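/- Notation. For $s>0$ let $D_s=\{\xi\in\mathbb C:|\xi|<s\}$ and $D=D_1$; a prime and a superscript $(n)$ denote derivatives in $\xi$. For an open set $U\subseteq\mathbb C$ let $H(U)$ be the space of analytic functions on $U$ with the topology of locally uniform convergence. For $E\subseteq\mathbb C$ let $O(E)$ be the set of functions $f$ that are analytic and univalent in a neighbourhood of $E$ and satisfy $f(0)=0$, $f'(0)>0$. For power series put \[ \Big|\sum_{i\ge0}a_i\xi^i\Big|_{M(r)}=\sum_{i\ge0}|a_i|r^i,\qquad \Big\|\sum_{j\ge1}v_j\xi^j\Big\|_{\rho,n}=\sum_{j\ge1}|v_j|\,\rho^j j^{\frac12+n}. \] Let $\sigma=1$ (injection) or $\sigma=-1$ (suction). A strong solution on a time interval $I$ of the Polubarinova–Galin equation \[ \operatorname{Re}\big[f_t(\xi,t)\,\overline{f'(\xi,t)\,\xi}\big]=\sigma,\qquad |\xi|=1,\ t\in I, \tag{PG} \] is a function $f$ satisfying (PG) such that $f(\cdot,t)\in O(\overline D)$ for every $t\in I$ and $f$ is continuously differentiable in $t$ (one-sidedly at end points of $I$ that belong to $I$), in the sense that every $t\in I$ has a neighbourhood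 $J$ in $I$ and an $R>1$ with $f\in C^1(J,H(D_R))$. Theorem. Let $T_0>0$ and $r>1$, and let $f_{k_0}$ be a strong solution of (PG) on $[0,T_0]$ such that for every $t\in[0,T_0]$ the function $f_{k_0}(\cdot,t)$ is a polynomial of degree $k_0$ and $f_{k_0}(\cdot,t)\in O(\overline{D_r})$. Then for every $\varepsilon>0$, every integer $k\ge0$ and every $r'$ with $1<r'<r$ there are $\delta>0$ and $\rho>1$ such that the following holds for every function $f_0$ that is analytic in a neighbourhood of $\overline D$ and satisfies $f_0(0)=0$, $f_0'(0)>0$ and \[ \|f_0-f_{k_0}(\cdot,0)\|_{\rho,k}<\delta . \] There is a strong solution $f$ of (PG) on $[0,T_0]$ with $f(\cdot,0)=f_0$ on $\overline D$. It is unique: every strong solution of (PG) on an interval $[0,b)$, $b>0$, with initial function $f_0$ agrees with $f$ on $\overline D$ for all $t\in[0,b)\cap[0,T_0]$. Moreover, $f(\cdot,t)\in O(\overline{D_{r'}})$ for all $t\in[0,T_0]$, $f\in C^1([0,T_0],H(D_r))$, and \[ \big|f_{k_0}^{(n)}(\cdot,t)-f^{(n)}(\cdot,t)\big|_{M(r)}<\varepsilon\qquad(0\le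 n\le k,\ 0\le t\le T_0). \] -/

import Mathlib

open Set Filter Topology

noncomputable section

namespace HeleShaw

/-- The class `O(E)`: `f` is analytic and univalent (injective) in a neighbourhood of `E`,
`f 0 = 0`, and `f' 0` is a positive real number. -/
def InO (E : Set ℂ) (f : ℂ → ℂ) : Prop :=
  (∃ U : Set ℂ, IsOpen U ∧ E ⊆ U ∧ DifferentiableOn ℂ f U ∧ InjOn f U) ∧
    f 0 = 0 ∧ 0 < (deriv f 0).re ∧ (deriv f 0).im = 0

/-- On the set of times `I`, the map `t ↦ f t` is continuously differentiable with derivative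
`t ↦ ft t`, as a map into the space `H(U)` of analytic functions on the open set `U` with the
topology of locally uniform convergence. At end points of `I` derivatives are one-sided. -/
structure HasContTimeDeriv (U : Set ℂ) (I : Set ℝ) (f ft : ℝ → ℂ → ℂ) : Prop where
  analytic : ∀ t ∈ I, DifferentiableOn ℂ (f t) U
  analytic_deriv : ∀ t ∈ I, DifferentiableOn ℂ (ft t) U
  hasDeriv : ∀ t ∈ I, TendstoLocallyUniformlyOn
    (fun (s : ℝ) (ξ : ℂ) => (f s ξ - f t ξ) / ((s : ℂ) - (t : ℂ))) (ft t) (𝓝[I \ {t}] t) U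
  cont : ∀ t ∈ I, TendstoLocallyUniformlyOn ft (ft t) (𝓝[I] t) U

/-- `f ∈ C¹(I, H(U))`. -/
def IsC1InH (U : Set ℂ) (I : Set ℝ) (f : ℝ → ℂ → ℂ) : Prop :=
  ∃ ft : ℝ → ℂ → ℂ, HasContTimeDeriv U I f ft

/-- `f` is a strong solution, for times in the interval `I`, of the Polubarinova–Galin equation
`Re [f_t(ξ,t) * conj (f'(ξ,t) ξ)] = σ` on `|ξ| = 1` (`σ = 1`: injection, `σ = -1`: suction).
Every `f t` is univalent and analytic in a neighbourhood of the closed unit disk, normalised at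
`0`, and `f` is continuously differentiable in time, locally in time as a map into the analytic
functions on a common neighbourhood of the closed unit disk. -/
def IsStrongSolution (σ : ℝ) (I : Set ℝ) (f : ℝ → ℂ → ℂ) : Prop :=
  (∀ t ∈ I, InO (Metric.closedBall 0 1) (f t)) ∧
  ∃ ft : ℝ → ℂ → ℂ,
    (∀ t ∈ I, ∃ R > (1 : ℝ), ∃ η > (0 : ℝ),
      HasContTimeDeriv (Metric.ball 0 R) (I ∩ Metric.ball t η) f ft) ∧
    ∀ t ∈ I, ∀ ξ : ℂ, ‖ξ‖ = 1 →
      (ft t ξ * (starRingEnd ℂ) (deriv (f t) ξ * ξ)).re = σ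

/-- The `n`-th Taylor coefficient of `f` at `0`. -/
def taylorCoeff (f : ℂ → ℂ) (n : ℕ) : ℂ := iteratedDeriv n f 0 / (n.factorial : ℂ)

/-- The norm `|∑ aᵢ ξⁱ|_{M(r)} = ∑ |aᵢ| rⁱ`, with values in `[0, ∞]`. -/
def normM (r : ℝ) (f : ℂ → ℂ) : ENNReal :=
  ∑' i : ℕ, ENNReal.ofReal (‖taylorCoeff f i‖ * r ^ i)

/-- The norm `‖∑_{j ≥ 1} vⱼ ξʲ‖_{ρ,n} = ∑_{j ≥ 1} |vⱼ| ρʲ j^{1/2+n}`, with values in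
`[0, ∞]`; the summation index is shifted by one. -/
def normRho (ρ : ℝ) (n : ℕ) (v : ℂ → ℂ) : ENNReal :=
  ∑' j : ℕ, ENNReal.ofReal
    (‖taylorCoeff v (j + 1)‖ * ρ ^ (j + 1) * ((j : ℝ) + 1) ^ ((1 : ℝ) / 2 + (n : ℝ)))

end HeleShaw

end

noncomputable section
namespace HeleShaw

open PowerSeries
open scoped ENNReal

section FiniteSums

open Finset

/-! ### Weighted ℓ¹ norms and correlations of power series over a normed ring -/

section Sequences

variable {A : Type*} [NormedCommRing A]

/-! Write D = f' and q = 1/f'. Dividing (PG) by |f'|² on the circle gives Re(f_t / (ξ f')) = σ|q|².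
Hence f_t = ξ D p, where p is analytic in the disk, real at 0, and has real part σ|q|² on the circle
(`herglotz`). For the coefficients of D this is the system D_j' = (j+1)(D p)_j, which loses one
derivative in ξ (`taylorCoeff_succ_eq`, `rhs`).

The system is solved by a contraction in ℓ¹ norms of coefficient sequences whose weights decay in
time at rate at least K(j+1). Integration in time then gains 1/(K(j+1)), which cancels the factor
j+1 and leaves 1/K (`wnorm_primSeries_le`). What remains is a Lipschitz bound for D ↦ D p in such
norms with a constant independent of K.

This bound rests on an identity. On the circle p + conj p = 2σ|q|² and D|q|² = conj q, so D p = 2σ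
conj q - D conj p. In nonnegative orders the right-hand side is a constant minus the correlation ∑ᵢ
D_{j+i} conj p_i (`mul_herglotz`). A correlation only lowers indices, so with weights increasing in
j only D has to carry them, while p and q are measured on the closed unit disk alone
(`wnorm_mul_herglotz_sub_le`). The radius of the norm may therefore be as large as desired, even if
f' has zeros inside that radius.

To reach the whole time interval, the reference solution must have a weighted norm independent of K;
this is where it matters that it is a polynomial. The weights are products of e_j, equal to 1 for j
< k₀, and a factor μ(t) independent of j. The reference is measured with e_j, hence in plain ℓ¹, and
differences with e_j μ. So K can be fixed first, and the initial perturbation has to be small at the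
radius S exp(KT) (`exists_coeff_solution`).

Closeness at the radius S = 2r bounds the derivatives in the norm at radius r. It also gives
univalence, because the difference quotients of the polynomials are bounded below by compactness
(`exists_bounds_polynomial`, `injOn_of_norm_deriv_sub_le`). Uniqueness is the same contraction for
two arbitrary strong solutions on a short interval (`IsStrongSolution.eq_taylorCoeff_of_eq`),
followed by continuation. -/

theorem enorm_mul_le_mul (x y : A) : ‖x * y‖ₑ ≤ ‖x‖ₑ * ‖y‖ₑ := by
  simp only [← ofReal_norm]
  rw [← ENNReal.ofReal_mul (norm_nonneg _)]
  exact ENNReal.ofReal_le_ofReal (norm_mul_le _ _)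

theorem enorm_mul_tsum_le {ι : Type*} (c : A) (x : ι → A) :
    ‖c * ∑' i, x i‖ₑ ≤ ∑' i, ‖c * x i‖ₑ := by
  by_cases h : Summable x
  · rw [← h.tsum_mul_left]
    exact enorm_tsum_le_tsum_enorm
  · rw [tsum_eq_zero_of_not_summable h]
    simp

/-- The weighted `ℓ¹` norm `∑ ‖eⱼ Dⱼ‖` of a power series with coefficients in a normed ring. -/
def wnorm (e : ℕ → A) (D : PowerSeries A) : ℝ≥0∞ := ∑' j, ‖e j * coeff j D‖ₑ

/-- The unweighted `ℓ¹` norm of the coefficients of a power series. -/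
abbrev l1norm (D : PowerSeries A) : ℝ≥0∞ := wnorm (fun _ => 1) D

theorem l1norm_eq (D : PowerSeries A) : l1norm D = ∑' j, ‖coeff j D‖ₑ := by
  simp [wnorm]

theorem wnorm_add_le (e : ℕ → A) (a b : PowerSeries A) :
    wnorm e (a + b) ≤ wnorm e a + wnorm e b := by
  unfold wnorm
  rw [← ENNReal.tsum_add]
  refine ENNReal.tsum_le_tsum fun j => ?_
  rw [map_add, mul_add]
  exact enorm_add_le _ _

theorem wnorm_neg (e : ℕ → A) (a : PowerSeries A) : wnorm e (-a) = wnorm e a := by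
  simp [wnorm]

theorem wnorm_sub_le (e : ℕ → A) (a b : PowerSeries A) :
    wnorm e (a - b) ≤ wnorm e a + wnorm e b := by
  rw [sub_eq_add_neg, ← wnorm_neg e b]
  exact wnorm_add_le _ _ _

theorem wnorm_sub_comm (e : ℕ → A) (a b : PowerSeries A) :
    wnorm e (a - b) = wnorm e (b - a) := by
  rw [← wnorm_neg, neg_sub]

theorem wnorm_mono {e e' : ℕ → A} (h : ∀ j x, ‖e j * x‖ₑ ≤ ‖e' j * x‖ₑ) (a : PowerSeries A) :
    wnorm e a ≤ wnorm e' a :=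
  ENNReal.tsum_le_tsum fun j => h j _

theorem enorm_coeff_le_wnorm (e : ℕ → A) (a : PowerSeries A) (j : ℕ) :
    ‖e j * coeff j a‖ₑ ≤ wnorm e a :=
  ENNReal.le_tsum j

/-- The Cauchy product of two series of extended nonnegative numbers. -/
theorem tsum_sum_antidiagonal (u v : ℕ → ℝ≥0∞) :
    ∑' n, ∑ p ∈ antidiagonal n, u p.1 * v p.2 = (∑' i, u i) * ∑' j, v j := by
  calc ∑' n, ∑ p ∈ antidiagonal n, u p.1 * v p.2
      = ∑' (x : Σ n : ℕ, antidiagonal n), u x.2.1.1 * v x.2.1.2 := by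
        rw [ENNReal.tsum_sigma']
        refine tsum_congr fun n => ?_
        rw [tsum_fintype, ← Finset.sum_coe_sort]
    _ = ∑' p : ℕ × ℕ, u p.1 * v p.2 :=
        HasAntidiagonal.sigmaAntidiagonalEquivProd.tsum_eq (fun p : ℕ × ℕ => u p.1 * v p.2)
    _ = _ := by
        rw [ENNReal.tsum_prod (f := fun i j => u i * v j), ← ENNReal.tsum_mul_right]
        exact tsum_congr fun i => ENNReal.tsum_mul_left

/-- The weight does not depend on the index, so it can be put entirely on one factor of the Cauchy
product. -/
theorem wnorm_mul_le (μ : A) (a b : PowerSeries A) :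
    wnorm (fun _ => μ) (a * b) ≤ l1norm a * wnorm (fun _ => μ) b := by
  rw [l1norm_eq]
  unfold wnorm
  rw [← tsum_sum_antidiagonal]
  refine ENNReal.tsum_le_tsum fun n => ?_
  rw [coeff_mul, Finset.mul_sum]
  refine (enorm_sum_le _ _).trans (Finset.sum_le_sum fun p _ => ?_)
  rw [mul_left_comm]
  exact enorm_mul_le_mul _ _

theorem summable_of_l1norm_ne_top {a : PowerSeries A} (h : l1norm a ≠ ∞) :
    Summable fun n => ‖coeff n a‖ := by
  rw [l1norm_eq] at h
  have := ENNReal.summable_toReal h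
  simpa using this

theorem l1norm_ne_top_of_summable {a : PowerSeries A} (h : Summable fun n => ‖coeff n a‖) :
    l1norm a ≠ ∞ := by
  rw [l1norm_eq]
  have := h.tsum_ofReal_ne_top
  simpa [ofReal_norm] using this

/-- A bound for the `ℓ¹` norm of the inverse of a small perturbation of the unit series. -/
theorem l1norm_le_two_of_mul_eq_one {x y : PowerSeries A} (hx : l1norm x ≤ 2⁻¹)
    (h : (1 + x) * y = 1) (h1 : ‖(1 : A)‖ₑ ≤ 1) : l1norm y ≤ 2 := by
  rw [l1norm_eq] at hx ⊢
  refine ENNReal.tsum_le_of_sum_range_le fun n => ?_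
  -- Summability of y is not known beforehand. Partial sums are finite, so S ≤ 1 + S/2 can be
  -- absorbed.
  set S := ∑ i ∈ range n, ‖coeff i y‖ₑ with hS
  have hfin : S ≠ ∞ := ENNReal.sum_ne_top.2 fun i _ => enorm_ne_top
  have hy : y = 1 - x * y := by linear_combination h
  have hconv : ∑ i ∈ range n, ‖coeff i (x * y)‖ₑ ≤ 2⁻¹ * S := by
    calc ∑ i ∈ range n, ‖coeff i (x * y)‖ₑ
        ≤ ∑ i ∈ range n, ∑ p ∈ antidiagonal i,
            -- Truncating y at n costs nothing for the indices i < n and makes the full Cauchy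
            -- product bounded by S.
            ‖coeff p.1 x‖ₑ * (if p.2 < n then ‖coeff p.2 y‖ₑ else 0) := by
          refine Finset.sum_le_sum fun i hi => ?_
          rw [coeff_mul]
          refine (enorm_sum_le _ _).trans (Finset.sum_le_sum fun p hp => ?_)
          have : p.2 < n := by
            have := mem_antidiagonal.1 hp
            have := mem_range.1 hi
            omega
          rw [if_pos this]
          exact enorm_mul_le_mul _ _
      _ ≤ ∑' i, ∑ p ∈ antidiagonal i,
            ‖coeff p.1 x‖ₑ * (if p.2 < n then ‖coeff p.2 y‖ₑ else 0) := ENNReal.sum_le_tsum _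
      _ = (∑' i, ‖coeff i x‖ₑ) * ∑' j, (if j < n then ‖coeff j y‖ₑ else 0) :=
          tsum_sum_antidiagonal (fun i => ‖coeff i x‖ₑ)
            (fun j => if j < n then ‖coeff j y‖ₑ else 0)
      _ ≤ 2⁻¹ * S := by
          refine mul_le_mul' hx (le_of_eq ?_)
          rw [tsum_eq_sum (s := range n) (by intro b hb; simp at hb; simp [hb])]
          exact Finset.sum_congr rfl fun i hi => by simp [mem_range.1 hi]
  have hone : ∑ i ∈ range n, ‖coeff i (1 : PowerSeries A)‖ₑ ≤ 1 := by
    refine (ENNReal.sum_le_tsum _).trans ?_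
    rw [tsum_eq_single 0 (by intro b hb; simp [coeff_one, hb])]
    simpa using h1
  have hle : S ≤ 1 + 2⁻¹ * S := by
    calc S = ∑ i ∈ range n, ‖coeff i (1 - x * y)‖ₑ := by rw [← hy]
      _ ≤ ∑ i ∈ range n, (‖coeff i (1 : PowerSeries A)‖ₑ + ‖coeff i (x * y)‖ₑ) := by
          refine Finset.sum_le_sum fun i _ => ?_
          rw [map_sub]
          exact enorm_sub_le
      _ ≤ 1 + 2⁻¹ * S := by
          rw [Finset.sum_add_distrib]
          exact add_le_add hone hconv
  clear_value S
  clear hS hconv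
  lift S to NNReal using hfin
  have h2 : ((2 : ℝ≥0∞)⁻¹) = ((2⁻¹ : NNReal) : ℝ≥0∞) := by simp
  rw [h2] at hle
  norm_cast at hle ⊢
  have : (S : ℝ) ≤ 1 + 2⁻¹ * S := by exact_mod_cast hle
  have h3 : (S : ℝ) ≤ 2 := by linarith
  exact_mod_cast h3

/-- The series with all coefficients doubled except for the constant one. -/
def dbl (h : PowerSeries A) : PowerSeries A := 2 * h - C (coeff 0 h)

theorem coeff_dbl (h : PowerSeries A) (n : ℕ) :
    coeff n (dbl h) = 2 * coeff n h - if n = 0 then coeff 0 h else 0 := by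
  have h2 : coeff n (2 * h) = 2 * coeff n h := by rw [two_mul, two_mul, map_add]
  rw [dbl, map_sub, h2, coeff_C]

theorem dbl_sub (a b : PowerSeries A) : dbl a - dbl b = dbl (a - b) := by
  simp only [dbl, map_sub]; ring

theorem wnorm_dbl_le (μ : A) (h : PowerSeries A) :
    wnorm (fun _ => μ) (dbl h) ≤ 2 * wnorm (fun _ => μ) h := by
  unfold wnorm
  rw [← ENNReal.tsum_mul_left]
  refine ENNReal.tsum_le_tsum fun j => ?_
  have h2 : coeff j (2 * h) = coeff j h + coeff j h := by rw [two_mul, map_add]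
  by_cases hj : j = 0
  · subst hj
    rw [dbl, map_sub, h2, coeff_zero_C, add_sub_cancel_right, two_mul]
    exact self_le_add_right _ _
  · rw [dbl, map_sub, h2, coeff_C, if_neg hj, sub_zero, mul_add, two_mul]
    exact enorm_add_le _ _

theorem wnorm_C_mul_le (μ σ : A) (hσ : ‖σ‖ₑ ≤ 1) (h : PowerSeries A) :
    wnorm (fun _ => μ) (C σ * h) ≤ wnorm (fun _ => μ) h := by
  unfold wnorm
  refine ENNReal.tsum_le_tsum fun j => ?_
  rw [coeff_C_mul, mul_left_comm]
  refine (enorm_mul_le_mul _ _).trans ?_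
  calc _ ≤ 1 * ‖μ * coeff j h‖ₑ := by gcongr
    _ = _ := one_mul _

theorem norm_coeff_le_of_l1norm {a : PowerSeries A} (h : l1norm a ≠ ∞) :
    ∃ M, ∀ n, ‖coeff n a‖ ≤ M :=
  ⟨_, fun n => (summable_of_l1norm_ne_top h).le_tsum n fun _ _ => norm_nonneg _⟩

variable [StarRing A]

/-- The correlation `∑ᵢ aₙ₊ᵢ bᵢ*` of two power series. -/
def corr (a b : PowerSeries A) : PowerSeries A :=
  PowerSeries.mk fun n => ∑' i, coeff (n + i) a * star (coeff i b)

theorem coeff_corr (a b : PowerSeries A) (n : ℕ) :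
    coeff n (corr a b) = ∑' i, coeff (n + i) a * star (coeff i b) := by
  simp [corr]

/-- The series `p` with `Re p = σ |q|²` on the unit circle and real constant coefficient. -/
def herglotz (σ : A) (q : PowerSeries A) : PowerSeries A := dbl (C σ * corr q q)

theorem coeff_herglotz (σ : A) (q : PowerSeries A) (n : ℕ) :
    coeff n (herglotz σ q) = σ * (2 * coeff n (corr q q) -
      if n = 0 then coeff 0 (corr q q) else 0) := by
  rw [herglotz, coeff_dbl, coeff_C_mul, coeff_C_mul]
  split_ifs <;> ring

variable [NormedStarGroup A]

theorem enorm_star' (x : A) : ‖star x‖ₑ = ‖x‖ₑ := by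
  simp [← ofReal_norm]

/-- The coefficient of order j only involves a at indices j + i, where the weight is at least e j.
So a carries the growing weights and b only the factor μ. -/
theorem wnorm_corr_le {e : ℕ → A} {μ : A} (he : ∀ j i x, ‖e j * x‖ₑ ≤ ‖e (j + i) * x‖ₑ)
    (hμ : star μ = μ) (a b : PowerSeries A) :
    wnorm (fun j => e j * μ) (corr a b) ≤ wnorm e a * wnorm (fun _ => μ) b := by
  unfold wnorm
  calc ∑' j, ‖e j * μ * coeff j (corr a b)‖ₑ
      ≤ ∑' j, ∑' i, ‖e (j + i) * coeff (j + i) a‖ₑ * ‖μ * coeff i b‖ₑ := by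
        refine ENNReal.tsum_le_tsum fun j => ?_
        rw [coeff_corr]
        refine (enorm_mul_tsum_le _ _).trans (ENNReal.tsum_le_tsum fun i => ?_)
        calc ‖e j * μ * (coeff (j + i) a * star (coeff i b))‖ₑ
            = ‖(e j * coeff (j + i) a) * star (μ * coeff i b)‖ₑ := by
              rw [star_mul, hμ]; congr 1; ring
          _ ≤ ‖e j * coeff (j + i) a‖ₑ * ‖star (μ * coeff i b)‖ₑ := enorm_mul_le_mul _ _
          _ ≤ _ := by rw [enorm_star']; gcongr; exact he _ _ _
    _ = ∑' i, (∑' j, ‖e (j + i) * coeff (j + i) a‖ₑ) * ‖μ * coeff i b‖ₑ := by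
        rw [ENNReal.tsum_comm]
        exact tsum_congr fun i => ENNReal.tsum_mul_right
    _ ≤ ∑' i, (∑' j, ‖e j * coeff j a‖ₑ) * ‖μ * coeff i b‖ₑ := by
        refine ENNReal.tsum_le_tsum fun i => ?_
        exact mul_le_mul_left (ENNReal.tsum_comp_le_tsum_of_injective (add_left_injective i)
          (fun j => ‖e j * coeff j a‖ₑ)) _
    _ = _ := ENNReal.tsum_mul_left

theorem wnorm_corr_le_right (μ : A) (hμ : star μ = μ) (a b : PowerSeries A) :
    wnorm (fun _ => μ) (corr a b) ≤ l1norm a * wnorm (fun _ => μ) b := by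
  simpa using wnorm_corr_le (e := fun _ => (1 : A)) (μ := μ) (fun _ _ _ => le_rfl) hμ a b

theorem wnorm_corr_le_left (μ : A) (a b : PowerSeries A) :
    wnorm (fun _ => μ) (corr a b) ≤ wnorm (fun _ => μ) a * l1norm b := by
  simpa using wnorm_corr_le (e := fun _ => μ) (μ := 1) (fun _ _ _ => le_rfl) (by simp) a b

variable [CompleteSpace A]

theorem summable_corr {a b : PowerSeries A} (ha : l1norm a ≠ ∞) (hb : l1norm b ≠ ∞) (n : ℕ) :
    Summable fun i => coeff (n + i) a * star (coeff i b) := by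
  obtain ⟨M, hM⟩ := norm_coeff_le_of_l1norm ha
  refine Summable.of_norm_bounded ((summable_of_l1norm_ne_top hb).mul_left M) fun i => ?_
  refine (norm_mul_le _ _).trans ?_
  rw [norm_star]
  gcongr
  exact hM _

theorem corr_sub_left {a a' b : PowerSeries A} (ha : l1norm a ≠ ∞) (ha' : l1norm a' ≠ ∞)
    (hb : l1norm b ≠ ∞) : corr (a - a') b = corr a b - corr a' b := by
  ext n
  rw [map_sub, coeff_corr, coeff_corr, coeff_corr,
    ← (summable_corr ha hb n).tsum_sub (summable_corr ha' hb n)]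
  simp [sub_mul]

theorem corr_sub_right {a b b' : PowerSeries A} (ha : l1norm a ≠ ∞) (hb : l1norm b ≠ ∞)
    (hb' : l1norm b' ≠ ∞) : corr a (b - b') = corr a b - corr a b' := by
  ext n
  rw [map_sub, coeff_corr, coeff_corr, coeff_corr,
    ← (summable_corr ha hb n).tsum_sub (summable_corr ha hb' n)]
  simp [mul_sub]

end Sequences

/-! ### The identity for D p and the Lipschitz estimate -/

section Identity

variable {A : Type*} [NormedCommRing A] [StarRing A] [NormedStarGroup A]

theorem star_coeff_zero_corr (q : PowerSeries A) :
    star (coeff 0 (corr q q)) = coeff 0 (corr q q) := by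
  rw [coeff_corr, tsum_star]
  simp [mul_comm]

theorem l1norm_corr_ne_top {a b : PowerSeries A} (ha : l1norm a ≠ ∞) (hb : l1norm b ≠ ∞) :
    l1norm (corr a b) ≠ ∞ :=
  ne_top_of_le_ne_top (ENNReal.mul_ne_top ha hb) (wnorm_corr_le_left 1 a b)

theorem l1norm_herglotz_le {σ : A} (hσ : ‖σ‖ₑ ≤ 1) (q : PowerSeries A) :
    l1norm (herglotz σ q) ≤ 2 * (l1norm q * l1norm q) :=
  (wnorm_dbl_le 1 _).trans (mul_le_mul_right ((wnorm_C_mul_le 1 σ hσ _).trans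
    (wnorm_corr_le_left 1 q q)) _)

variable [CompleteSpace A]

/-- Multiplying `|q|²` by a series `D` with `D q = 1` leaves the conjugate of `q`; only the
coefficients of nonnegative order are recorded. -/
theorem sum_mul_corr_add_tsum {D q : PowerSeries A} (hD : l1norm D ≠ ∞) (hq : l1norm q ≠ ∞)
    (h : D * q = 1) (j : ℕ) :
    ∑ i ∈ range (j + 1), coeff (j - i) D * coeff i (corr q q) +
      ∑' i, coeff (j + (i + 1)) D * star (coeff (i + 1) (corr q q)) =
      if j = 0 then star (coeff 0 q) else 0 := by
  have hqs := summable_of_l1norm_ne_top hq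
  have hDs := summable_of_l1norm_ne_top hD
  obtain ⟨M, hM⟩ := norm_coeff_le_of_l1norm hq
  obtain ⟨M', hM'⟩ := norm_coeff_le_of_l1norm hD
  have hM0 : 0 ≤ M := (norm_nonneg _).trans (hM 0)
  have hM0' : 0 ≤ M' := (norm_nonneg _).trans (hM' 0)
  -- The coefficient of D q of order j + m is split at the index m of q. Multiplied by conj q_m and
  -- summed over m, the part `T₁` produces the coefficients of |q|² of order i ≥ 0 and `T₂` those of
  -- negative order.
  set T₁ : ℕ → A := fun m => ∑ i ∈ range (j + 1), coeff (j - i) D * coeff (m + i) q with hT₁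
  set T₂ : ℕ → A := fun m => ∑ b ∈ range m, coeff (j + m - b) D * coeff b q with hT₂
  have hT : ∀ m, T₂ m + T₁ m = if j + m = 0 then 1 else 0 := by
    intro m
    have : coeff (j + m) (D * q) = if j + m = 0 then 1 else 0 := by rw [h, coeff_one]
    rw [← this, mul_comm D q, coeff_mul,
      Finset.Nat.sum_antidiagonal_eq_sum_range_succ
        (fun a b => coeff a q * coeff b D), Nat.succ_eq_add_one,
      show j + m + 1 = m + (j + 1) by ring, Finset.sum_range_add]
    congr 1
    · exact Finset.sum_congr rfl fun b _ => mul_comm _ _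
    · refine Finset.sum_congr rfl fun b _ => ?_
      rw [mul_comm, show j + m - (m + b) = j - b by omega]
  have hS₁ : HasSum (fun m => star (coeff m q) * T₁ m)
      (∑ i ∈ range (j + 1), coeff (j - i) D * coeff i (corr q q)) := by
    have : ∀ i ∈ range (j + 1), HasSum
        (fun m => star (coeff m q) * (coeff (j - i) D * coeff (m + i) q))
        (coeff (j - i) D * coeff i (corr q q)) := by
      intro i _
      rw [coeff_corr]
      have := ((summable_corr hq hq i).hasSum).mul_left (coeff (j - i) D)
      refine this.congr_fun ?_
      intro m
      rw [add_comm i m]; ring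
    have := hasSum_sum this
    simpa [hT₁, Finset.mul_sum] using this
  -- The double series behind `T₂`, with m = i + 1 + b; its absolute convergence allows summation by
  -- rows or along antidiagonals.
  let g : ℕ × ℕ → A := fun p =>
    coeff (j + (p.1 + 1)) D * star (coeff (p.1 + 1 + p.2) q) * coeff p.2 q
  have hg : Summable g := by
    have hb : Summable fun p : ℕ × ℕ => ‖coeff (j + (p.1 + 1)) D‖ * (M * ‖coeff p.2 q‖) := by
      refine Summable.mul_of_nonneg (f := fun i => ‖coeff (j + (i + 1)) D‖)
        (g := fun b => M * ‖coeff b q‖) ?_ (hqs.mul_left M) (fun _ => norm_nonneg _)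
        (fun _ => mul_nonneg hM0 (norm_nonneg _))
      refine hDs.comp_injective (i := fun i => j + (i + 1)) fun a b hab => ?_
      simpa using hab
    refine Summable.of_norm_bounded hb fun p => ?_
    simp only [g, mul_assoc]
    refine (norm_mul_le _ _).trans ?_
    gcongr
    refine (norm_mul_le _ _).trans ?_
    rw [norm_star]
    gcongr
    exact hM _
  have hS₂' : ∑' p, g p = ∑' i, coeff (j + (i + 1)) D * star (coeff (i + 1) (corr q q)) := by
    rw [hg.tsum_prod]
    refine tsum_congr fun i => ?_
    rw [coeff_corr, tsum_star, ← Summable.tsum_mul_left]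
    · refine tsum_congr fun b => ?_
      simp only [g, star_mul, star_star]
      ring
    · simpa using ((summable_corr hq hq (i + 1)).star)
  have hS₂ : HasSum (fun m => star (coeff m q) * T₂ m) (∑' p, g p) := by
    have hsig := ((HasAntidiagonal.sigmaAntidiagonalEquivProd (A := ℕ)).hasSum_iff.2
      hg.hasSum).sigma (fun n => hasSum_fintype _)
    have hshift : HasSum (fun n => star (coeff (n + 1) q) * T₂ (n + 1)) (∑' p, g p) := by
      refine hsig.congr_fun fun n => ?_
      simp only [Function.comp_def, HasAntidiagonal.sigmaAntidiagonalEquivProd_apply]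
      rw [Finset.sum_coe_sort (antidiagonal n) g, hT₂, Finset.mul_sum,
        ← Finset.Nat.sum_antidiagonal_swap,
        Finset.Nat.sum_antidiagonal_eq_sum_range_succ_mk]
      refine Finset.sum_congr rfl fun b hb => ?_
      have hb' : b ≤ n := by have := mem_range.1 hb; omega
      simp only [g, Prod.swap]
      rw [show n - b + 1 + b = n + 1 by omega, show j + (n - b + 1) = j + (n + 1) - b by omega]
      ring
    -- The term m = 0 dropped by the shift vanishes, since `T₂ 0` is an empty sum.
    have := (hasSum_nat_add_iff (f := fun m => star (coeff m q) * T₂ m) 1).1 hshift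
    simpa [hT₂] using this
  have hsum := (hS₂.add hS₁).unique (f := fun m => star (coeff m q) * T₂ m + star (coeff m q) * T₁ m)
    (a₂ := if j = 0 then star (coeff 0 q) else 0) (by
      have : (fun m => star (coeff m q) * T₂ m + star (coeff m q) * T₁ m) =
          fun m => if m = 0 then (if j = 0 then star (coeff 0 q) else 0) else 0 := by
        funext m
        rw [← mul_add, hT]
        by_cases hm : m = 0 <;> by_cases hj : j = 0 <;> simp [hm, hj]
      rw [this]
      exact hasSum_ite_eq 0 _)
  rw [← hsum, hS₂', add_comm]

variable {σ : A}

/-- The product `D p` and the correlation of `D` and `p` are opposite up to a constant. -/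
theorem mul_herglotz (hσ : star σ = σ) {D q : PowerSeries A} (hD : l1norm D ≠ ∞)
    (hq : l1norm q ≠ ∞) (h : D * q = 1) :
    D * herglotz σ q = C (2 * σ * star (coeff 0 q)) - corr D (herglotz σ q) := by
  have hc := l1norm_corr_ne_top hq hq
  ext j
  -- This is D|q|² = conj q in order j. The two sides below distribute 2σ|q|² = p + conj p; the term
  -- of order 0 of |q|² is shared equally by p and conj p.
  have key := sum_mul_corr_add_tsum hD hq h j
  have e1 : coeff j (D * herglotz σ q) =
      σ * (2 * ∑ i ∈ range (j + 1), coeff (j - i) D * coeff i (corr q q) -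
        coeff j D * coeff 0 (corr q q)) := by
    rw [mul_comm D, coeff_mul, Finset.Nat.sum_antidiagonal_eq_sum_range_succ
        (fun a b => coeff a (herglotz σ q) * coeff b D)]
    have : coeff j D * coeff 0 (corr q q) = ∑ i ∈ range (j + 1),
        coeff (j - i) D * if i = 0 then coeff 0 (corr q q) else 0 := by
      simp
    rw [this, Finset.mul_sum, ← Finset.sum_sub_distrib, Finset.mul_sum]
    refine Finset.sum_congr rfl fun i _ => ?_
    rw [coeff_herglotz]; ring
  have e2 : coeff j (corr D (herglotz σ q)) =
      σ * (2 * ∑' i, coeff (j + (i + 1)) D * star (coeff (i + 1) (corr q q)) +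
        coeff j D * coeff 0 (corr q q)) := by
    rw [coeff_corr]
    have hs : ∀ i, coeff (j + (i + 1)) D * star (coeff (i + 1) (herglotz σ q)) =
        (σ * 2) * (coeff (j + (i + 1)) D * star (coeff (i + 1) (corr q q))) := by
      intro i
      rw [coeff_herglotz]
      simp [hσ]
      ring
    have hsm := (summable_nat_add_iff 1).2 (summable_corr hD hc j)
    rw [tsum_eq_zero_add']
    · rw [tsum_congr hs, hsm.tsum_mul_left, coeff_herglotz]
      have := star_coeff_zero_corr q
      simp [hσ] at this ⊢
      rw [this]
      ring
    · exact (hsm.mul_left (σ * 2)).congr fun i => (hs i).symm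
  rw [map_sub, e1, e2, coeff_C]
  have : (if j = 0 then 2 * σ * star (coeff 0 q) else 0) =
      2 * σ * (if j = 0 then star (coeff 0 q) else 0) := by split_ifs <;> simp
  rw [this, ← key]
  ring

/-- The Lipschitz estimate for the right-hand side of the evolution equation, in a weighted norm
in which only the first factor needs the full weights. -/
theorem wnorm_mul_herglotz_sub_le (hσ : star σ = σ) (hσ' : ‖σ‖ₑ ≤ 1) {D₁ D₂ q₁ q₂ : PowerSeries A}
    (h₁ : D₁ * q₁ = 1) (h₂ : D₂ * q₂ = 1) (hD₁ : l1norm D₁ ≠ ∞) (hD₂ : l1norm D₂ ≠ ∞)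
    {Q Φ E : ℝ≥0∞} (hQ : Q ≠ ∞) (hq₁ : l1norm q₁ ≤ Q) (hq₂ : l1norm q₂ ≤ Q)
    {e : ℕ → A} {μ : A} (hμ : star μ = μ) (he : ∀ j i x, ‖e j * x‖ₑ ≤ ‖e (j + i) * x‖ₑ)
    (he1 : ∀ x, ‖x‖ₑ ≤ ‖e 0 * x‖ₑ) (hE : ‖e 0‖ₑ ≤ E) (hΦ : wnorm e D₂ ≤ Φ) :
    wnorm (fun j => e j * μ) (D₁ * herglotz σ q₁ - D₂ * herglotz σ q₂) ≤
      (2 * E * Q ^ 2 + 2 * Q ^ 2 + 4 * Φ * Q ^ 3) * wnorm (fun j => e j * μ) (D₁ - D₂) := by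
  have hq₁' : l1norm q₁ ≠ ∞ := ne_top_of_le_ne_top hQ hq₁
  have hq₂' : l1norm q₂ ≠ ∞ := ne_top_of_le_ne_top hQ hq₂
  have hp : ∀ {q : PowerSeries A}, l1norm q ≤ Q → l1norm (herglotz σ q) ≤ 2 * Q ^ 2 := by
    intro q hq
    refine (l1norm_herglotz_le hσ' q).trans ?_
    rw [sq]
    gcongr
  have hpt : ∀ {q : PowerSeries A}, l1norm q ≤ Q → l1norm (herglotz σ q) ≠ ∞ := fun hq =>
    ne_top_of_le_ne_top (by finiteness) (hp hq)
  have hDd : l1norm (D₁ - D₂) ≠ ∞ :=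
    ne_top_of_le_ne_top (ENNReal.add_ne_top.2 ⟨hD₁, hD₂⟩) (wnorm_sub_le _ _ _)
  set N := wnorm (fun j => e j * μ) (D₁ - D₂) with hN
  have hμN : wnorm (fun _ => μ) (D₁ - D₂) ≤ N := by
    refine wnorm_mono (fun j x => ?_) _
    have := he 0 j (μ * x)
    rw [zero_add] at this
    rw [mul_assoc]
    exact (he1 _).trans this
  -- The resolvent identity q₁ - q₂ = q₁ q₂ (D₂ - D₁).
  have hdq : wnorm (fun _ => μ) (q₁ - q₂) ≤ Q ^ 2 * N := by
    have : q₁ - q₂ = q₁ * (q₂ * (D₂ - D₁)) := by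
      linear_combination q₂ * h₁ - q₁ * h₂
    rw [this, sq, mul_assoc]
    refine (wnorm_mul_le _ _ _).trans (mul_le_mul' hq₁ ((wnorm_mul_le _ _ _).trans
      (mul_le_mul' hq₂ ?_)))
    rw [wnorm_sub_comm]
    exact hμN
  have hdp : wnorm (fun _ => μ) (herglotz σ q₁ - herglotz σ q₂) ≤ 4 * Q ^ 3 * N := by
    have e1 : corr q₁ q₁ - corr q₂ q₂ = corr (q₁ - q₂) q₁ + corr q₂ (q₁ - q₂) := by
      rw [corr_sub_left hq₁' hq₂' hq₁', corr_sub_right hq₂' hq₁' hq₂']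
      ring
    rw [herglotz, herglotz, dbl_sub, ← mul_sub, e1]
    refine (wnorm_dbl_le _ _).trans ?_
    calc 2 * wnorm (fun _ => μ) (C σ * (corr (q₁ - q₂) q₁ + corr q₂ (q₁ - q₂)))
        ≤ 2 * (Q ^ 2 * N * Q + Q * (Q ^ 2 * N)) := by
          gcongr
          refine (wnorm_C_mul_le _ _ hσ' _).trans ((wnorm_add_le _ _ _).trans ?_)
          gcongr
          · exact (wnorm_corr_le_left _ _ _).trans (mul_le_mul' hdq hq₁)
          · exact (wnorm_corr_le_right _ hμ _ _).trans (mul_le_mul' hq₂ hdq)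
      _ = 4 * Q ^ 3 * N := by ring
  -- After `mul_herglotz` the growing weights fall on D₁ - D₂ in one correlation and on the fixed D₂
  -- in the other. The difference of the Herglotz series only meets μ.
  have hdecomp : D₁ * herglotz σ q₁ - D₂ * herglotz σ q₂ =
      C (2 * σ * star (coeff 0 (q₁ - q₂))) - corr (D₁ - D₂) (herglotz σ q₁) -
        corr D₂ (herglotz σ q₁ - herglotz σ q₂) := by
    rw [mul_herglotz hσ hD₁ hq₁' h₁, mul_herglotz hσ hD₂ hq₂' h₂,
      corr_sub_left hD₁ hD₂ (hpt hq₁), corr_sub_right hD₂ (hpt hq₁) (hpt hq₂)]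
    simp only [map_sub, star_sub, mul_sub]
    ring
  -- A constant series sees only the weight of index 0, hence the factor E.
  have hC : wnorm (fun j => e j * μ) (C (2 * σ * star (coeff 0 (q₁ - q₂)))) ≤
      2 * E * Q ^ 2 * N := by
    have h0 : wnorm (fun j => e j * μ) (C (2 * σ * star (coeff 0 (q₁ - q₂)))) =
        ‖e 0 * μ * (2 * σ * star (coeff 0 (q₁ - q₂)))‖ₑ := by
      unfold wnorm
      rw [tsum_eq_single 0 (by intro b hb; rw [coeff_C, if_neg hb, mul_zero, enorm_zero]), coeff_zero_C]
    rw [h0]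
    have e3 : e 0 * μ * (2 * σ * star (coeff 0 (q₁ - q₂))) =
        σ * (e 0 * star (μ * coeff 0 (q₁ - q₂))) + σ * (e 0 * star (μ * coeff 0 (q₁ - q₂))) := by
      rw [star_mul, hμ]; ring
    have e4 : ‖σ * (e 0 * star (μ * coeff 0 (q₁ - q₂)))‖ₑ ≤ 1 * (E * (Q ^ 2 * N)) := by
      refine (enorm_mul_le_mul _ _).trans (mul_le_mul' hσ' ((enorm_mul_le_mul _ _).trans
        (mul_le_mul' hE ?_)))
      rw [enorm_star']
      exact (enorm_coeff_le_wnorm (fun _ => μ) _ 0).trans hdq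
    rw [e3]
    refine (enorm_add_le _ _).trans ((add_le_add e4 e4).trans (le_of_eq ?_))
    ring
  rw [hdecomp]
  refine (wnorm_sub_le _ _ _).trans ((add_le_add_left (wnorm_sub_le _ _ _) _).trans ?_)
  have hb : wnorm (fun j => e j * μ) (corr (D₁ - D₂) (herglotz σ q₁)) ≤ N * (2 * Q ^ 2) := by
    have := wnorm_corr_le (e := fun j => e j * μ) (μ := 1)
      (fun j i x => by simpa only [mul_assoc] using he j i (μ * x)) (by simp)
      (D₁ - D₂) (herglotz σ q₁)
    simp only [mul_one] at this
    exact this.trans (mul_le_mul' le_rfl (hp hq₁))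
  have hc : wnorm (fun j => e j * μ) (corr D₂ (herglotz σ q₁ - herglotz σ q₂)) ≤
      Φ * (4 * Q ^ 3 * N) :=
    (wnorm_corr_le he hμ _ _).trans (mul_le_mul' hΦ hdp)
  refine (add_le_add (add_le_add hC hb) hc).trans (le_of_eq ?_)
  ring

end Identity

end FiniteSums

/-! ### Contraction in weighted ℓ¹ and inverses of perturbations -/

section FixedPoint

variable {A : Type*} [NormedCommRing A] [CompleteSpace A]

/-- Banach's fixed point theorem on a ball of a weighted `ℓ¹` space of power series. -/
theorem exists_fixedPoint_wnorm {m m' : ℕ → A} (hm : ∀ j, m j * m' j = 1)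
    (Ψ : PowerSeries A → PowerSeries A) {η : ℝ} (hη : 0 < η)
    (h0 : wnorm m (Ψ 0) ≤ ENNReal.ofReal (η / 2))
    (hL : ∀ V₁ V₂, wnorm m V₁ ≤ ENNReal.ofReal η → wnorm m V₂ ≤ ENNReal.ofReal η →
      wnorm m (Ψ V₁ - Ψ V₂) ≤ 2⁻¹ * wnorm m (V₁ - V₂)) :
    ∃ V, wnorm m V ≤ ENNReal.ofReal η ∧ Ψ V = V := by
  classical
  -- The weights are units, so V ↦ (m_j V_j) identifies the series of finite weighted norm with the
  -- complete space ℓ¹(A).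
  let X := lp (fun _ : ℕ => A) 1
  let toS : X → PowerSeries A := fun x => PowerSeries.mk fun j => m' j * x j
  have hnorm : ∀ x : X, ‖x‖ₑ = ∑' j, ‖x j‖ₑ := by
    intro x
    have hs : Summable fun j => ‖x j‖ := by
      have := (lp.memℓp x).summable (by simp)
      simpa using this
    rw [← ofReal_norm, lp.norm_eq_tsum_rpow (by simp)]
    simp only [ENNReal.toReal_one, Real.rpow_one, div_one]
    rw [ENNReal.ofReal_tsum_of_nonneg (fun _ => norm_nonneg _) hs]
    simp [ofReal_norm]
  have hcoeff : ∀ (x : X) j, m j * coeff j (toS x) = x j := by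
    intro x j
    simp only [toS, coeff_mk]
    rw [← mul_assoc, hm, one_mul]
  have htoS_sub : ∀ x y : X, toS x - toS y = toS (x - y) := by
    intro x y
    ext j
    simp [toS, mul_sub]
  have hw : ∀ x : X, wnorm m (toS x) = ‖x‖ₑ := by
    intro x
    rw [hnorm, wnorm]
    exact tsum_congr fun j => by rw [hcoeff]
  have hmem : ∀ V : PowerSeries A, wnorm m V ≠ ∞ → Memℓp (fun j => m j * coeff j V) 1 := by
    intro V hV
    refine memℓp_gen ?_
    have := ENNReal.summable_toReal hV
    simpa using this
  have hback : ∀ V : PowerSeries A, ∀ hV : wnorm m V ≠ ∞, toS ⟨_, hmem V hV⟩ = V := by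
    intro V hV
    ext j
    simp only [toS, coeff_mk]
    rw [← mul_assoc, mul_comm (m' j), hm, one_mul]
  let Φ : X → X := fun x => if h : wnorm m (Ψ (toS x)) ≠ ∞ then ⟨_, hmem _ h⟩ else 0
  let s : Set X := Metric.closedBall 0 η
  have hs : ∀ x, x ∈ s ↔ wnorm m (toS x) ≤ ENNReal.ofReal η := by
    intro x
    rw [hw, ← ofReal_norm, ENNReal.ofReal_le_ofReal_iff hη.le]
    simp [s]
  have hΨ : ∀ x ∈ s, wnorm m (Ψ (toS x)) ≤ ENNReal.ofReal η := by
    intro x hx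
    have h1 := hL (toS x) 0 ((hs x).1 hx) (by simp [wnorm])
    have h2 : Ψ (toS x) = (Ψ (toS x) - Ψ 0) + Ψ 0 := by ring
    rw [h2]
    refine (wnorm_add_le _ _ _).trans ((add_le_add h1 h0).trans ?_)
    rw [sub_zero]
    have h3 : 2⁻¹ * wnorm m (toS x) ≤ 2⁻¹ * ENNReal.ofReal η := by
      gcongr; exact (hs x).1 hx
    refine (add_le_add_left h3 _).trans (le_of_eq ?_)
    rw [div_eq_inv_mul, ENNReal.ofReal_mul (by norm_num), ENNReal.ofReal_inv_of_pos (by norm_num),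
      ENNReal.ofReal_ofNat, ← add_mul, ENNReal.inv_two_add_inv_two, one_mul]
  have hfin : ∀ x ∈ s, wnorm m (Ψ (toS x)) ≠ ∞ := fun x hx =>
    ne_top_of_le_ne_top ENNReal.ofReal_ne_top (hΨ x hx)
  have hΦ : ∀ x ∈ s, toS (Φ x) = Ψ (toS x) := by
    intro x hx
    simp only [Φ]
    rw [dif_pos (hfin x hx)]
    exact hback _ (hfin x hx)
  have hmaps : MapsTo Φ s s := fun x hx => by
    rw [hs, hΦ x hx]; exact hΨ x hx
  have hcontr : ContractingWith 2⁻¹ (hmaps.restrict Φ s s) := by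
    refine ⟨by rw [← NNReal.coe_lt_coe]; norm_num, fun x y => ?_⟩
    rw [Subtype.edist_eq, Subtype.edist_eq, MapsTo.val_restrict_apply, MapsTo.val_restrict_apply,
      edist_eq_enorm_sub, edist_eq_enorm_sub, ← hw, ← hw, ← htoS_sub, ← htoS_sub, hΦ _ x.2,
      hΦ _ y.2]
    refine (hL _ _ ((hs _).1 x.2) ((hs _).1 y.2)).trans (le_of_eq ?_)
    simp
  have hcomplete : IsComplete s := Metric.isClosed_closedBall.isComplete
  obtain ⟨x, hx, hfix, -⟩ := hcontr.exists_fixedPoint' hcomplete hmaps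
    (x := 0) (by simp [s, hη.le]) (edist_ne_top _ _)
  exact ⟨toS x, (hs x).1 hx, by rw [← hΦ x hx, hfix.eq]⟩

/-- Inverses of small perturbations, with a bound. -/
theorem exists_mul_eq_one_of_l1norm_small [NormOneClass A] {D q V : PowerSeries A} (h : D * q = 1)
    (hV : l1norm q * l1norm V ≤ 2⁻¹) :
    ∃ q', (D + V) * q' = 1 ∧ l1norm q' ≤ 2 * l1norm q := by
  have hx : l1norm (q * V) ≤ 2⁻¹ := (wnorm_mul_le 1 q V).trans hV
  -- Since D q = 1, (D + V) q = 1 + q V. A power series is a unit as soon as its constant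
  -- coefficient is, and that one is inverted by a Neumann series.
  have hunit : IsUnit (1 + q * V) := by
    rw [PowerSeries.isUnit_iff_constantCoeff]
    have h1 : ‖coeff 0 (q * V)‖ₑ ≤ 2⁻¹ := by
      have := (enorm_coeff_le_wnorm (fun _ => (1 : A)) (q * V) 0).trans hx
      simpa using this
    have h2 : ‖-(coeff 0 (q * V))‖ < 1 := by
      rw [norm_neg, ← toReal_enorm]
      have := ENNReal.toReal_mono (by simp) h1
      refine this.trans_lt ?_
      norm_num
    have := (Units.oneSub _ h2).isUnit
    simpa [Units.val_oneSub] using this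
  obtain ⟨y, hy⟩ := hunit.exists_right_inv
  refine ⟨q * y, by linear_combination hy + y * h, ?_⟩
  refine (wnorm_mul_le 1 q y).trans ?_
  rw [mul_comm]
  gcongr
  exact l1norm_le_two_of_mul_eq_one hx hy (by simp)

/-- `rhs` uses `Ring.inverse` in order to be defined for every series; with this lemma an explicit
inverse takes its place. -/
theorem eq_inverse_of_mul_eq_one {R : Type*} [CommRing R] {D q : R} (h : D * q = 1) :
    Ring.inverse D = q := by
  have hu : IsUnit D := IsUnit.of_mul_eq_one _ h
  have := Ring.inverse_mul_cancel D hu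
  linear_combination (-Ring.inverse D) * h + q * this

/-- The right-hand side of the evolution equation for the Taylor coefficients of `f'`. -/
def rhs [StarRing A] (σ : A) (D : PowerSeries A) : PowerSeries A :=
  D * herglotz σ (Ring.inverse D)

end FixedPoint

/-! ### Integration in time against decaying weights -/

section Primitive

variable {a b : ℝ} (hab : a ≤ b)

/-- The primitive of a continuous function on `[a, b]` that vanishes at `a`. -/
def prim (x : C(Icc a b, ℂ)) : C(Icc a b, ℂ) where
  toFun t := ∫ τ in a..t, IccExtend hab x τ
  continuous_toFun := by
    have : Continuous fun t : ℝ => ∫ τ in a..t, IccExtend hab x τ :=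
      intervalIntegral.continuous_primitive
        (fun _ _ => (x.continuous.Icc_extend' ).intervalIntegrable _ _) a
    exact this.comp continuous_subtype_val

theorem prim_apply (x : C(Icc a b, ℂ)) (t : Icc a b) :
    prim hab x t = ∫ τ in a..t, IccExtend hab x τ := rfl

theorem prim_sub (x y : C(Icc a b, ℂ)) : prim hab (x - y) = prim hab x - prim hab y := by
  ext t
  rw [ContinuousMap.sub_apply, prim_apply, prim_apply, prim_apply,
    ← intervalIntegral.integral_sub (x.continuous.Icc_extend'.intervalIntegrable _ _)
      (y.continuous.Icc_extend'.intervalIntegrable _ _)]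
  rfl

/-- Moving m under the integral costs exp(-κ(t-τ)), whose integral over τ ≤ t is at most 1/κ. -/
theorem norm_mul_prim_le {m : C(Icc a b, ℂ)} {κ : ℝ} (hκ : 0 < κ)
    (hm : ∀ τ t : Icc a b, τ ≤ t → ‖m t‖ ≤ Real.exp (-κ * (t - τ)) * ‖m τ‖)
    (x : C(Icc a b, ℂ)) : ‖m * prim hab x‖ ≤ κ⁻¹ * ‖m * x‖ := by
  rw [ContinuousMap.norm_le _ (by positivity)]
  intro t
  have hat : a ≤ t := t.2.1
  have hint : ∫ τ in a..(t : ℝ), Real.exp (-κ * (t - τ)) * ‖m * x‖ ≤ κ⁻¹ * ‖m * x‖ := by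
    rw [intervalIntegral.integral_mul_const]
    gcongr
    have hd : ∀ τ ∈ uIcc a (t : ℝ), HasDerivAt (fun τ => κ⁻¹ * Real.exp (-κ * (t - τ)))
        (Real.exp (-κ * (t - τ))) τ := by
      intro τ _
      have h1 : HasDerivAt (fun τ : ℝ => -κ * ((t : ℝ) - τ)) (-κ * (-1)) τ :=
        ((hasDerivAt_id τ).const_sub (t : ℝ)).const_mul (-κ)
      have := (h1.exp).const_mul κ⁻¹
      refine this.congr_deriv ?_
      have := hκ.ne'
      field_simp
    rw [intervalIntegral.integral_eq_sub_of_hasDerivAt hd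
      (Continuous.intervalIntegrable (by fun_prop) _ _)]
    have : 0 < Real.exp (-κ * (t - a)) := Real.exp_pos _
    have hk : 0 < κ⁻¹ := by positivity
    simp only [sub_self, mul_zero, Real.exp_zero, mul_one]
    nlinarith [mul_pos hk this]
  rw [ContinuousMap.mul_apply, prim_apply, ← intervalIntegral.integral_const_mul]
  refine (intervalIntegral.norm_integral_le_of_norm_le hat ?_
    (Continuous.intervalIntegrable (by fun_prop) _ _)).trans hint
  refine Eventually.of_forall fun τ hτ => ?_
  have hτ' : τ ∈ Icc a b := ⟨hτ.1.le, hτ.2.trans t.2.2⟩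
  rw [IccExtend_of_mem hab _ hτ', norm_mul]
  calc ‖m t‖ * ‖x ⟨τ, hτ'⟩‖ ≤ Real.exp (-κ * (t - τ)) * ‖m ⟨τ, hτ'⟩‖ * ‖x ⟨τ, hτ'⟩‖ := by
        gcongr
        exact hm ⟨τ, hτ'⟩ t hτ.2
    _ = Real.exp (-κ * (t - τ)) * ‖(m * x) ⟨τ, hτ'⟩‖ := by
        rw [ContinuousMap.mul_apply, norm_mul, mul_assoc]
    _ ≤ _ := by gcongr; exact ContinuousMap.norm_coe_le_norm _ _

/-- Termwise integration of a series `∑ Wⱼ ξʲ⁺¹`, recorded for its derivative in `ξ`. -/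
def primSeries (W : PowerSeries C(Icc a b, ℂ)) : PowerSeries C(Icc a b, ℂ) :=
  PowerSeries.mk fun j => ((j : C(Icc a b, ℂ)) + 1) * prim hab (coeff j W)

theorem coeff_primSeries (W : PowerSeries C(Icc a b, ℂ)) (j : ℕ) :
    coeff j (primSeries hab W) = ((j : C(Icc a b, ℂ)) + 1) * prim hab (coeff j W) := by
  simp [primSeries]

theorem primSeries_sub (W W' : PowerSeries C(Icc a b, ℂ)) :
    primSeries hab (W - W') = primSeries hab W - primSeries hab W' := by
  ext1 j
  simp only [coeff_primSeries, map_sub, prim_sub, mul_sub]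

theorem norm_natCast_add_one_mul (j : ℕ) (x : C(Icc a b, ℂ)) :
    ‖((j : C(Icc a b, ℂ)) + 1) * x‖ ≤ ((j : ℝ) + 1) * ‖x‖ := by
  rw [ContinuousMap.norm_le _ (by positivity)]
  intro t
  rw [ContinuousMap.mul_apply, norm_mul]
  gcongr
  · have : (((j : C(Icc a b, ℂ)) + 1) t) = ((j + 1 : ℕ) : ℂ) := by simp
    rw [this, Complex.norm_natCast]
    simp
  · exact ContinuousMap.norm_coe_le_norm _ _

/-- The decay rate K(j+1) of the j-th weight compensates the factor j+1 lost to the derivative in ξ,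
and 1/K remains as the contraction constant. -/
theorem wnorm_primSeries_le {m : ℕ → C(Icc a b, ℂ)} {K : ℝ} (hK : 0 < K)
    (hm : ∀ j, ∀ τ t : Icc a b, τ ≤ t →
      ‖m j t‖ ≤ Real.exp (-(K * (j + 1)) * (t - τ)) * ‖m j τ‖)
    (W : PowerSeries C(Icc a b, ℂ)) :
    wnorm m (primSeries hab W) ≤ ENNReal.ofReal K⁻¹ * wnorm m W := by
  unfold wnorm
  rw [← ENNReal.tsum_mul_left]
  refine ENNReal.tsum_le_tsum fun j => ?_
  rw [coeff_primSeries, mul_left_comm, ← ofReal_norm, ← ofReal_norm,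
    ← ENNReal.ofReal_mul (by positivity)]
  refine ENNReal.ofReal_le_ofReal ?_
  refine (norm_natCast_add_one_mul j _).trans ?_
  have h1 := norm_mul_prim_le hab (κ := K * (j + 1)) (by positivity) (hm j) (coeff j W)
  calc ((j : ℝ) + 1) * ‖m j * prim hab (coeff j W)‖
      ≤ ((j : ℝ) + 1) * ((K * (j + 1))⁻¹ * ‖m j * coeff j W‖) := by gcongr
    _ = _ := by field_simp

theorem enorm_mul_le_of_pointwise {e e' : C(Icc a b, ℂ)} (h : ∀ t, ‖e t‖ ≤ ‖e' t‖)
    (x : C(Icc a b, ℂ)) : ‖e * x‖ₑ ≤ ‖e' * x‖ₑ := by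
  rw [← ofReal_norm, ← ofReal_norm]
  refine ENNReal.ofReal_le_ofReal ?_
  rw [ContinuousMap.norm_le _ (norm_nonneg _)]
  intro t
  refine le_trans ?_ (ContinuousMap.norm_coe_le_norm _ t)
  rw [ContinuousMap.mul_apply, ContinuousMap.mul_apply, norm_mul, norm_mul]
  gcongr
  exact h t

end Primitive

/-! ### Solving the coefficient equation near a polynomial solution -/

section CoefficientSolution

variable {T : ℝ}

/-- Existence for the coefficient equation near a polynomial solution: a perturbation of the
initial coefficients that is small in a norm with a large radius `s₀` leads to a solution on the
whole interval that stays close to the polynomial one in the norm with radius `S`. -/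
theorem exists_coeff_solution (hT : 0 ≤ T) {σ : C(Icc 0 T, ℂ)} (hσ : star σ = σ) (hσ' : ‖σ‖ₑ ≤ 1)
    {D₀ q₀ : PowerSeries C(Icc 0 T, ℂ)} (h₀ : D₀ * q₀ = 1) (hq₀ : l1norm q₀ ≠ ∞) {k₀ : ℕ}
    (hk₀ : 1 ≤ k₀) (hdeg : ∀ j, k₀ ≤ j → coeff j D₀ = 0) {S θ : ℝ} (hS : 1 ≤ S) (hθ : 0 < θ) :
    ∃ s₀ ≥ S, ∃ δ > 0, ∀ c : ℕ → ℂ, ∑' j, ENNReal.ofReal (‖c j‖ * s₀ ^ j) ≤ ENNReal.ofReal δ →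
      ∃ D q : PowerSeries C(Icc 0 T, ℂ), D * q = 1 ∧ l1norm D ≠ ∞ ∧ l1norm q ≠ ∞ ∧
        D = D₀ + (PowerSeries.mk fun j => ContinuousMap.const _ (c j)) +
          primSeries hT (rhs σ D - rhs σ D₀) ∧
        ∑' j, ENNReal.ofReal (‖coeff j (D - D₀)‖ * S ^ j) ≤ ENNReal.ofReal θ := by
  have : Nonempty (Icc 0 T) := ⟨⟨0, le_rfl, hT⟩⟩
  have hD₀ : l1norm D₀ ≠ ∞ := by
    rw [l1norm_eq, tsum_eq_sum (s := Finset.range k₀)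
      (by intro j hj; simp [hdeg j (by simpa using hj)])]
    exact ENNReal.sum_ne_top.2 fun _ _ => enorm_ne_top
  set Q := 2 * l1norm q₀ with hQ
  have hQt : Q ≠ ∞ := by finiteness
  set Φ := l1norm D₀ + 1 with hΦ
  have hΦt : Φ ≠ ∞ := by finiteness
  -- The Lipschitz constant with E = 1. It depends only on the reference solution, so K can be
  -- chosen after it with L/K ≤ 1/2, and the weights after K.
  set L := 2 * 1 * Q ^ 2 + 2 * Q ^ 2 + 4 * Φ * Q ^ 3 with hL
  have hLt : L ≠ ∞ := by finiteness
  set K := 2 * L.toReal + 1 with hK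
  have hKpos : 0 < K := by positivity
  have hKL : ENNReal.ofReal K⁻¹ * L ≤ 2⁻¹ := by
    rw [← ENNReal.ofReal_toReal hLt, ← ENNReal.ofReal_mul (by positivity),
      show (2 : ℝ≥0∞)⁻¹ = ENNReal.ofReal 2⁻¹ by
        rw [ENNReal.ofReal_inv_of_pos (by norm_num)]; simp]
    refine ENNReal.ofReal_le_ofReal ?_
    rw [inv_mul_le_iff₀ hKpos, hK]
    linarith
  have hSpos : 0 < S := by linarith
  -- The subtraction is truncated: the exponent is 0 for j < k₀, exactly where the coefficients of
  -- D₀ may be nonzero.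
  let n : ℕ → ℕ := fun j => j + 1 - k₀
  let er : ℕ → ℝ → ℝ := fun j t => (S * Real.exp (K * (T - t))) ^ n j
  let e : ℕ → C(Icc 0 T, ℂ) := fun j => ⟨fun t => ((er j t : ℝ) : ℂ), by fun_prop⟩
  -- This factor supplies the decay rate K k₀ missing from `e`; together the rates are K (n j + k₀)
  -- ≥ K (j + 1).
  let μ : C(Icc 0 T, ℂ) := ⟨fun t => ((Real.exp (-(K * k₀ * t)) : ℝ) : ℂ), by fun_prop⟩
  let m : ℕ → C(Icc 0 T, ℂ) := fun j => e j * μ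
  have hbase : ∀ t : Icc 0 T, S ≤ S * Real.exp (K * (T - t)) := by
    intro t
    refine le_mul_of_one_le_right hSpos.le (Real.one_le_exp ?_)
    have := t.2.2
    exact mul_nonneg hKpos.le (by linarith)
  have herpos : ∀ j t, 0 < er j t := fun j t => by positivity
  have hne : ∀ j (t : Icc 0 T), ‖e j t‖ = er j t := fun j t => by
    simp only [e, ContinuousMap.coe_mk, Complex.norm_real, Real.norm_eq_abs,
      abs_of_pos (herpos j t)]
  have hnμ : ∀ t : Icc 0 T, ‖μ t‖ = Real.exp (-(K * k₀ * t)) := fun t => by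
    simp only [μ, ContinuousMap.coe_mk, Complex.norm_real, Real.norm_eq_abs, Real.abs_exp]
  have hnm : ∀ j (t : Icc 0 T), ‖m j t‖ = er j t * Real.exp (-(K * k₀ * t)) := fun j t => by
    simp only [m, ContinuousMap.mul_apply, norm_mul, hne, hnμ]
  have hμstar : star μ = μ := by
    ext t
    exact Complex.conj_ofReal _
  have he0 : e 0 = 1 := by
    ext t
    have : n 0 = 0 := by simp only [n]; omega
    simp [e, er, this]
  have hemono : ∀ j i x, ‖e j * x‖ₑ ≤ ‖e (j + i) * x‖ₑ := by
    intro j i x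
    refine enorm_mul_le_of_pointwise (fun t => ?_) x
    rw [hne, hne]
    exact pow_le_pow_right₀ (hS.trans (hbase t)) (by simp only [n]; omega)
  have hmdecay : ∀ j, ∀ τ t : Icc 0 T, τ ≤ t →
      ‖m j t‖ ≤ Real.exp (-(K * (j + 1)) * (t - τ)) * ‖m j τ‖ := by
    intro j τ t hτt
    have hτt' : (τ : ℝ) ≤ t := hτt
    have hform : ∀ t : Icc 0 T,
        ‖m j t‖ = S ^ n j * Real.exp (n j * (K * (T - t)) + -(K * k₀ * t)) := by
      intro t
      rw [hnm]
      simp only [er]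
      rw [mul_pow, ← Real.exp_nat_mul, mul_assoc, ← Real.exp_add]
    rw [hform, hform, mul_left_comm (Real.exp _), ← Real.exp_add]
    refine mul_le_mul_of_nonneg_left (Real.exp_le_exp.2 ?_) (by positivity)
    have hn : ((j : ℝ) + 1) ≤ n j + k₀ := by
      have : j + 1 ≤ n j + k₀ := by simp only [n]; omega
      exact_mod_cast this
    have : K * ((j : ℝ) + 1) * (t - τ) ≤ K * (n j + k₀) * (t - τ) :=
      mul_le_mul_of_nonneg_right (mul_le_mul_of_nonneg_left hn hKpos.le) (by linarith)
    linarith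
  have hm' : ∀ j, ∃ y, m j * y = 1 := by
    intro j
    have : IsUnit (m j) := by
      rw [ContinuousMap.isUnit_iff_forall_ne_zero]
      intro t
      rw [← norm_pos_iff, hnm]
      have := herpos j t
      positivity
    exact this.exists_right_inv
  choose m' hm' using hm'
  -- The price of comparing norms: the exponential undoes μ, and S ^ k₀ makes up for the exponent n
  -- j being short of j.
  set B := S ^ k₀ * Real.exp (K * k₀ * T) with hB
  have hBpos : 0 < B := by positivity
  have hB1 : 1 ≤ S ^ k₀ := one_le_pow₀ hS
  have hexpT : ∀ t : Icc 0 T, 1 ≤ Real.exp (K * k₀ * T) * Real.exp (-(K * k₀ * t)) := by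
    intro t
    rw [← Real.exp_add]
    refine Real.one_le_exp ?_
    have := t.2.2
    have : K * k₀ * (t : ℝ) ≤ K * k₀ * T := by gcongr
    linarith
  -- comparison of the weights `e` and `m`, and of powers of `S` and `m`
  have hem : ∀ V, wnorm e V ≤ ENNReal.ofReal B * wnorm m V := by
    intro V
    unfold wnorm
    rw [← ENNReal.tsum_mul_left]
    refine ENNReal.tsum_le_tsum fun j => ?_
    rw [← ofReal_norm (m j * _), ← ENNReal.ofReal_mul hBpos.le, ← ofReal_norm]
    refine ENNReal.ofReal_le_ofReal ?_
    rw [ContinuousMap.norm_le _ (by positivity)]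
    intro t
    calc ‖(e j * coeff j V) t‖ = er j t * ‖coeff j V t‖ := by
          rw [ContinuousMap.mul_apply, norm_mul, hne]
      _ ≤ (S ^ k₀ * (Real.exp (K * k₀ * T) * Real.exp (-(K * k₀ * t)))) *
            (er j t * ‖coeff j V t‖) := by
          refine le_mul_of_one_le_left (by have := herpos j t; positivity) ?_
          exact one_le_mul_of_one_le_of_one_le hB1 (hexpT t)
      _ = B * ‖(m j * coeff j V) t‖ := by
          rw [ContinuousMap.mul_apply, norm_mul, hnm, hB]; ring
      _ ≤ _ := by gcongr; exact ContinuousMap.norm_coe_le_norm _ _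
  have hSm : ∀ V, ∑' j, ENNReal.ofReal (‖coeff j V‖ * S ^ j) ≤
      ENNReal.ofReal B * wnorm m V := by
    intro V
    unfold wnorm
    rw [← ENNReal.tsum_mul_left]
    refine ENNReal.tsum_le_tsum fun j => ?_
    rw [← ofReal_norm (m j * _), ← ENNReal.ofReal_mul hBpos.le]
    refine ENNReal.ofReal_le_ofReal ?_
    rw [← le_div_iff₀ (by positivity), ContinuousMap.norm_le _ (by positivity)]
    intro t
    rw [le_div_iff₀ (by positivity)]
    calc ‖coeff j V t‖ * S ^ j ≤ ‖coeff j V t‖ * (S ^ k₀ * er j t) := by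
          gcongr
          calc S ^ j ≤ S ^ (k₀ + n j) := pow_le_pow_right₀ hS (by simp only [n]; omega)
            _ = S ^ k₀ * S ^ n j := pow_add _ _ _
            _ ≤ S ^ k₀ * er j t := by
                gcongr
                exact pow_le_pow_left₀ hSpos.le (hbase t) _
      _ ≤ (Real.exp (K * k₀ * T) * Real.exp (-(K * k₀ * t))) *
            (‖coeff j V t‖ * (S ^ k₀ * er j t)) := by
          refine le_mul_of_one_le_left (by have := herpos j t; positivity) (hexpT t)
      _ = B * ‖(m j * coeff j V) t‖ := by
          rw [ContinuousMap.mul_apply, norm_mul, hnm, hB]; ring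
      _ ≤ _ := by gcongr; exact ContinuousMap.norm_coe_le_norm _ _
  have hle : ∀ V, l1norm V ≤ wnorm e V := by
    intro V
    refine wnorm_mono (fun j x => ?_) V
    have := hemono 0 j x
    rwa [he0, zero_add] at this
  -- The only place where the degree bound enters the estimates: on D₀ the weights are 1, whatever K
  -- is.
  have heD₀ : wnorm e D₀ ≤ l1norm D₀ := by
    refine ENNReal.tsum_le_tsum fun j => ?_
    by_cases hj : k₀ ≤ j
    · simp [hdeg j hj]
    · refine enorm_mul_le_of_pointwise (fun t => ?_) _
      have : n j = 0 := by simp only [n]; omega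
      rw [hne]
      simp [er, this]
  -- choice of the radius of the ball
  set η₀ := min (min θ 1) (2 * ((l1norm q₀).toReal + 1))⁻¹ with hη₀
  have hη₀pos : 0 < η₀ := by positivity
  -- In the ball of this radius `wnorm e V` is at most η₀. The three bounds in η₀ give the closeness
  -- θ, the bound Φ and the invertibility of D₀ + V.
  set η := η₀ / B with hη
  have hηpos : 0 < η := by positivity
  have hBη : ∀ V, wnorm m V ≤ ENNReal.ofReal η →
      ENNReal.ofReal B * wnorm m V ≤ ENNReal.ofReal η₀ := by
    intro V hV
    calc ENNReal.ofReal B * wnorm m V ≤ ENNReal.ofReal B * ENNReal.ofReal η := by gcongr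
      _ = ENNReal.ofReal η₀ := by
        rw [← ENNReal.ofReal_mul hBpos.le, hη, mul_div_cancel₀ _ hBpos.ne']
  have hsmall : ∀ V, wnorm m V ≤ ENNReal.ofReal η → ∃ q, (D₀ + V) * q = 1 ∧ l1norm q ≤ Q := by
    intro V hV
    refine exists_mul_eq_one_of_l1norm_small h₀ ?_
    have h1 : l1norm V ≤ ENNReal.ofReal (2 * ((l1norm q₀).toReal + 1))⁻¹ :=
      ((hle V).trans ((hem V).trans (hBη V hV))).trans
        (ENNReal.ofReal_le_ofReal (min_le_right _ _))
    calc l1norm q₀ * l1norm V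
        ≤ ENNReal.ofReal (l1norm q₀).toReal *
          ENNReal.ofReal (2 * ((l1norm q₀).toReal + 1))⁻¹ := by
          rw [ENNReal.ofReal_toReal hq₀]; gcongr
      _ ≤ ENNReal.ofReal 2⁻¹ := by
          rw [← ENNReal.ofReal_mul (by positivity)]
          refine ENNReal.ofReal_le_ofReal ?_
          have : (0 : ℝ) ≤ (l1norm q₀).toReal := by positivity
          rw [← div_eq_mul_inv, div_le_iff₀ (by positivity)]
          linarith
      _ = 2⁻¹ := by rw [ENNReal.ofReal_inv_of_pos (by norm_num)]; simp
  have hefin : ∀ V, wnorm m V ≤ ENNReal.ofReal η → wnorm e V ≤ 1 := by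
    intro V hV
    refine ((hem V).trans (hBη V hV)).trans ?_
    rw [← ENNReal.ofReal_one]
    exact ENNReal.ofReal_le_ofReal ((min_le_left _ _).trans (min_le_right _ _))
  have hDV : ∀ V, wnorm m V ≤ ENNReal.ofReal η → l1norm (D₀ + V) ≠ ∞ := by
    intro V hV
    have h1 : l1norm V ≠ ∞ :=
      ne_top_of_le_ne_top ENNReal.one_ne_top ((hle V).trans (hefin V hV))
    exact ne_top_of_le_ne_top (ENNReal.add_ne_top.2 ⟨hD₀, h1⟩) (wnorm_add_le _ _ _)
  -- The radius is the base of the weights at time 0, where they are largest. Half of η is what the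
  -- fixed point theorem requires of the image of 0.
  refine ⟨S * Real.exp (K * T), ?_, η / 2, by positivity, fun c hc => ?_⟩
  · exact le_mul_of_one_le_right hSpos.le (Real.one_le_exp (by positivity))
  let c' : PowerSeries C(Icc 0 T, ℂ) := PowerSeries.mk fun j => ContinuousMap.const _ (c j)
  have hc' : wnorm m c' ≤ ENNReal.ofReal (η / 2) := by
    refine le_trans (ENNReal.tsum_le_tsum fun j => ?_) hc
    rw [← ofReal_norm]
    refine ENNReal.ofReal_le_ofReal ?_
    have hs1 : 1 ≤ S * Real.exp (K * T) :=
      one_le_mul_of_one_le_of_one_le hS (Real.one_le_exp (by positivity))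
    rw [ContinuousMap.norm_le _ (by positivity)]
    intro t
    have ht := t.2.1
    rw [ContinuousMap.mul_apply, norm_mul, hnm, mul_comm]
    have h1 : er j t ≤ (S * Real.exp (K * T)) ^ j := by
      calc er j t ≤ (S * Real.exp (K * T)) ^ n j := by
            refine pow_le_pow_left₀ (by positivity) ?_ _
            gcongr
            linarith
        _ ≤ _ := pow_le_pow_right₀ hs1 (by simp only [n]; omega)
    have h2 : Real.exp (-(K * k₀ * t)) ≤ 1 := by
      rw [Real.exp_le_one_iff]
      have : 0 ≤ K * k₀ * (t : ℝ) := by positivity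
      linarith
    have h3 : coeff j c' t = c j := by simp [c']
    rw [h3]
    gcongr
    calc er j t * Real.exp (-(K * k₀ * t)) ≤ (S * Real.exp (K * T)) ^ j * 1 := by gcongr
      _ = _ := mul_one _
  obtain ⟨V, hV, hfix⟩ := exists_fixedPoint_wnorm hm'
    (fun V => c' + primSeries hT (rhs σ (D₀ + V) - rhs σ D₀)) hηpos
    (by
      have : primSeries hT (rhs σ (D₀ + 0) - rhs σ D₀) = 0 := by
        rw [add_zero, primSeries_sub, sub_self]
      refine le_trans (le_of_eq ?_) hc'
      rw [this, add_zero])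
    (by
      intro V₁ V₂ h₁ h₂
      obtain ⟨q₁, hq₁, hq₁'⟩ := hsmall V₁ h₁
      obtain ⟨q₂, hq₂, hq₂'⟩ := hsmall V₂ h₂
      have e1 : c' + primSeries hT (rhs σ (D₀ + V₁) - rhs σ D₀) -
          (c' + primSeries hT (rhs σ (D₀ + V₂) - rhs σ D₀)) =
          primSeries hT (rhs σ (D₀ + V₁) - rhs σ (D₀ + V₂)) := by
        simp only [primSeries_sub]; ring
      simp only [e1]
      have hlip := wnorm_mul_herglotz_sub_le hσ hσ' hq₁ hq₂ (hDV V₁ h₁) (hDV V₂ h₂) hQt hq₁' hq₂'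
        hμstar hemono (fun x => by rw [he0, one_mul]) (E := 1) (by rw [he0]; simp)
        (Φ := Φ) ((wnorm_add_le _ _ _).trans (add_le_add heD₀ (hefin V₂ h₂)))
      rw [← eq_inverse_of_mul_eq_one hq₁, ← eq_inverse_of_mul_eq_one hq₂,
        add_sub_add_left_eq_sub] at hlip
      calc wnorm m (primSeries hT (rhs σ (D₀ + V₁) - rhs σ (D₀ + V₂)))
          ≤ ENNReal.ofReal K⁻¹ * wnorm m (rhs σ (D₀ + V₁) - rhs σ (D₀ + V₂)) :=
            wnorm_primSeries_le hT hKpos hmdecay _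
        _ ≤ ENNReal.ofReal K⁻¹ * (L * wnorm m (V₁ - V₂)) := mul_le_mul_right hlip _
        _ ≤ 2⁻¹ * wnorm m (V₁ - V₂) := by
            rw [← mul_assoc]
            exact mul_le_mul_left hKL _)
  obtain ⟨q, hq, hq'⟩ := hsmall V hV
  refine ⟨D₀ + V, q, hq, hDV V hV, ne_top_of_le_ne_top hQt hq', ?_, ?_⟩
  · conv_lhs => rw [← hfix]
    simp only [c']
    ring
  · rw [add_sub_cancel_left]
    refine ((hSm V).trans (hBη V hV)).trans (ENNReal.ofReal_le_ofReal ?_)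
    exact (min_le_left _ _).trans (min_le_left _ _)

end CoefficientSolution

/-! ### Taylor coefficients and sums of complex power series -/

section Scalar

/-- The sum of a power series with complex coefficients. -/
def psum (a : PowerSeries ℂ) (ξ : ℂ) : ℂ := ∑' n, coeff n a * ξ ^ n

variable {a b : PowerSeries ℂ} {s : ℝ}

theorem norm_coeff_mul_pow_le (hξ : ‖(ξ : ℂ)‖ ≤ s) (n : ℕ) :
    ‖coeff n a * ξ ^ n‖ ≤ ‖coeff n a‖ * s ^ n := by
  rw [norm_mul, norm_pow]
  gcongr

theorem summable_psum (ha : Summable fun n => ‖coeff n a‖ * s ^ n) {ξ : ℂ} (hξ : ‖ξ‖ ≤ s) :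
    Summable fun n => coeff n a * ξ ^ n :=
  Summable.of_norm_bounded ha fun n => norm_coeff_mul_pow_le hξ n

theorem continuousOn_psum (ha : Summable fun n => ‖coeff n a‖ * s ^ n) :
    ContinuousOn (psum a) (Metric.closedBall 0 s) :=
  continuousOn_tsum (fun n => by fun_prop) ha fun n ξ hξ =>
    norm_coeff_mul_pow_le (by simpa using hξ) n

theorem differentiableOn_psum (ha : Summable fun n => ‖coeff n a‖ * s ^ n) :
    DifferentiableOn ℂ (psum a) (Metric.ball 0 s) :=
  Complex.differentiableOn_tsum_of_summable_norm ha (fun n => by fun_prop) Metric.isOpen_ball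
    fun n ξ hξ => norm_coeff_mul_pow_le (mem_ball_zero_iff.1 hξ).le n

theorem psum_mul (ha : Summable fun n => ‖coeff n a‖ * s ^ n)
    (hb : Summable fun n => ‖coeff n b‖ * s ^ n) {ξ : ℂ} (hξ : ‖ξ‖ ≤ s) :
    psum (a * b) ξ = psum a ξ * psum b ξ := by
  have ha' : Summable fun n => ‖coeff n a * ξ ^ n‖ :=
    Summable.of_nonneg_of_le (fun _ => norm_nonneg _) (fun n => norm_coeff_mul_pow_le hξ n) ha
  have hb' : Summable fun n => ‖coeff n b * ξ ^ n‖ :=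
    Summable.of_nonneg_of_le (fun _ => norm_nonneg _) (fun n => norm_coeff_mul_pow_le hξ n) hb
  unfold psum
  rw [tsum_mul_tsum_eq_tsum_sum_antidiagonal_of_summable_norm ha' hb']
  refine tsum_congr fun n => ?_
  rw [coeff_mul, Finset.sum_mul]
  refine Finset.sum_congr rfl fun p hp => ?_
  rw [← Finset.HasAntidiagonal.mem_antidiagonal.1 hp, pow_add]
  ring

theorem psum_one (ξ : ℂ) : psum 1 ξ = 1 := by
  unfold psum
  rw [tsum_eq_single 0 (by intro n hn; simp [coeff_one, hn])]
  simp

theorem summable_pow_one (ha : l1norm a ≠ ∞) : Summable fun n => ‖coeff n a‖ * (1 : ℝ) ^ n := by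
  simpa using summable_of_l1norm_ne_top ha

theorem hasSum_taylorCoeff {f : ℂ → ℂ} {R : ℝ} (hf : DifferentiableOn ℂ f (Metric.ball 0 R)) {ξ : ℂ}
    (hξ : ‖ξ‖ < R) : HasSum (fun n => taylorCoeff f n * ξ ^ n) (f ξ) := by
  have := Complex.hasSum_taylorSeries_on_ball hf (z := ξ) (by simpa using hξ)
  refine this.congr_fun fun n => ?_
  simp only [taylorCoeff, sub_zero, smul_eq_mul]
  field_simp

theorem norm_taylorCoeff_le {f : ℂ → ℂ} {R B : ℝ} (hR : 0 < R)
    (hf : DiffContOnCl ℂ f (Metric.ball 0 R)) (hB : ∀ ξ ∈ Metric.sphere (0 : ℂ) R, ‖f ξ‖ ≤ B)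
    (n : ℕ) : ‖taylorCoeff f n‖ ≤ B / R ^ n := by
  have := Complex.norm_iteratedDeriv_le_of_forall_mem_sphere_norm_le n hR hf hB
  rw [taylorCoeff, norm_div, Complex.norm_natCast, div_le_iff₀ (by positivity)]
  refine this.trans (le_of_eq ?_)
  ring

theorem taylorCoeff_congr {f g : ℂ → ℂ} (h : f =ᶠ[𝓝 0] g) (n : ℕ) :
    taylorCoeff f n = taylorCoeff g n := by
  simp only [taylorCoeff, h.iteratedDeriv_eq n]

theorem taylorCoeff_eq_of_hasFPowerSeriesAt {f : ℂ → ℂ} {p : FormalMultilinearSeries ℂ ℂ ℂ}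
    (h : HasFPowerSeriesAt f p 0) (n : ℕ) : taylorCoeff f n = p.coeff n := by
  have := h.eq_formalMultilinearSeries
    ((AnalyticAt.hasFPowerSeriesAt ⟨p, h⟩ : HasFPowerSeriesAt f _ 0))
  rw [this]
  simp [taylorCoeff, FormalMultilinearSeries.coeff_ofScalars, div_eq_inv_mul]

theorem taylorCoeff_eq_of_hasSum {f : ℂ → ℂ} (hs : 0 < s) {c : ℕ → ℂ}
    (h : ∀ ξ : ℂ, ‖ξ‖ < s → HasSum (fun n => c n * ξ ^ n) (f ξ)) (n : ℕ) :
    taylorCoeff f n = c n := by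
  have hp : HasFPowerSeriesAt f (FormalMultilinearSeries.ofScalars ℂ c) 0 := by
    rw [hasFPowerSeriesAt_iff]
    filter_upwards [Metric.ball_mem_nhds (0 : ℂ) hs] with z hz
    have := h z (by simpa using hz)
    simpa [FormalMultilinearSeries.coeff_ofScalars, mul_comm] using this
  rw [taylorCoeff_eq_of_hasFPowerSeriesAt hp, FormalMultilinearSeries.coeff_ofScalars]

theorem taylorCoeff_psum (hs : 0 < s) (ha : Summable fun n => ‖coeff n a‖ * s ^ n) (n : ℕ) :
    taylorCoeff (psum a) n = coeff n a :=
  taylorCoeff_eq_of_hasSum hs (fun _ hξ => (summable_psum ha hξ.le).hasSum) n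

theorem taylorCoeff_zero (f : ℂ → ℂ) : taylorCoeff f 0 = f 0 := by
  simp [taylorCoeff]

theorem taylorCoeff_one (f : ℂ → ℂ) : taylorCoeff f 1 = deriv f 0 := by
  simp [taylorCoeff]

theorem taylorCoeff_iteratedDeriv (f : ℂ → ℂ) (n i : ℕ) :
    taylorCoeff (iteratedDeriv n f) i = ((i + n).descFactorial n : ℂ) * taylorCoeff f (i + n) := by
  have h1 : iteratedDeriv i (iteratedDeriv n f) = iteratedDeriv (i + n) f := by
    simp only [iteratedDeriv_eq_iterate, Function.iterate_add_apply]
  have h2 : ((i + n).factorial : ℂ) = i.factorial * (i + n).descFactorial n := by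
    rw [← Nat.factorial_mul_descFactorial (Nat.le_add_left n i), Nat.add_sub_cancel]
    push_cast
    ring
  have h3 : (i.factorial : ℂ) ≠ 0 := by exact_mod_cast i.factorial_ne_zero
  have h4 : ((i + n).descFactorial n : ℂ) ≠ 0 := by
    have := (Nat.descFactorial_pos.2 (Nat.le_add_left n i)).ne'
    exact_mod_cast this
  rw [taylorCoeff, taylorCoeff, h1, h2]
  field_simp

theorem taylorCoeff_deriv (f : ℂ → ℂ) (i : ℕ) :
    taylorCoeff (deriv f) i = ((i : ℂ) + 1) * taylorCoeff f (i + 1) := by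
  have := taylorCoeff_iteratedDeriv f 1 i
  simpa [iteratedDeriv_one, Nat.descFactorial_one] using this

theorem taylorCoeff_sub {f g : ℂ → ℂ} (hf : AnalyticAt ℂ f 0) (hg : AnalyticAt ℂ g 0) (n : ℕ) :
    taylorCoeff (fun ξ => f ξ - g ξ) n = taylorCoeff f n - taylorCoeff g n := by
  obtain ⟨p, hp⟩ := hf
  obtain ⟨p', hp'⟩ := hg
  rw [taylorCoeff_eq_of_hasFPowerSeriesAt hp, taylorCoeff_eq_of_hasFPowerSeriesAt hp']
  rw [show (fun ξ => f ξ - g ξ) = f - g from rfl,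
    taylorCoeff_eq_of_hasFPowerSeriesAt (hp.sub hp')]
  rfl

/-- The Taylor series at `0`. -/
def taylorSeries (f : ℂ → ℂ) : PowerSeries ℂ := PowerSeries.mk (taylorCoeff f)

theorem coeff_taylorSeries (f : ℂ → ℂ) (n : ℕ) : coeff n (taylorSeries f) = taylorCoeff f n := by
  simp [taylorSeries]

theorem psum_taylorSeries {f : ℂ → ℂ} {R : ℝ} (hf : DifferentiableOn ℂ f (Metric.ball 0 R)) {ξ : ℂ}
    (hξ : ‖ξ‖ < R) : psum (taylorSeries f) ξ = f ξ := by
  simp only [psum, coeff_taylorSeries]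
  exact (hasSum_taylorCoeff hf hξ).tsum_eq

theorem summable_norm_taylorCoeff {f : ℂ → ℂ} {R : ℝ} (hf : DifferentiableOn ℂ f (Metric.ball 0 R))
    (hs0 : 0 ≤ s) (hs : s < R) : Summable fun n => ‖taylorCoeff f n‖ * s ^ n := by
  have := (hasSum_taylorCoeff hf (ξ := (s : ℂ))
    (by rwa [Complex.norm_real, Real.norm_of_nonneg hs0])).summable.norm
  simpa [abs_of_nonneg hs0] using this

end Scalar

/-! ### The real part of the Herglotz series on the unit circle -/

section Circle

/-- Splitting `ℕ × ℕ` along the diagonal. -/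
theorem bijective_diagonal_split : Function.Bijective
    (Sum.elim (fun p : ℕ × ℕ => (p.1 + p.2, p.2)) (fun p : ℕ × ℕ => (p.2, p.1 + 1 + p.2)) :
      (ℕ × ℕ) ⊕ (ℕ × ℕ) → ℕ × ℕ) := by
  constructor
  · rintro (⟨n, b⟩ | ⟨n, b⟩) (⟨n', b'⟩ | ⟨n', b'⟩) h <;>
      simp only [Sum.elim_inl, Sum.elim_inr, Prod.mk.injEq, Sum.inl.injEq, Sum.inr.injEq,
        reduceCtorEq] at h ⊢ <;> omega
  · rintro ⟨x, y⟩
    by_cases h : y ≤ x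
    · exact ⟨Sum.inl (x - y, y), by simp; omega⟩
    · exact ⟨Sum.inr (y - x - 1, x), by simp; omega⟩

/-- The double sum is split into indices on or below the diagonal and those above it; the second
half is the conjugate of a strictly shifted correlation. -/
theorem tsum_mul_star_tsum {x : ℕ → ℂ} (hx : Summable fun n => ‖x n‖) :
    (∑' n, x n) * star (∑' n, x n) = ∑' n, ∑' b, x (n + b) * star (x b) +
      star (∑' n, ∑' b, x (n + 1 + b) * star (x b)) := by
  have hx' : Summable fun n => ‖star (x n)‖ := by simpa only [norm_star] using hx
  have hprod : Summable fun p : ℕ × ℕ => x p.1 * star (x p.2) :=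
    summable_mul_of_summable_norm (f := x) (g := fun n => star (x n)) hx hx'
  set F : ℕ × ℕ → ℂ := fun p => x p.1 * star (x p.2) with hF
  let u : ℕ × ℕ → ℕ × ℕ := fun p => (p.1 + p.2, p.2)
  let v : ℕ × ℕ → ℕ × ℕ := fun p => (p.2, p.1 + 1 + p.2)
  have huv : Function.Bijective (Sum.elim u v) := bijective_diagonal_split
  have hl : Summable fun p : ℕ × ℕ => x (p.1 + p.2) * star (x p.2) :=
    hprod.comp_injective (i := u) (huv.1.comp Sum.inl_injective)
  have hr : Summable fun p : ℕ × ℕ => x p.2 * star (x (p.1 + 1 + p.2)) :=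
    hprod.comp_injective (i := v) (huv.1.comp Sum.inr_injective)
  have hsplit : HasSum (F ∘ Sum.elim u v) _ := HasSum.sum hl.hasSum hr.hasSum
  have htot := (Equiv.ofBijective _ huv).tsum_eq F
  simp only [Equiv.ofBijective_apply] at htot
  have htot' := hsplit.tsum_eq.symm.trans htot
  rw [hl.tsum_prod, hr.tsum_prod] at htot'
  rw [tsum_star, tsum_mul_tsum_of_summable_norm (f := x) (g := fun n => star (x n)) hx hx',
    ← htot', tsum_star]
  congr 1
  refine tsum_congr fun n => ?_
  rw [tsum_star]
  refine tsum_congr fun b => ?_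
  rw [star_mul, star_star]

/-- With c₀ the constant term and Y the remainder of the correlation series, |q|² = c₀ + Y + conj Y
on the circle, whereas p = σ(c₀ + 2Y) and c₀ is real. -/
theorem re_psum_herglotz {σ : ℝ} {q : PowerSeries ℂ} (hq : l1norm q ≠ ∞) {ξ : ℂ} (hξ : ‖ξ‖ = 1) :
    (psum (herglotz (σ : ℂ) q) ξ).re = σ * ‖psum q ξ‖ ^ 2 := by
  have hqs := summable_of_l1norm_ne_top hq
  have hc := l1norm_corr_ne_top hq hq
  have hξ' : ξ * star ξ = 1 := by
    rw [Complex.star_def, Complex.mul_conj, Complex.normSq_eq_norm_sq, hξ]; simp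
  have hxs : Summable fun n => ‖coeff n q * ξ ^ n‖ := by
    simpa [norm_mul, norm_pow, hξ] using hqs
  have hdiag : ∀ n b, (coeff (n + b) q * ξ ^ (n + b)) * star (coeff b q * ξ ^ b) =
      coeff (n + b) q * star (coeff b q) * ξ ^ n := by
    intro n b
    rw [star_mul, star_pow, pow_add]
    calc _ = coeff (n + b) q * star (coeff b q) * ξ ^ n * (ξ * star ξ) ^ b := by
          rw [mul_pow]; ring
      _ = _ := by rw [hξ', one_pow, mul_one]
  have hdiag' : ∀ n, ∑' b, (coeff (n + b) q * ξ ^ (n + b)) * star (coeff b q * ξ ^ b) =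
      coeff n (corr q q) * ξ ^ n := by
    intro n
    rw [tsum_congr (hdiag n), coeff_corr, (summable_corr hq hq n).tsum_mul_right]
  have hsc : Summable fun n => coeff n (corr q q) * ξ ^ n :=
    summable_psum (s := 1) (summable_pow_one hc) hξ.le
  have hH : psum q ξ * star (psum q ξ) = psum (corr q q) ξ +
      star (∑' n, coeff (n + 1) (corr q q) * ξ ^ (n + 1)) := by
    have := tsum_mul_star_tsum hxs
    rw [tsum_congr hdiag', tsum_congr (fun n => hdiag' (n + 1))] at this
    exact this
  have h0 : psum (corr q q) ξ = coeff 0 (corr q q) +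
      ∑' n, coeff (n + 1) (corr q q) * ξ ^ (n + 1) := by
    unfold psum
    rw [hsc.tsum_eq_zero_add]
    simp
  set Y := ∑' n, coeff (n + 1) (corr q q) * ξ ^ (n + 1) with hY
  have hP : psum (herglotz (σ : ℂ) q) ξ = σ * (2 * psum (corr q q) ξ - coeff 0 (corr q q)) := by
    have e : ∀ n, coeff n (herglotz (σ : ℂ) q) * ξ ^ n = σ * (2 * (coeff n (corr q q) * ξ ^ n) -
        if n = 0 then coeff 0 (corr q q) else 0) := by
      intro n
      rw [coeff_herglotz]
      split_ifs with hn
      · subst hn; simp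
      · ring
    have hd : HasSum (fun n : ℕ => if n = 0 then coeff 0 (corr q q) else 0)
        (coeff 0 (corr q q)) := hasSum_ite_eq 0 _
    unfold psum
    rw [tsum_congr e, tsum_mul_left, ((hsc.mul_left 2).tsum_sub hd.summable), hd.tsum_eq,
      tsum_mul_left]
  have hreal : (coeff 0 (corr q q)).im = 0 := by
    have := star_coeff_zero_corr q
    exact Complex.conj_eq_iff_im.1 this
  have hmain : ((‖psum q ξ‖ ^ 2 : ℝ) : ℂ) = coeff 0 (corr q q) + Y + star Y := by
    rw [← h0, ← hH, Complex.star_def, Complex.mul_conj,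
      Complex.normSq_eq_norm_sq]
  have hre := congrArg Complex.re hmain
  rw [Complex.ofReal_re] at hre
  rw [hP, h0, hre]
  simp only [Complex.re_ofReal_mul, Complex.sub_re, Complex.add_re, Complex.star_def,
    Complex.conj_re, two_mul]
  ring

/-- A function that is analytic in the unit disk, purely imaginary on the unit circle and real at
the origin vanishes. -/
theorem eq_zero_of_re_eq_zero_on_circle {c : ℂ → ℂ} (hc : DiffContOnCl ℂ c (Metric.ball 0 1))
    (hre : ∀ ξ : ℂ, ‖ξ‖ = 1 → (c ξ).re = 0) (h0 : (c 0).im = 0) {ξ : ℂ} (hξ : ‖ξ‖ < 1) :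
    c ξ = 0 := by
  -- The maximum principle for exp(s c), which has modulus 1 on the circle; s = 1 and s = -1 force
  -- Re c = 0 inside.
  have hbound : ∀ s : ℝ, ∀ z ∈ Metric.ball (0 : ℂ) 1, Real.exp (s * (c z).re) ≤ 1 := by
    intro s z hz
    have hd : DiffContOnCl ℂ (fun z => Complex.exp (s * c z)) (Metric.ball 0 1) :=
      Complex.differentiable_exp.comp_diffContOnCl
        ((diffContOnCl_const (c := (s : ℂ))).smul hc)
    have := Complex.norm_le_of_forall_mem_frontier_norm_le Metric.isBounded_ball hd (C := 1)
      (fun w hw => ?_) (subset_closure hz)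
    · simpa [Complex.norm_exp] using this
    · rw [frontier_ball _ one_ne_zero] at hw
      simp [Complex.norm_exp, hre w (by simpa using hw)]
  have hre' : ∀ z ∈ Metric.ball (0 : ℂ) 1, (c z).re = 0 := by
    intro z hz
    have h1 := hbound 1 z hz
    have h2 := hbound (-1) z hz
    rw [Real.exp_le_one_iff] at h1 h2
    linarith
  have hmem : (0 : ℂ) ∈ Metric.ball (0 : ℂ) 1 := by simp
  have hξm : ξ ∈ Metric.ball (0 : ℂ) 1 := by simpa using hξ
  obtain ⟨k, hk⟩ := AnalyticOnNhd.eq_const_of_re_eq_const (c₀ := 0)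
    (hc.differentiableOn.analyticOnNhd Metric.isOpen_ball) (fun z hz => hre' z hz)
    Metric.isOpen_ball ((convex_ball (0 : ℂ) 1).isConnected ⟨0, hmem⟩)
  rw [hk ξ hξm, ← hk 0 hmem]
  exact Complex.ext (hre' 0 hmem) h0

end Circle

/-! ### Nonvanishing derivative of univalent functions -/

section Univalent

/-- The derivative of an injective analytic function does not vanish. -/
theorem deriv_ne_zero_of_injOn {f : ℂ → ℂ} {U : Set ℂ} (hU : IsOpen U)
    (hf : DifferentiableOn ℂ f U) (hinj : InjOn f U) {z : ℂ} (hz : z ∈ U) : deriv f z ≠ 0 := by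
  intro hd
  have hUz : U ∈ 𝓝 z := hU.mem_nhds hz
  have hfa : AnalyticAt ℂ f z := hf.analyticAt hUz
  have hga : AnalyticAt ℂ (fun w => f w - f z) z := hfa.sub analyticAt_const
  have hnt : ¬ ∀ᶠ w in 𝓝 z, f w - f z = 0 := by
    intro h
    have h2 : ∀ᶠ w in 𝓝[≠] z, f w - f z = 0 ∧ w ∈ U ∧ w ≠ z := by
      filter_upwards [nhdsWithin_le_nhds h, nhdsWithin_le_nhds hUz, self_mem_nhdsWithin]
        with w h1 h2 h3 using ⟨h1, h2, h3⟩
    obtain ⟨w, h1, h2, h3⟩ := h2.exists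
    exact h3 (hinj h2 hz (sub_eq_zero.1 h1))
  obtain ⟨n, h, hh, hhz, heq⟩ := (hga.exists_eventuallyEq_pow_smul_nonzero_iff).2 hnt
  have hn0 : n ≠ 0 := by
    rintro rfl
    have := heq.self_of_nhds
    simp at this
    exact hhz this.symm
  have hn1 : n ≠ 1 := by
    rintro rfl
    have h1 : HasDerivAt (fun w => (w - z) ^ 1 • h w) (h z) z := by
      have := ((hasDerivAt_id z).sub_const z).mul hh.differentiableAt.hasDerivAt
      simp at this
      simp only [pow_one, smul_eq_mul]
      exact this
    have h2 : HasDerivAt (fun w => f w - f z) (h z) z := h1.congr_of_eventuallyEq heq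
    have h3 : HasDerivAt (fun w => f w - f z) 0 z := by
      have := hfa.differentiableAt.hasDerivAt.sub_const (f z)
      rwa [hd] at this
    exact hhz (h2.unique h3)
  -- Now n ≥ 2. An analytic n-th root k of h near z makes f - f z the n-th power of φ(w) = (w - z)
  -- k(w), which is locally invertible.
  obtain ⟨c, hc⟩ := IsAlgClosed.exists_pow_nat_eq (h z) (Nat.pos_of_ne_zero hn0)
  have hc0 : c ≠ 0 := by rintro rfl; rw [zero_pow hn0] at hc; exact hhz hc.symm
  let k : ℂ → ℂ := fun w => c * Complex.exp (Complex.log (h w / h z) / n)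
  have hka : AnalyticAt ℂ k z := by
    have h1 : AnalyticAt ℂ (fun w => h w / h z) z := hh.div_const
    have h2 : AnalyticAt ℂ (fun w => Complex.log (h w / h z)) z := by
      refine h1.clog ?_
      rw [div_self hhz]
      exact Complex.one_mem_slitPlane
    exact analyticAt_const.mul (h2.div_const.cexp)
  have hkz : k z = c := by simp [k, div_self hhz]
  have hkn : ∀ᶠ w in 𝓝 z, k w ^ n = h w := by
    filter_upwards [hh.continuousAt.eventually_ne hhz] with w hw
    simp only [k]
    rw [mul_pow, hc, ← Complex.exp_nat_mul, mul_div_cancel₀ _ (by exact_mod_cast hn0),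
      Complex.exp_log (div_ne_zero hw hhz), mul_div_cancel₀ _ hhz]
  let φ : ℂ → ℂ := fun w => (w - z) * k w
  have hφa : AnalyticAt ℂ φ z := (analyticAt_id.sub analyticAt_const).mul hka
  have hφd : HasDerivAt φ c z := by
    have := ((hasDerivAt_id z).sub_const z).mul hka.differentiableAt.hasDerivAt
    simp [hkz] at this
    exact this
  have hstrict : HasStrictDerivAt φ c z := by
    have := hφa.hasStrictDerivAt
    rwa [hφd.deriv] at this
  have hmap := hstrict.map_nhds_eq hc0
  have hφz : φ z = 0 := by simp [φ]
  rw [hφz] at hmap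
  set N : Set ℂ := {w | w ∈ U ∧ φ w ^ n = f w - f z} with hN
  have hNz : N ∈ 𝓝 z := by
    filter_upwards [hUz, hkn, heq] with w h1 h2 h3
    refine ⟨h1, ?_⟩
    rw [h3, smul_eq_mul, ← h2]
    simp only [φ, mul_pow]
  have himg : φ '' N ∈ 𝓝 (0 : ℂ) := by rw [← hmap]; exact image_mem_map hNz
  obtain ⟨ε, hε, hball⟩ := Metric.mem_nhds_iff.1 himg
  -- Two points with φ-values w and ζ w have equal n-th powers, hence equal f-values, against
  -- injectivity.
  let ζ : ℂ := Complex.exp (2 * Real.pi * Complex.I / n)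
  have hζ : IsPrimitiveRoot ζ n := Complex.isPrimitiveRoot_exp n hn0
  have hζ1 : ζ ≠ 1 := hζ.ne_one (by omega)
  have hζn : ‖ζ‖ = 1 := hζ.norm'_eq_one hn0
  let w : ℂ := ((ε / 2 : ℝ) : ℂ)
  have hwn : ‖w‖ = ε / 2 := by
    simp only [w, Complex.norm_real, Real.norm_eq_abs]
    exact abs_of_pos (by positivity)
  have hw0 : w ≠ 0 := by rw [← norm_pos_iff, hwn]; positivity
  obtain ⟨z₁, hz₁, e₁⟩ := hball (show w ∈ Metric.ball (0 : ℂ) ε by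
    rw [mem_ball_zero_iff, hwn]; linarith)
  obtain ⟨z₂, hz₂, e₂⟩ := hball (show ζ * w ∈ Metric.ball (0 : ℂ) ε by
    rw [mem_ball_zero_iff, norm_mul, hζn, hwn]; linarith)
  have hff : f z₁ = f z₂ := by
    have h1 := hz₁.2
    have h2 := hz₂.2
    rw [e₁] at h1
    rw [e₂, mul_pow, hζ.pow_eq_one, one_mul] at h2
    linear_combination h2 - h1
  have := hinj hz₁.1 hz₂.1 hff
  rw [this, e₂] at e₁
  exact hζ1 (mul_right_cancel₀ hw0 (by rw [e₁, one_mul]))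

end Univalent

/-! ### From the boundary equation to the coefficient equation -/

section Equation

/-- A solution of the boundary value problem `Re [w conj (f' ξ)] = σ`, `|ξ| = 1`, in terms of
Taylor coefficients. -/
theorem taylorCoeff_succ_eq {σ R : ℝ} (hR : 1 < R) {f w : ℂ → ℂ}
    (hf : DifferentiableOn ℂ f (Metric.ball 0 R)) (hw : DifferentiableOn ℂ w (Metric.ball 0 R))
    {q : PowerSeries ℂ} (hq : taylorSeries (deriv f) * q = 1) (hq1 : l1norm q ≠ ∞)
    (hw0 : w 0 = 0) (him : (deriv w 0 * coeff 0 q).im = 0)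
    (hPG : ∀ ξ : ℂ, ‖ξ‖ = 1 → (w ξ * (starRingEnd ℂ) (deriv f ξ * ξ)).re = σ) (j : ℕ) :
    taylorCoeff w (j + 1) = coeff j (taylorSeries (deriv f) * herglotz (σ : ℂ) q) := by
  set D := taylorSeries (deriv f) with hD
  set p := herglotz (σ : ℂ) q with hp
  have hf' : DifferentiableOn ℂ (deriv f) (Metric.ball 0 R) := hf.deriv Metric.isOpen_ball
  have hDs : Summable fun n => ‖coeff n D‖ * (1 : ℝ) ^ n := by
    simpa only [hD, coeff_taylorSeries] using summable_norm_taylorCoeff hf' zero_le_one hR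
  have hqs := summable_pow_one hq1
  have hcorr := l1norm_corr_ne_top hq1 hq1
  have hpl : l1norm p ≠ ∞ := by
    refine ne_top_of_le_ne_top ?_ (wnorm_dbl_le 1 _)
    refine ENNReal.mul_ne_top (by simp) (ne_top_of_le_ne_top ?_ (wnorm_mul_le 1 _ _))
    refine ENNReal.mul_ne_top (l1norm_ne_top_of_summable ?_) hcorr
    refine summable_of_ne_finset_zero (s := {0}) fun n hn => ?_
    rw [coeff_C, if_neg (by simpa using hn), norm_zero]
  have hps := summable_pow_one hpl
  have hDq : ∀ ξ : ℂ, ‖ξ‖ ≤ 1 → deriv f ξ * psum q ξ = 1 := by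
    intro ξ hξ
    rw [← psum_taylorSeries hf' (hξ.trans_lt hR), ← psum_mul hDs hqs hξ, hq, psum_one]
  have h0R : Metric.ball (0 : ℂ) R ∈ 𝓝 0 := Metric.ball_mem_nhds _ (by linarith)
  have hW : DifferentiableOn ℂ (dslope w 0) (Metric.ball 0 R) :=
    (Complex.differentiableOn_dslope h0R).2 hw
  have hsub : Metric.closedBall (0 : ℂ) 1 ⊆ Metric.ball 0 R := Metric.closedBall_subset_ball hR
  have hmk : ∀ {a : PowerSeries ℂ}, (Summable fun n => ‖coeff n a‖ * (1 : ℝ) ^ n) →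
      DiffContOnCl ℂ (psum a) (Metric.ball 0 1) := fun ha =>
    ⟨differentiableOn_psum ha, by
      rw [closure_ball _ one_ne_zero]; exact continuousOn_psum ha⟩
  have hWc : DiffContOnCl ℂ (dslope w 0) (Metric.ball 0 1) :=
    ⟨hW.mono (Metric.ball_subset_closedBall.trans hsub), by
      rw [closure_ball _ one_ne_zero]; exact hW.continuousOn.mono hsub⟩
  have hwW : ∀ ξ, w ξ = ξ * dslope w 0 ξ := by
    intro ξ
    have := sub_smul_dslope w 0 ξ
    simpa [hw0] using this.symm
  -- `dslope w 0` is w/ξ continued to 0. On the circle (w/ξ) q has real part σ|q|² by (PG), the same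
  -- as p, and both are real at 0; so they coincide.
  have hzero : ∀ ξ : ℂ, ‖ξ‖ < 1 → dslope w 0 ξ * psum q ξ - psum p ξ = 0 := by
    intro ξ hξ
    refine eq_zero_of_re_eq_zero_on_circle (c := fun ξ => dslope w 0 ξ * psum q ξ - psum p ξ)
      ((hWc.smul (hmk hqs)).sub (hmk hps)) ?_ ?_ hξ
    · intro ζ hζ
      have hζ' : ζ * (starRingEnd ℂ) ζ = 1 := by
        rw [Complex.mul_conj, Complex.normSq_eq_norm_sq, hζ]; simp
      have h1 := hDq ζ hζ.le
      have h2 := hPG ζ hζ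
      have h3 : w ζ * (starRingEnd ℂ) (deriv f ζ * ζ) =
          dslope w 0 ζ * (starRingEnd ℂ) (deriv f ζ) := by
        rw [hwW, map_mul]
        linear_combination dslope w 0 ζ * (starRingEnd ℂ) (deriv f ζ) * hζ'
      have h4 : dslope w 0 ζ * psum q ζ = (w ζ * (starRingEnd ℂ) (deriv f ζ * ζ)) *
          ((‖psum q ζ‖ ^ 2 : ℝ) : ℂ) := by
        have h5 : (starRingEnd ℂ) (deriv f ζ) * (starRingEnd ℂ) (psum q ζ) = 1 := by
          rw [← map_mul, h1, map_one]
        have h6 : ((‖psum q ζ‖ ^ 2 : ℝ) : ℂ) = psum q ζ * (starRingEnd ℂ) (psum q ζ) := by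
          rw [Complex.mul_conj, Complex.normSq_eq_norm_sq]
        rw [h3, h6]
        linear_combination (-(dslope w 0 ζ * psum q ζ)) * h5
      rw [Complex.sub_re, hp, re_psum_herglotz hq1 hζ, h4, Complex.re_mul_ofReal, h2, sub_self]
    · have e1 : dslope w 0 0 = deriv w 0 := dslope_same _ _
      have e2 : ∀ a : PowerSeries ℂ, psum a 0 = coeff 0 a := by
        intro a
        unfold psum
        rw [tsum_eq_single 0 (by intro n hn; simp [hn])]
        simp
      simp only [e1, e2]
      rw [Complex.sub_im, him, hp, coeff_herglotz]
      have h7 : (coeff 0 (corr q q)).im = 0 := Complex.conj_eq_iff_im.1 (star_coeff_zero_corr q)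
      simp only [if_true, two_mul, add_sub_cancel_right, Complex.im_ofReal_mul, h7]
      simp
  have hW1 : ∀ ξ : ℂ, ‖ξ‖ < 1 → dslope w 0 ξ = psum (D * p) ξ := by
    intro ξ hξ
    have h1 := hDq ξ hξ.le
    have h2 := hzero ξ hξ
    rw [psum_mul hDs hps hξ.le, hD, psum_taylorSeries hf' (hξ.trans hR)]
    linear_combination deriv f ξ * h2 - dslope w 0 ξ * h1
  have hDp : Summable fun n => ‖coeff n (D * p)‖ * (1 : ℝ) ^ n := by
    refine summable_pow_one (ne_top_of_le_ne_top (ENNReal.mul_ne_top ?_ hpl) (wnorm_mul_le 1 _ _))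
    exact l1norm_ne_top_of_summable (by simpa using hDs)
  have hsum : ∀ ξ : ℂ, ‖ξ‖ < 1 →
      HasSum (fun n => (coeff n (X * (D * p))) * ξ ^ n) (w ξ) := by
    intro ξ hξ
    rw [hwW, hW1 ξ hξ]
    have h1 := (summable_psum hDp hξ.le).hasSum.mul_left ξ
    refine (hasSum_nat_add_iff' 1).1 ?_
    simp only [Finset.range_one, Finset.sum_singleton, coeff_zero_X_mul, zero_mul, sub_zero]
    refine h1.congr_fun fun n => ?_
    rw [coeff_succ_X_mul, pow_succ]
    ring
  rw [taylorCoeff_eq_of_hasSum one_pos hsum (j + 1), coeff_succ_X_mul]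

end Equation

/-! ### Evaluation of coefficient functions at a fixed time -/

section Evaluation

variable {a b : ℝ}

/-- The power series of values at a fixed time. -/
def atTime (t : Icc a b) : PowerSeries C(Icc a b, ℂ) →+* PowerSeries ℂ :=
  PowerSeries.map (ContinuousMap.evalStarAlgHom ℂ ℂ t : C(Icc a b, ℂ) →⋆ₐ[ℂ] ℂ)

theorem coeff_atTime (t : Icc a b) (D : PowerSeries C(Icc a b, ℂ)) (n : ℕ) :
    coeff n (atTime t D) = coeff n D t := by
  simp [atTime]

theorem l1norm_atTime_ne_top (t : Icc a b) {D : PowerSeries C(Icc a b, ℂ)} (hD : l1norm D ≠ ∞) :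
    l1norm (atTime t D) ≠ ∞ := by
  refine l1norm_ne_top_of_summable (Summable.of_nonneg_of_le (fun _ => norm_nonneg _) (fun n => ?_)
    (summable_of_l1norm_ne_top hD))
  rw [coeff_atTime]
  exact ContinuousMap.norm_coe_le_norm _ _

/-- Evaluation at t is a continuous star homomorphism, so it passes through the infinite sums. -/
theorem atTime_corr (t : Icc a b) {D q : PowerSeries C(Icc a b, ℂ)} (hD : l1norm D ≠ ∞)
    (hq : l1norm q ≠ ∞) : atTime t (corr D q) = corr (atTime t D) (atTime t q) := by
  ext n
  rw [coeff_atTime, coeff_corr, coeff_corr]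
  have h := (summable_corr hD hq n).hasSum.map
    (ContinuousMap.evalStarAlgHom ℂ ℂ t : C(Icc a b, ℂ) →⋆ₐ[ℂ] ℂ)
    (continuous_eval_const t)
  refine h.tsum_eq.symm.trans (tsum_congr fun i => ?_)
  simp [coeff_atTime]

theorem atTime_herglotz (t : Icc a b) (σ : C(Icc a b, ℂ)) {q : PowerSeries C(Icc a b, ℂ)}
    (hq : l1norm q ≠ ∞) : atTime t (herglotz σ q) = herglotz (σ t) (atTime t q) := by
  ext n
  rw [coeff_atTime, coeff_herglotz, coeff_herglotz, ← atTime_corr t hq hq, coeff_atTime,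
    coeff_atTime]
  split_ifs <;> simp [two_mul]

theorem atTime_rhs (t : Icc a b) (σ : C(Icc a b, ℂ)) {D q : PowerSeries C(Icc a b, ℂ)}
    (h : D * q = 1) (hq : l1norm q ≠ ∞) :
    atTime t (rhs σ D) = atTime t D * herglotz (σ t) (atTime t q) := by
  rw [rhs, eq_inverse_of_mul_eq_one h, map_mul, atTime_herglotz t σ hq]

end Evaluation

/-! ### Time derivatives of Taylor coefficients -/

section TimeDerivative

/-- Weierstrass: locally uniform convergence of analytic functions is inherited by all derivatives.
-/
theorem tendsto_taylorCoeff {ι : Type*} {l : Filter ι} {F : ι → ℂ → ℂ} {g : ℂ → ℂ} {U : Set ℂ}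
    (hU : IsOpen U) (h0 : (0 : ℂ) ∈ U) (hF : ∀ᶠ i in l, DifferentiableOn ℂ (F i) U)
    (h : TendstoLocallyUniformlyOn F g l U) (n : ℕ) :
    Tendsto (fun i => taylorCoeff (F i) n) l (𝓝 (taylorCoeff g n)) := by
  have key : ∀ n : ℕ, ∀ (F : ι → ℂ → ℂ) (g : ℂ → ℂ),
      (∀ᶠ i in l, DifferentiableOn ℂ (F i) U) → TendstoLocallyUniformlyOn F g l U →
      Tendsto (fun i => iteratedDeriv n (F i) 0) l (𝓝 (iteratedDeriv n g 0)) := by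
    intro n
    induction n with
    | zero => intro F g _ h; simpa using h.tendsto_at h0
    | succ n ih =>
      intro F g hF h
      simp only [iteratedDeriv_succ']
      exact ih _ _ (hF.mono fun i hi => hi.deriv hU) (h.deriv hF hU)
  exact (key n F g hF h).div_const _

theorem taylorCoeff_div_const {f : ℂ → ℂ} (c : ℂ) (n : ℕ) :
    taylorCoeff (fun ξ => f ξ / c) n = taylorCoeff f n / c := by
  have : (fun ξ => f ξ / c) = fun ξ => c⁻¹ * f ξ := by funext ξ; rw [div_eq_inv_mul]
  rw [this, taylorCoeff, taylorCoeff, iteratedDeriv_const_mul_field]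
  ring

variable {U : Set ℂ} {I : Set ℝ} {f ft : ℝ → ℂ → ℂ}

theorem HasContTimeDeriv.hasDerivWithinAt_taylorCoeff (h : HasContTimeDeriv U I f ft)
    (hU : IsOpen U) (h0 : (0 : ℂ) ∈ U) {t : ℝ} (ht : t ∈ I) (n : ℕ) :
    HasDerivWithinAt (fun s => taylorCoeff (f s) n) (taylorCoeff (ft t) n) I t := by
  rw [hasDerivWithinAt_iff_tendsto_slope]
  have hdiff : ∀ᶠ s in 𝓝[I \ {t}] t, s ∈ I := by
    filter_upwards [self_mem_nhdsWithin] with s hs using hs.1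
  have := tendsto_taylorCoeff hU h0
    (hdiff.mono fun s hs => ((h.analytic s hs).sub (h.analytic t ht)).div_const _)
    (h.hasDeriv t ht) n
  refine this.congr' (hdiff.mono fun s hs => ?_)
  rw [taylorCoeff_div_const, show f s - f t = fun ξ => f s ξ - f t ξ from rfl,
    taylorCoeff_sub ((h.analytic s hs).analyticAt (hU.mem_nhds h0))
      ((h.analytic t ht).analyticAt (hU.mem_nhds h0)), slope_def_module, div_eq_inv_mul,
    ← Complex.ofReal_sub, ← Complex.ofReal_inv, Complex.real_smul]

theorem HasContTimeDeriv.continuousWithinAt_taylorCoeff (h : HasContTimeDeriv U I f ft)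
    (hU : IsOpen U) (h0 : (0 : ℂ) ∈ U) {t : ℝ} (ht : t ∈ I) (n : ℕ) :
    ContinuousWithinAt (fun s => taylorCoeff (ft s) n) I t :=
  tendsto_taylorCoeff hU h0
    (by filter_upwards [self_mem_nhdsWithin] with s hs using h.analytic_deriv s hs) (h.cont t ht) n

theorem HasContTimeDeriv.mono {V : Set ℂ} {J : Set ℝ} (h : HasContTimeDeriv U I f ft)
    (hV : V ⊆ U) (hJ : J ⊆ I) : HasContTimeDeriv V J f ft where
  analytic t ht := (h.analytic t (hJ ht)).mono hV
  analytic_deriv t ht := (h.analytic_deriv t (hJ ht)).mono hV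
  hasDeriv t ht := by
    intro u hu x hx
    obtain ⟨v, hv, hev⟩ := h.hasDeriv t (hJ ht) u hu x (hV hx)
    exact ⟨v, nhdsWithin_mono _ hV hv,
      hev.filter_mono (nhdsWithin_mono _ (sdiff_subset_sdiff_left hJ))⟩
  cont t ht := by
    intro u hu x hx
    obtain ⟨v, hv, hev⟩ := h.cont t (hJ ht) u hu x (hV hx)
    exact ⟨v, nhdsWithin_mono _ hV hv, hev.filter_mono (nhdsWithin_mono _ hJ)⟩

theorem IsStrongSolution.mono {σ : ℝ} {J : Set ℝ} (h : IsStrongSolution σ I f) (hJ : J ⊆ I) :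
    IsStrongSolution σ J f := by
  obtain ⟨h1, ft, h2, h3⟩ := h
  refine ⟨fun t ht => h1 t (hJ ht), ft, fun t ht => ?_, fun t ht => h3 t (hJ ht)⟩
  obtain ⟨R, hR, η, hη, hd⟩ := h2 t (hJ ht)
  exact ⟨R, hR, η, hη, hd.mono subset_rfl (inter_subset_inter_left _ hJ)⟩

/-- On a compact set the difference quotients are eventually bounded by some constant, so f s - f t
is at most that constant times |s - t|. -/
theorem HasContTimeDeriv.tendstoLocallyUniformlyOn (h : HasContTimeDeriv U I f ft)
    (hU : IsOpen U) {t : ℝ} (ht : t ∈ I) : TendstoLocallyUniformlyOn f (f t) (𝓝[I] t) U := by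
  rw [tendstoLocallyUniformlyOn_iff_forall_isCompact hU]
  intro K hKU hK
  have hunif := (tendstoLocallyUniformlyOn_iff_forall_isCompact hU).1 (h.hasDeriv t ht) K hKU hK
  obtain ⟨M, hM⟩ := hK.exists_bound_of_continuousOn
    (((h.analytic_deriv t ht).continuousOn).mono hKU)
  rw [Metric.tendstoUniformlyOn_iff] at hunif ⊢
  intro ε hε
  have hev := hunif 1 one_pos
  have hM1 : 0 < |M| + 1 := by positivity
  rw [eventually_nhdsWithin_iff] at hev ⊢
  filter_upwards [hev, Metric.ball_mem_nhds t (div_pos hε hM1)] with s hs hst hsI ξ hξ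
  by_cases hts : s = t
  · simpa [hts] using hε
  have h1 := hs ⟨hsI, hts⟩ ξ hξ
  have hne : ((s : ℂ) - (t : ℂ)) ≠ 0 := by
    rw [← Complex.ofReal_sub]
    exact_mod_cast sub_ne_zero.2 hts
  have h2 : ‖(f s ξ - f t ξ) / ((s : ℂ) - t)‖ ≤ |M| + 1 := by
    have h3 := hM ξ hξ
    rw [dist_eq_norm] at h1
    have h4 := norm_sub_norm_le ((f s ξ - f t ξ) / ((s : ℂ) - t)) (ft t ξ)
    rw [norm_sub_rev] at h4
    linarith [le_abs_self M]
  have h5 : ‖f s ξ - f t ξ‖ = ‖(f s ξ - f t ξ) / ((s : ℂ) - t)‖ * |s - t| := by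
    rw [← Real.norm_eq_abs, ← Complex.norm_real, Complex.ofReal_sub, norm_div,
      div_mul_cancel₀ _ (norm_ne_zero_iff.2 hne)]
  rw [dist_comm, dist_eq_norm, h5]
  rw [Metric.mem_ball, Real.dist_eq, lt_div_iff₀ hM1] at hst
  calc _ ≤ (|M| + 1) * |s - t| := by gcongr
    _ < ε := by rw [mul_comm]; exact hst

end TimeDerivative

/-- Both series converge absolutely for |ξ| < R/2, so their formal product sums to 1 there, and
coefficients are unique. -/
theorem taylorSeries_mul_taylorSeries_inv {g : ℂ → ℂ} {R : ℝ} (hR : 0 < R)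
    (hg : DifferentiableOn ℂ g (Metric.ball 0 R)) (hne : ∀ ξ ∈ Metric.ball (0 : ℂ) R, g ξ ≠ 0) :
    taylorSeries g * taylorSeries (fun ξ => (g ξ)⁻¹) = 1 := by
  have hgi : DifferentiableOn ℂ (fun ξ => (g ξ)⁻¹) (Metric.ball 0 R) := hg.inv hne
  have h2 : R / 2 < R := by linarith
  have hs1 : Summable fun n => ‖coeff n (taylorSeries g)‖ * (R / 2) ^ n := by
    simpa only [coeff_taylorSeries] using summable_norm_taylorCoeff hg (by positivity) h2
  have hs2 : Summable fun n => ‖coeff n (taylorSeries fun ξ => (g ξ)⁻¹)‖ * (R / 2) ^ n := by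
    simpa only [coeff_taylorSeries] using summable_norm_taylorCoeff hgi (by positivity) h2
  have hsum : ∀ ξ : ℂ, ‖ξ‖ < R / 2 → HasSum (fun n =>
      coeff n (taylorSeries g * taylorSeries fun ξ => (g ξ)⁻¹) * ξ ^ n) 1 := by
    intro ξ hξ
    have h3 : ‖ξ‖ < R := hξ.trans h2
    have hm := psum_mul hs1 hs2 hξ.le
    rw [psum_taylorSeries hg h3, psum_taylorSeries hgi h3,
      mul_inv_cancel₀ (hne ξ (by simpa using h3))] at hm
    rw [← hm]
    refine (Summable.of_norm ?_).hasSum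
    have hn1 : Summable fun n => ‖coeff n (taylorSeries g) * ξ ^ n‖ :=
      Summable.of_nonneg_of_le (fun _ => norm_nonneg _)
        (fun n => norm_coeff_mul_pow_le hξ.le n) hs1
    have hn2 : Summable fun n => ‖coeff n (taylorSeries fun ξ => (g ξ)⁻¹) * ξ ^ n‖ :=
      Summable.of_nonneg_of_le (fun _ => norm_nonneg _)
        (fun n => norm_coeff_mul_pow_le hξ.le n) hs2
    refine (summable_norm_sum_mul_antidiagonal_of_summable_norm hn1 hn2).congr fun n => ?_
    congr 1
    rw [coeff_mul, Finset.sum_mul]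
    refine Finset.sum_congr rfl fun p hp => ?_
    rw [← Finset.HasAntidiagonal.mem_antidiagonal.1 hp, pow_add]
    ring
  have hone : ∀ ξ : ℂ, ‖ξ‖ < R / 2 →
      HasSum (fun n => coeff n (1 : PowerSeries ℂ) * ξ ^ n) 1 := by
    intro ξ _
    have := hasSum_single (f := fun n => coeff n (1 : PowerSeries ℂ) * ξ ^ n) 0
      (by intro n hn; simp [coeff_one, hn])
    simpa using this
  ext n
  rw [← taylorCoeff_eq_of_hasSum (by positivity) hsum n,
    ← taylorCoeff_eq_of_hasSum (by positivity) hone n]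

theorem InO.apply_zero {E : Set ℂ} {f : ℂ → ℂ} (h : InO E f) : f 0 = 0 := h.2.1

theorem InO.deriv_ne_zero {E : Set ℂ} {f : ℂ → ℂ} (h : InO E f) {ξ : ℂ} (hξ : ξ ∈ E) :
    deriv f ξ ≠ 0 := by
  obtain ⟨⟨U, hU, hEU, hd, hi⟩, -⟩ := h
  exact deriv_ne_zero_of_injOn hU hd hi (hEU hξ)

/-! ### The integral equation for strong solutions -/

section CoefficientEquation

variable {σ a b : ℝ} {f : ℝ → ℂ → ℂ}

/-- The time derivatives of the Taylor coefficients of a strong solution. -/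
theorem IsStrongSolution.exists_deriv_taylorCoeff (hab : a < b)
    (h : IsStrongSolution σ (Icc a b) f) :
    ∃ w : ℝ → ℂ → ℂ,
      (∀ t ∈ Icc a b, ∀ n,
        HasDerivWithinAt (fun s => taylorCoeff (f s) n) (taylorCoeff (w t) n) (Icc a b) t) ∧
      (∀ n, ContinuousOn (fun t => taylorCoeff (w t) n) (Icc a b)) ∧
      (∀ t ∈ Icc a b, w t 0 = 0 ∧ (deriv (w t) 0).im = 0) ∧
      (∀ t ∈ Icc a b, ∃ R > (1 : ℝ), DifferentiableOn ℂ (f t) (Metric.ball 0 R) ∧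
        DifferentiableOn ℂ (w t) (Metric.ball 0 R)) ∧
      ∀ t ∈ Icc a b, ∀ ξ : ℂ, ‖ξ‖ = 1 →
        (w t ξ * (starRingEnd ℂ) (deriv (f t) ξ * ξ)).re = σ := by
  obtain ⟨hO, w, hloc, hPG⟩ := h
  have hder : ∀ t ∈ Icc a b, ∀ n, HasDerivWithinAt (fun s => taylorCoeff (f s) n)
      (taylorCoeff (w t) n) (Icc a b) t := by
    intro t ht n
    obtain ⟨R, hR, η, hη, hd⟩ := hloc t ht
    have := hd.hasDerivWithinAt_taylorCoeff Metric.isOpen_ball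
      (Metric.mem_ball_self (by linarith)) ⟨ht, Metric.mem_ball_self hη⟩ n
    exact (hasDerivWithinAt_inter (Metric.ball_mem_nhds t hη)).1 this
  -- Time derivatives are unique up to the end points, so the normalisations f(0) = 0 and Im f'(0) =
  -- 0, valid at all times, pass to w.
  have huniq : ∀ t ∈ Icc a b, UniqueDiffWithinAt ℝ (Icc a b) t := uniqueDiffOn_Icc hab
  refine ⟨w, hder, fun n t ht => ?_, fun t ht => ⟨?_, ?_⟩, fun t ht => ?_, hPG⟩
  · obtain ⟨R, hR, η, hη, hd⟩ := hloc t ht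
    have := hd.continuousWithinAt_taylorCoeff Metric.isOpen_ball
      (Metric.mem_ball_self (by linarith)) ⟨ht, Metric.mem_ball_self hη⟩ n
    exact (continuousWithinAt_inter (Metric.ball_mem_nhds t hη)).1 this
  · have h1 := hder t ht 0
    have h2 : HasDerivWithinAt (fun s => taylorCoeff (f s) 0) 0 (Icc a b) t :=
      (hasDerivWithinAt_const t _ (0 : ℂ)).congr
        (fun s hs => by rw [taylorCoeff_zero, (hO s hs).apply_zero])
        (by rw [taylorCoeff_zero, (hO t ht).apply_zero])
    rw [← taylorCoeff_zero (w t)]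
    exact (huniq t ht).eq_deriv _ h1 h2
  · have h1 : HasDerivWithinAt (fun s => (taylorCoeff (f s) 1).im) (taylorCoeff (w t) 1).im
        (Icc a b) t :=
      Complex.imCLM.hasFDerivAt.comp_hasDerivWithinAt t (hder t ht 1)
    have h2 : HasDerivWithinAt (fun s => (taylorCoeff (f s) 1).im) 0 (Icc a b) t :=
      (hasDerivWithinAt_const t _ (0 : ℝ)).congr
        (fun s hs => by rw [taylorCoeff_one, (hO s hs).2.2.2])
        (by rw [taylorCoeff_one, (hO t ht).2.2.2])
    rw [← taylorCoeff_one (w t)]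
    exact (huniq t ht).eq_deriv _ h1 h2
  · obtain ⟨R, hR, η, hη, hd⟩ := hloc t ht
    exact ⟨R, hR, hd.analytic t ⟨ht, Metric.mem_ball_self hη⟩,
      hd.analytic_deriv t ⟨ht, Metric.mem_ball_self hη⟩⟩

/-- The constant function of time with value `σ`. -/
def constC (a b σ : ℝ) : C(Icc a b, ℂ) := ContinuousMap.const _ (σ : ℂ)

theorem star_constC (a b σ : ℝ) : star (constC a b σ) = constC a b σ := by
  ext t; exact Complex.conj_ofReal _

theorem enorm_constC_le {a b σ : ℝ} (hσ : |σ| ≤ 1) : ‖constC a b σ‖ₑ ≤ 1 := by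
  rw [← ofReal_norm, ← ENNReal.ofReal_one]
  refine ENNReal.ofReal_le_ofReal ?_
  rw [ContinuousMap.norm_le _ zero_le_one]
  intro t
  simpa [constC] using hσ

/-- The Taylor coefficients of the derivative of a strong solution satisfy an integral equation. -/
theorem IsStrongSolution.exists_powerSeries (hab : a < b) (h : IsStrongSolution σ (Icc a b) f)
    {R B : ℝ} (hR : 1 < R)
    (hf : ∀ t ∈ Icc a b, ∃ R' > R, DifferentiableOn ℂ (f t) (Metric.ball 0 R'))
    (hne : ∀ t ∈ Icc a b, ∀ ξ : ℂ, ‖ξ‖ ≤ R → deriv (f t) ξ ≠ 0)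
    (hB : ∀ t ∈ Icc a b, ∀ ξ : ℂ, ‖ξ‖ = R → ‖deriv (f t) ξ‖ ≤ B ∧ ‖(deriv (f t) ξ)⁻¹‖ ≤ B) :
    ∃ D q : PowerSeries C(Icc a b, ℂ), D * q = 1 ∧
      (∀ j t, coeff j D t = taylorCoeff (deriv (f t)) j) ∧
      (∀ j, ‖coeff j D‖ ≤ B / R ^ j) ∧ (∀ j, ‖coeff j q‖ ≤ B / R ^ j) ∧
      ∀ j t, coeff j D t = coeff j D ⟨a, left_mem_Icc.2 hab.le⟩ +
        coeff j (primSeries hab.le (rhs (constC a b σ) D)) t := by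
  have hR0 : 0 < R := by linarith
  have ha : a ∈ Icc a b := left_mem_Icc.2 hab.le
  have hB0 : 0 ≤ B := (norm_nonneg _).trans
    (hB a ha (R : ℂ) (by rw [Complex.norm_real, Real.norm_of_nonneg hR0.le])).1
  obtain ⟨w, hder, hwc, hw0, hdiff, hPG⟩ := h.exists_deriv_taylorCoeff hab
  have hcont : ∀ n, ContinuousOn (fun t => taylorCoeff (f t) n) (Icc a b) :=
    fun n t ht => (hder t ht n).continuousWithinAt
  let D : PowerSeries C(Icc a b, ℂ) := PowerSeries.mk fun j =>
    ⟨fun t => taylorCoeff (deriv (f t)) j, by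
      simp only [taylorCoeff_deriv]
      exact continuous_const.mul (hcont (j + 1)).domRestrict⟩
  have hD : ∀ j t, coeff j D t = taylorCoeff (deriv (f t)) j := by
    intro j t; simp only [D, coeff_mk]; rfl
  have hDt : ∀ t : Icc a b, atTime t D = taylorSeries (deriv (f t)) := by
    intro t; ext j; rw [coeff_atTime, hD, coeff_taylorSeries]
  -- Only the constant coefficient f'(0), which never vanishes, decides whether D is a unit over the
  -- continuous functions.
  have hunit : IsUnit D := by
    rw [isUnit_iff_constantCoeff, ContinuousMap.isUnit_iff_forall_ne_zero]
    intro t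
    rw [← coeff_zero_eq_constantCoeff_apply, hD, taylorCoeff_zero]
    exact hne t t.2 0 (by simpa using hR0.le)
  obtain ⟨q, hq⟩ := hunit.exists_right_inv
  have hf' : ∀ t ∈ Icc a b, ∃ R' > R, DifferentiableOn ℂ (deriv (f t)) (Metric.ball 0 R') := by
    intro t ht
    obtain ⟨R', hR', hd⟩ := hf t ht
    exact ⟨R', hR', hd.deriv Metric.isOpen_ball⟩
  have hdc : ∀ t ∈ Icc a b, DiffContOnCl ℂ (deriv (f t)) (Metric.ball 0 R) := by
    intro t ht
    obtain ⟨R', hR', hd⟩ := hf' t ht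
    exact (hd.mono (Metric.closedBall_subset_ball hR')).diffContOnCl_ball subset_rfl
  have hdci : ∀ t ∈ Icc a b, DiffContOnCl ℂ (fun ξ => (deriv (f t) ξ)⁻¹) (Metric.ball 0 R) := by
    intro t ht
    refine (hdc t ht).inv fun ξ hξ => ?_
    rw [closure_ball _ hR0.ne'] at hξ
    exact hne t ht ξ (by simpa using hξ)
  -- The formal inverse is the Taylor series of 1/f' at each time, so Cauchy estimates on |ξ| = R
  -- apply to it.
  have hqt : ∀ t : Icc a b, atTime t q = taylorSeries fun ξ => (deriv (f t) ξ)⁻¹ := by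
    intro t
    have h1 : taylorSeries (deriv (f t)) * atTime t q = 1 := by
      rw [← hDt, ← map_mul, hq, map_one]
    have h2 := taylorSeries_mul_taylorSeries_inv hR0 (hdc t t.2).differentiableOn
      fun ξ hξ => hne t t.2 ξ (by simpa using (mem_ball_zero_iff.1 hξ).le)
    rw [← eq_inverse_of_mul_eq_one h1, eq_inverse_of_mul_eq_one h2]
  have hDB : ∀ j, ‖coeff j D‖ ≤ B / R ^ j := by
    intro j
    rw [ContinuousMap.norm_le _ (by positivity)]
    intro t
    rw [hD]
    exact norm_taylorCoeff_le hR0 (hdc t t.2)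
      (fun ξ hξ => (hB t t.2 ξ (by simpa using hξ)).1) j
  have hqB : ∀ j, ‖coeff j q‖ ≤ B / R ^ j := by
    intro j
    rw [ContinuousMap.norm_le _ (by positivity)]
    intro t
    rw [← coeff_atTime, hqt, coeff_taylorSeries]
    exact norm_taylorCoeff_le hR0 (hdci t t.2)
      (fun ξ hξ => (hB t t.2 ξ (by simpa using hξ)).2) j
  have hql : l1norm q ≠ ∞ := by
    refine l1norm_ne_top_of_summable (Summable.of_nonneg_of_le (fun _ => norm_nonneg _) hqB ?_)
    have := (summable_geometric_of_lt_one (inv_nonneg.2 hR0.le) (inv_lt_one_of_one_lt₀ hR)).mul_left B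
    simpa [div_eq_mul_inv] using this
  have hweq : ∀ (t : Icc a b) j, taylorCoeff (w t) (j + 1) =
      coeff j (rhs (constC a b σ) D) t := by
    intro t j
    obtain ⟨R', hR', hfd, hwd⟩ := hdiff t t.2
    have h1 : taylorSeries (deriv (f t)) * atTime t q = 1 := by
      rw [← hDt, ← map_mul, hq, map_one]
    rw [← coeff_atTime, atTime_rhs t _ hq hql, hDt]
    refine taylorCoeff_succ_eq hR' hfd hwd h1 (l1norm_atTime_ne_top t hql) (hw0 t t.2).1 ?_
      (hPG t t.2) j
    have h3 : coeff 0 (atTime t q) = (deriv (f t) 0)⁻¹ := by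
      rw [hqt, coeff_taylorSeries, taylorCoeff_zero]
    have h4 : (deriv (f t) 0).im = 0 := (h.1 t t.2).2.2.2
    rw [h3, ← div_eq_mul_inv, Complex.div_im, (hw0 t t.2).2, h4]
    simp
  refine ⟨D, q, hq, hD, hDB, hqB, fun j t => ?_⟩
  rw [coeff_primSeries, ContinuousMap.mul_apply, prim_apply, hD, hD, taylorCoeff_deriv,
    taylorCoeff_deriv]
  set W : C(Icc a b, ℂ) := coeff j (rhs (constC a b σ) D) with hW
  have hint : ∫ τ in a..(t : ℝ), IccExtend hab.le W τ =
      taylorCoeff (f t) (j + 1) - taylorCoeff (f a) (j + 1) := by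
    refine intervalIntegral.integral_eq_sub_of_hasDeriv_right_of_le
      (f := fun s => taylorCoeff (f s) (j + 1)) t.2.1
      ((hcont (j + 1)).mono (Icc_subset_Icc_right t.2.2)) ?_
      (W.continuous.Icc_extend'.intervalIntegrable _ _)
    intro τ hτ
    have hτ' : τ ∈ Icc a b := ⟨hτ.1.le, hτ.2.le.trans t.2.2⟩
    rw [IccExtend_of_mem hab.le _ hτ', hW, ← hweq ⟨τ, hτ'⟩ j]
    have h5 := (hder τ hτ' (j + 1)).hasDerivAt
      (Icc_mem_nhds hτ.1 (hτ.2.trans_le t.2.2))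
    exact h5.hasDerivWithinAt
  rw [hint]
  simp
  ring

end CoefficientEquation

/-! ### Uniqueness of strong solutions -/

section Uniqueness

variable {σ : ℝ} {f g : ℝ → ℂ → ℂ}

/-- Near its initial time a strong solution has uniform bounds on a disk of radius above `1`. -/
theorem IsStrongSolution.exists_bounds {a b : ℝ} (hab : a < b)
    (h : IsStrongSolution σ (Icc a b) f) :
    ∃ R > (1 : ℝ), ∃ B : ℝ, ∃ c ∈ Ioc a b, ∀ t ∈ Icc a c,
      (∃ R' > R, DifferentiableOn ℂ (f t) (Metric.ball 0 R')) ∧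
      ∀ ξ : ℂ, ‖ξ‖ ≤ R → deriv (f t) ξ ≠ 0 ∧ ‖deriv (f t) ξ‖ ≤ B ∧ ‖(deriv (f t) ξ)⁻¹‖ ≤ B := by
  obtain ⟨hO, w, hloc, -⟩ := h
  have ha : a ∈ Icc a b := left_mem_Icc.2 hab.le
  obtain ⟨R₀, hR₀, η, hη, hd⟩ := hloc a ha
  obtain ⟨⟨U, hU, hEU, hfd, hfi⟩, -⟩ := hO a ha
  have haη : a ∈ Icc a b ∩ Metric.ball a η := ⟨ha, Metric.mem_ball_self hη⟩
  have hsub : Metric.closedBall (0 : ℂ) 1 ⊆ U ∩ Metric.ball 0 R₀ :=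
    subset_inter hEU (Metric.closedBall_subset_ball hR₀)
  obtain ⟨δ, hδ, hthick⟩ := (isCompact_closedBall (0 : ℂ) 1).exists_cthickening_subset_open
    (hU.inter Metric.isOpen_ball) hsub
  rw [cthickening_closedBall hδ.le zero_le_one] at hthick
  set R := δ + 1 with hR
  have hRball : ∀ ξ : ℂ, ‖ξ‖ ≤ R → ξ ∈ U ∩ Metric.ball 0 R₀ := fun ξ hξ =>
    hthick (by simpa using hξ)
  have hRR₀ : R < R₀ := by
    have := (hRball (R : ℂ) (by
      rw [Complex.norm_real, Real.norm_of_nonneg (by positivity)])).2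
    rw [mem_ball_zero_iff, Complex.norm_real] at this
    exact (le_abs_self _).trans_lt this
  have hK : IsCompact (Metric.closedBall (0 : ℂ) R) := isCompact_closedBall _ _
  have hKsub : Metric.closedBall (0 : ℂ) R ⊆ Metric.ball 0 R₀ :=
    Metric.closedBall_subset_ball hRR₀
  have hda : DifferentiableOn ℂ (deriv (f a)) (Metric.ball 0 R₀) :=
    (hd.analytic a haη).deriv Metric.isOpen_ball
  have hca : ContinuousOn (deriv (f a)) (Metric.closedBall 0 R) := hda.continuousOn.mono hKsub
  have hnea : ∀ ξ ∈ Metric.closedBall (0 : ℂ) R, deriv (f a) ξ ≠ 0 := fun ξ hξ =>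
    deriv_ne_zero_of_injOn hU hfd hfi (hRball ξ (by simpa using hξ)).1
  obtain ⟨M, hM⟩ := hK.exists_bound_of_continuousOn hca
  obtain ⟨M', hM'⟩ := hK.exists_bound_of_continuousOn (hca.inv₀ hnea)
  have h0mem : (0 : ℂ) ∈ Metric.closedBall (0 : ℂ) R := by simp; positivity
  have hM'pos : 0 < M' := by
    refine lt_of_lt_of_le ?_ (hM' 0 h0mem)
    simpa using hnea 0 h0mem
  have hlim : TendstoLocallyUniformlyOn (fun t => deriv (f t)) (deriv (f a))
      (𝓝[Icc a b ∩ Metric.ball a η] a) (Metric.ball 0 R₀) := by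
    refine (hd.tendstoLocallyUniformlyOn Metric.isOpen_ball haη).deriv ?_ Metric.isOpen_ball
    filter_upwards [self_mem_nhdsWithin] with s hs using hd.analytic s hs
  have hunif := (tendstoLocallyUniformlyOn_iff_forall_isCompact Metric.isOpen_ball).1 hlim _
    hKsub hK
  rw [Metric.tendstoUniformlyOn_iff] at hunif
  -- At the initial time |f'| ≥ 1/M' on the disk; a perturbation of half that size keeps |f'| ≥
  -- 1/(2M').
  have hev := hunif (1 / (2 * M')) (by positivity)
  rw [nhdsWithin_inter_of_mem' (mem_nhdsWithin_of_mem_nhds (Metric.ball_mem_nhds a hη)),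
    eventually_nhdsWithin_iff] at hev
  obtain ⟨c₀, hc₀, hball⟩ := Metric.eventually_nhds_iff_ball.1 hev
  refine ⟨R, by linarith, max (M + 1 / (2 * M')) (2 * M'), min b (min (a + c₀ / 2) (a + η / 2)),
    ⟨by simp [hab, hc₀, hη], min_le_left _ _⟩, fun t ht => ?_⟩
  have ht1 : t ≤ b := ht.2.trans (min_le_left _ _)
  have ht2 : t ≤ a + c₀ / 2 := ht.2.trans ((min_le_right _ _).trans (min_le_left _ _))
  have ht3 : t ≤ a + η / 2 := ht.2.trans ((min_le_right _ _).trans (min_le_right _ _))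
  have htb : t ∈ Icc a b := ⟨ht.1, ht1⟩
  have htη : t ∈ Icc a b ∩ Metric.ball a η := ⟨htb, by
    rw [Metric.mem_ball, Real.dist_eq, abs_of_nonneg (by linarith [ht.1])]; linarith⟩
  refine ⟨⟨R₀, hRR₀, hd.analytic t htη⟩, fun ξ hξ => ?_⟩
  have hξ' : ξ ∈ Metric.closedBall (0 : ℂ) R := by simpa using hξ
  have hclose := hball t (by
    rw [Metric.mem_ball, Real.dist_eq, abs_of_nonneg (by linarith [ht.1])]; linarith) htb ξ hξ'
  rw [dist_eq_norm] at hclose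
  have hlow : 1 / M' ≤ ‖deriv (f a) ξ‖ := by
    have h1 := hM' ξ hξ'
    have h2 : 0 < ‖deriv (f a) ξ‖ := norm_pos_iff.2 (hnea ξ hξ')
    rw [Pi.inv_apply, norm_inv] at h1
    rw [div_le_iff₀ hM'pos]
    rw [inv_le_iff_one_le_mul₀ h2] at h1
    linarith
  have h3 : 1 / M' - 1 / (2 * M') = 1 / (2 * M') := by field_simp; norm_num
  have hlow' : 1 / (2 * M') ≤ ‖deriv (f t) ξ‖ := by
    have := norm_sub_norm_le (deriv (f a) ξ) (deriv (f t) ξ)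
    linarith
  have hpos : 0 < ‖deriv (f t) ξ‖ := lt_of_lt_of_le (by positivity) hlow'
  refine ⟨norm_pos_iff.1 hpos, le_max_of_le_left ?_, le_max_of_le_right ?_⟩
  · have h1 := hM ξ hξ'
    have h2 := norm_sub_norm_le (deriv (f t) ξ) (deriv (f a) ξ)
    rw [norm_sub_rev] at h2
    linarith
  · rw [norm_inv, inv_le_comm₀ hpos (by positivity)]
    simpa using hlow'

theorem tsum_ofReal_geometric_ne_top (B : ℝ) {x : ℝ} (hx0 : 0 ≤ x) (hx : x < 1) :
    ∑' j : ℕ, ENNReal.ofReal (B * x ^ j) ≠ ∞ :=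
  ((summable_geometric_of_lt_one hx0 hx).mul_left B).tsum_ofReal_ne_top

/-- Two strong solutions that agree at some time agree for a short while. -/
theorem IsStrongSolution.eq_taylorCoeff_of_eq {a b : ℝ} (hab : a < b)
    (hf : IsStrongSolution σ (Icc a b) f) (hg : IsStrongSolution σ (Icc a b) g)
    (hσ : |σ| ≤ 1) (h0 : ∀ n, taylorCoeff (f a) n = taylorCoeff (g a) n) :
    ∃ c ∈ Ioc a b, ∀ t ∈ Icc a c, ∀ n, taylorCoeff (f t) n = taylorCoeff (g t) n := by
  obtain ⟨R₁, hR₁, B₁, c₁, hc₁, hb₁⟩ := hf.exists_bounds hab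
  obtain ⟨R₂, hR₂, B₂, c₂, hc₂, hb₂⟩ := hg.exists_bounds hab
  set R := min R₁ R₂ with hRdef
  have hR : 1 < R := lt_min hR₁ hR₂
  set B := max B₁ B₂ with hBdef
  have hB0 : 0 ≤ B := by
    have := ((hb₁ a (left_mem_Icc.2 hc₁.1.le)).2 0 (by simp; linarith)).2.1
    exact (norm_nonneg _).trans (this.trans (le_max_left _ _))
  -- S > 1 leaves room for the weights to shrink, and S < R makes the weighted norms of both
  -- solutions finite with bounds independent of K.
  obtain ⟨S, hS1, hSR⟩ := exists_between hR
  have hR0 : 0 < R := by linarith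
  have hS0 : 0 < S := by linarith
  set Q := ∑' j : ℕ, ENNReal.ofReal (B * R⁻¹ ^ j) with hQ
  have hQt : Q ≠ ∞ := tsum_ofReal_geometric_ne_top _ (by positivity) (inv_lt_one_of_one_lt₀ hR)
  set Φ := ∑' j : ℕ, ENNReal.ofReal (B * S * (S / R) ^ j) with hΦ
  have hΦt : Φ ≠ ∞ := tsum_ofReal_geometric_ne_top _ (by positivity)
    ((div_lt_one hR0).2 hSR)
  set E := ENNReal.ofReal S with hE
  set L := 2 * E * Q ^ 2 + 2 * Q ^ 2 + 4 * Φ * Q ^ 3 with hL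
  have hLt : L ≠ ∞ := by finiteness
  set K := 2 * L.toReal + 1 with hK
  have hKpos : 0 < K := by positivity
  have hKL : ENNReal.ofReal K⁻¹ * L ≤ 2⁻¹ := by
    rw [← ENNReal.ofReal_toReal hLt, ← ENNReal.ofReal_mul (by positivity),
      show (2 : ℝ≥0∞)⁻¹ = ENNReal.ofReal 2⁻¹ by
        rw [ENNReal.ofReal_inv_of_pos (by norm_num)]; simp]
    refine ENNReal.ofReal_le_ofReal ?_
    rw [inv_mul_le_iff₀ hKpos, hK]
    linarith
  -- The weights are powers of S exp(-K(t-a)). Up to this time the base stays at least 1, so they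
  -- remain increasing in the index.
  set c := min (min c₁ c₂) (a + Real.log S / K) with hc
  have hlogS : 0 < Real.log S := Real.log_pos hS1
  have hac : a < c := lt_min (lt_min hc₁.1 hc₂.1) (by
    have : 0 < Real.log S / K := by positivity
    linarith)
  have hcc₁ : c ≤ c₁ := (min_le_left _ _).trans (min_le_left _ _)
  have hcc₂ : c ≤ c₂ := (min_le_left _ _).trans (min_le_right _ _)
  have hcS : K * (c - a) ≤ Real.log S := by
    have : c ≤ a + Real.log S / K := min_le_right _ _
    rw [← sub_le_iff_le_add', le_div_iff₀ hKpos] at this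
    linarith
  have hcb : c ≤ b := hcc₁.trans hc₁.2
  refine ⟨c, ⟨hac, hcb⟩, ?_⟩
  have hfc := hf.mono (Icc_subset_Icc_right hcb)
  have hgc := hg.mono (Icc_subset_Icc_right hcb)
  have hb₁' : ∀ t ∈ Icc a c, (∃ R' > R, DifferentiableOn ℂ (f t) (Metric.ball 0 R')) ∧
      ∀ ξ : ℂ, ‖ξ‖ ≤ R → deriv (f t) ξ ≠ 0 ∧ ‖deriv (f t) ξ‖ ≤ B ∧
        ‖(deriv (f t) ξ)⁻¹‖ ≤ B := by
    intro t ht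
    obtain ⟨⟨R', hR', hd⟩, h2⟩ := hb₁ t ⟨ht.1, ht.2.trans hcc₁⟩
    refine ⟨⟨R', (min_le_left _ _).trans_lt hR', hd⟩, fun ξ hξ => ?_⟩
    obtain ⟨h3, h4, h5⟩ := h2 ξ (hξ.trans (min_le_left _ _))
    exact ⟨h3, h4.trans (le_max_left _ _), h5.trans (le_max_left _ _)⟩
  have hb₂' : ∀ t ∈ Icc a c, (∃ R' > R, DifferentiableOn ℂ (g t) (Metric.ball 0 R')) ∧
      ∀ ξ : ℂ, ‖ξ‖ ≤ R → deriv (g t) ξ ≠ 0 ∧ ‖deriv (g t) ξ‖ ≤ B ∧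
        ‖(deriv (g t) ξ)⁻¹‖ ≤ B := by
    intro t ht
    obtain ⟨⟨R', hR', hd⟩, h2⟩ := hb₂ t ⟨ht.1, ht.2.trans hcc₂⟩
    refine ⟨⟨R', (min_le_right _ _).trans_lt hR', hd⟩, fun ξ hξ => ?_⟩
    obtain ⟨h3, h4, h5⟩ := h2 ξ (hξ.trans (min_le_right _ _))
    exact ⟨h3, h4.trans (le_max_right _ _), h5.trans (le_max_right _ _)⟩
  obtain ⟨D₁, q₁, hq₁, hD₁, hDB₁, hqB₁, hint₁⟩ := hfc.exists_powerSeries hac hR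
    (fun t ht => (hb₁' t ht).1) (fun t ht ξ hξ => ((hb₁' t ht).2 ξ hξ).1)
    (fun t ht ξ hξ => ((hb₁' t ht).2 ξ hξ.le).2)
  obtain ⟨D₂, q₂, hq₂, hD₂, hDB₂, hqB₂, hint₂⟩ := hgc.exists_powerSeries hac hR
    (fun t ht => (hb₂' t ht).1) (fun t ht ξ hξ => ((hb₂' t ht).2 ξ hξ).1)
    (fun t ht ξ hξ => ((hb₂' t ht).2 ξ hξ.le).2)
  -- weights
  let er : ℕ → ℝ → ℝ := fun j t => (S * Real.exp (-(K * (t - a)))) ^ (j + 1)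
  let e : ℕ → C(Icc a c, ℂ) := fun j => ⟨fun t => ((er j t : ℝ) : ℂ), by fun_prop⟩
  have herpos : ∀ j t, 0 < er j t := fun j t => by positivity
  have hne : ∀ j (t : Icc a c), ‖e j t‖ = er j t := fun j t => by
    simp only [e, ContinuousMap.coe_mk, Complex.norm_real, Real.norm_eq_abs,
      abs_of_pos (herpos j t)]
  have hbase : ∀ t : Icc a c, 1 ≤ S * Real.exp (-(K * (t - a))) := by
    intro t
    have h1 : K * ((t : ℝ) - a) ≤ Real.log S := by
      refine le_trans ?_ hcS
      have := t.2.2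
      gcongr
    have h2 : S⁻¹ ≤ Real.exp (-(K * (t - a))) := by
      rw [Real.exp_neg]
      refine inv_anti₀ (Real.exp_pos _) ?_
      calc Real.exp (K * (t - a)) ≤ Real.exp (Real.log S) := Real.exp_le_exp.2 h1
        _ = S := Real.exp_log hS0
    calc (1 : ℝ) = S * S⁻¹ := (mul_inv_cancel₀ hS0.ne').symm
      _ ≤ _ := by gcongr
  have hbaseS : ∀ t : Icc a c, S * Real.exp (-(K * (t - a))) ≤ S := by
    intro t
    refine mul_le_of_le_one_right hS0.le (Real.exp_le_one_iff.2 ?_)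
    have : 0 ≤ K * ((t : ℝ) - a) := mul_nonneg hKpos.le (by linarith [t.2.1])
    linarith
  have hemono : ∀ j i x, ‖e j * x‖ₑ ≤ ‖e (j + i) * x‖ₑ := by
    intro j i x
    refine enorm_mul_le_of_pointwise (fun t => ?_) x
    rw [hne, hne]
    exact pow_le_pow_right₀ (hbase t) (by omega)
  have he1 : ∀ x, ‖x‖ₑ ≤ ‖e 0 * x‖ₑ := by
    intro x
    have := enorm_mul_le_of_pointwise (e := 1) (e' := e 0) (fun t => by
      rw [hne]; simpa [er] using hbase t) x
    rwa [one_mul] at this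
  have hE0 : ‖e 0‖ₑ ≤ E := by
    rw [← ofReal_norm]
    refine ENNReal.ofReal_le_ofReal ?_
    rw [ContinuousMap.norm_le _ hS0.le]
    intro t
    rw [hne]
    simpa [er] using hbaseS t
  have hdecay : ∀ j, ∀ τ t : Icc a c, τ ≤ t →
      ‖e j t‖ ≤ Real.exp (-(K * (j + 1)) * (t - τ)) * ‖e j τ‖ := by
    intro j τ t _
    rw [hne, hne]
    simp only [er]
    rw [mul_pow, mul_pow, ← Real.exp_nat_mul, ← Real.exp_nat_mul, mul_left_comm, ← Real.exp_add]
    refine le_of_eq ?_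
    congr 2
    push_cast
    ring
  have hl1 : ∀ {q : PowerSeries C(Icc a c, ℂ)}, (∀ j, ‖coeff j q‖ ≤ B / R ^ j) →
      l1norm q ≤ Q := by
    intro q hq
    rw [l1norm_eq]
    refine ENNReal.tsum_le_tsum fun j => ?_
    rw [← ofReal_norm]
    refine ENNReal.ofReal_le_ofReal ((hq j).trans (le_of_eq ?_))
    rw [inv_pow, div_eq_mul_inv]
  have hwe : ∀ {q : PowerSeries C(Icc a c, ℂ)}, (∀ j, ‖coeff j q‖ ≤ B / R ^ j) →
      wnorm e q ≤ Φ := by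
    intro q hq
    refine ENNReal.tsum_le_tsum fun j => ?_
    rw [← ofReal_norm]
    refine ENNReal.ofReal_le_ofReal ?_
    rw [ContinuousMap.norm_le _ (by positivity)]
    intro t
    rw [ContinuousMap.mul_apply, norm_mul, hne]
    calc er j t * ‖coeff j q t‖ ≤ S ^ (j + 1) * (B / R ^ j) := by
          refine mul_le_mul ?_ ((ContinuousMap.norm_coe_le_norm _ _).trans (hq j))
            (norm_nonneg _) (by positivity)
          exact pow_le_pow_left₀ (zero_le_one.trans (hbase t)) (hbaseS t) _
      _ = _ := by rw [div_pow]; ring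
  have hlip := wnorm_mul_herglotz_sub_le (star_constC a c σ) (enorm_constC_le hσ) hq₁ hq₂
    (ne_top_of_le_ne_top hQt (hl1 hDB₁)) (ne_top_of_le_ne_top hQt (hl1 hDB₂)) hQt (hl1 hqB₁)
    (hl1 hqB₂) (star_one _) hemono he1 hE0 (hwe hDB₂)
  simp only [mul_one] at hlip
  rw [← eq_inverse_of_mul_eq_one hq₁, ← eq_inverse_of_mul_eq_one hq₂] at hlip
  have hdiff : D₁ - D₂ =
      primSeries hac.le (rhs (constC a c σ) D₁ - rhs (constC a c σ) D₂) := by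
    rw [primSeries_sub]
    ext j t
    have hinit : coeff j D₁ ⟨a, left_mem_Icc.2 hac.le⟩ = coeff j D₂ ⟨a, left_mem_Icc.2 hac.le⟩ := by
      rw [hD₁, hD₂, taylorCoeff_deriv, taylorCoeff_deriv, h0]
    rw [map_sub, map_sub, ContinuousMap.sub_apply, ContinuousMap.sub_apply, hint₁, hint₂, hinit]
    ring
  -- With equal initial coefficients the contraction bounds the difference by half of itself; being
  -- finite, it vanishes.
  have hhalf : wnorm e (D₁ - D₂) ≤ 2⁻¹ * wnorm e (D₁ - D₂) := by
    calc wnorm e (D₁ - D₂)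
        = wnorm e (primSeries hac.le (rhs (constC a c σ) D₁ - rhs (constC a c σ) D₂)) := by
          rw [← hdiff]
      _ ≤ ENNReal.ofReal K⁻¹ * wnorm e (rhs (constC a c σ) D₁ - rhs (constC a c σ) D₂) :=
          wnorm_primSeries_le hac.le hKpos hdecay _
      _ ≤ ENNReal.ofReal K⁻¹ * (L * wnorm e (D₁ - D₂)) := mul_le_mul_right hlip _
      _ ≤ 2⁻¹ * wnorm e (D₁ - D₂) := by
          rw [← mul_assoc]
          exact mul_le_mul_left hKL _
  have hfin : wnorm e (D₁ - D₂) ≠ ∞ :=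
    ne_top_of_le_ne_top (ENNReal.add_ne_top.2 ⟨hΦt, hΦt⟩)
      ((wnorm_sub_le _ _ _).trans (add_le_add (hwe hDB₁) (hwe hDB₂)))
  have hzero : wnorm e (D₁ - D₂) = 0 := by
    by_contra hne0
    have h1 : 2⁻¹ * wnorm e (D₁ - D₂) < wnorm e (D₁ - D₂) := by
      rw [← ENNReal.div_eq_inv_mul]
      exact ENNReal.half_lt_self hne0 hfin
    exact absurd hhalf (not_le.2 h1)
  intro t ht n
  cases n with
  | zero => rw [taylorCoeff_zero, taylorCoeff_zero, (hfc.1 t ht).apply_zero,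
      (hgc.1 t ht).apply_zero]
  | succ j =>
    have h1 : e j * coeff j (D₁ - D₂) = 0 := by
      have := enorm_coeff_le_wnorm e (D₁ - D₂) j
      rw [hzero] at this
      simpa using this
    have h2 := congrArg (fun x : C(Icc a c, ℂ) => x ⟨t, ht⟩) h1
    have h3 : e j ⟨t, ht⟩ ≠ 0 := by
      rw [← norm_pos_iff, hne]; exact herpos _ _
    simp only [ContinuousMap.mul_apply, map_sub, ContinuousMap.sub_apply,
      ContinuousMap.zero_apply, mul_eq_zero, h3, false_or, hD₁, hD₂] at h2
    rw [taylorCoeff_deriv, taylorCoeff_deriv, ← mul_sub] at h2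
    have h4 : ((j : ℂ) + 1) ≠ 0 := by exact_mod_cast Nat.succ_ne_zero j
    exact sub_eq_zero.1 ((mul_eq_zero.1 h2).resolve_left h4)

/-- A strong solution is determined by its initial function. -/
theorem IsStrongSolution.eqOn_of_eqOn_zero {T : ℝ} (hT : 0 ≤ T)
    (hf : IsStrongSolution σ (Icc 0 T) f) (hg : IsStrongSolution σ (Icc 0 T) g)
    (hσ : |σ| ≤ 1) (h0 : ∀ n, taylorCoeff (f 0) n = taylorCoeff (g 0) n) :
    ∀ t ∈ Icc 0 T, EqOn (f t) (g t) (Metric.closedBall 0 1) := by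
  have hcoeff : ∀ t ∈ Icc 0 T, ∀ n, taylorCoeff (f t) n = taylorCoeff (g t) n := by
    rcases hT.eq_or_lt with rfl | hT
    · intro t ht
      rwa [le_antisymm ht.2 ht.1]
    obtain ⟨w, hder, -⟩ := hf.exists_deriv_taylorCoeff hT
    obtain ⟨w', hder', -⟩ := hg.exists_deriv_taylorCoeff hT
    set s : Set ℝ := {t | ∀ n, taylorCoeff (f t) n = taylorCoeff (g t) n} with hs
    have hclosed : IsClosed (s ∩ Icc 0 T) := by
      have : s ∩ Icc 0 T = ⋂ n, (Icc 0 T ∩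
          {t | taylorCoeff (f t) n - taylorCoeff (g t) n ∈ ({0} : Set ℂ)}) := by
        ext t
        simp only [hs, mem_inter_iff, mem_ofPred_eq, mem_iInter, mem_singleton_iff, sub_eq_zero]
        exact ⟨fun h n => ⟨h.2, h.1 n⟩, fun h => ⟨fun n => (h n).2, (h 0).1⟩⟩
      rw [this]
      refine isClosed_iInter fun n => ?_
      exact ContinuousOn.preimage_isClosed_of_isClosed
        (fun t ht => ((hder t ht n).continuousWithinAt.sub (hder' t ht n).continuousWithinAt))
        isClosed_Icc isClosed_singleton
    -- Continuation: the set of times of agreement is closed, contains 0 and extends to the right of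
    -- each of its points before T.
    have hsub : Icc 0 T ⊆ s := by
      refine hclosed.Icc_subset_of_forall_exists_gt h0 fun x hx y hy => ?_
      have hxT : x < T := hx.2.2
      obtain ⟨c, hc, hcs⟩ := (hf.mono (Icc_subset_Icc_left hx.2.1)).eq_taylorCoeff_of_eq hxT
        (hg.mono (Icc_subset_Icc_left hx.2.1)) hσ hx.1
      refine ⟨min c y, hcs _ ⟨(lt_min hc.1 hy).le, min_le_left _ _⟩, lt_min hc.1 hy,
        min_le_right _ _⟩
    exact fun t ht => hsub ht
  have hball : ∀ {h : ℝ → ℂ → ℂ}, IsStrongSolution σ (Icc 0 T) h → ∀ t ∈ Icc 0 T,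
      ∃ R > (1 : ℝ), DifferentiableOn ℂ (h t) (Metric.ball 0 R) := by
    rintro h ⟨-, w, hloc, -⟩ t ht
    obtain ⟨R, hR, η, hη, hd⟩ := hloc t ht
    exact ⟨R, hR, hd.analytic t ⟨ht, Metric.mem_ball_self hη⟩⟩
  intro t ht ξ hξ
  obtain ⟨R, hR, hd⟩ := hball hf t ht
  obtain ⟨R', hR', hd'⟩ := hball hg t ht
  have hξ' : ‖ξ‖ ≤ 1 := by simpa using hξ
  have h1 := hasSum_taylorCoeff hd (hξ'.trans_lt hR)
  have h2 := hasSum_taylorCoeff hd' (hξ'.trans_lt hR')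
  refine h1.unique (h2.congr_fun fun n => ?_)
  rw [hcoeff t ht n]

end Uniqueness

/-! ### Power series with time-dependent coefficients -/

section Families

theorem psum_mk_sub {x y : ℕ → ℂ} {s : ℝ} (hx : Summable fun n => ‖x n‖ * s ^ n)
    (hy : Summable fun n => ‖y n‖ * s ^ n) {ξ : ℂ} (hξ : ‖ξ‖ ≤ s) :
    psum (PowerSeries.mk x) ξ - psum (PowerSeries.mk y) ξ =
      psum (PowerSeries.mk fun n => x n - y n) ξ := by
  unfold psum
  rw [← (summable_psum (by simpa using hx) hξ).tsum_sub (summable_psum (by simpa using hy) hξ)]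
  simp [sub_mul]

/-- Dominated convergence for ∑ ‖x n i - y n‖ sⁿ, which bounds the difference uniformly on the disk.
-/
theorem tendstoUniformlyOn_psum {ι : Type*} {l : Filter ι} {x : ℕ → ι → ℂ} {y : ℕ → ℂ} {M : ℕ → ℝ}
    {s : ℝ} (hs : 0 ≤ s) (hM : Summable fun n => M n * s ^ n)
    (hx : ∀ᶠ i in l, ∀ n, ‖x n i‖ ≤ M n) (hy : ∀ n, ‖y n‖ ≤ M n)
    (hlim : ∀ n, Tendsto (x n) l (𝓝 (y n))) :
    TendstoUniformlyOn (fun i => psum (PowerSeries.mk fun n => x n i)) (psum (PowerSeries.mk y)) l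
      (Metric.ball 0 s) := by
  have hsum : Tendsto (fun i => ∑' n, ‖x n i - y n‖ * s ^ n) l (𝓝 0) := by
    have := tendsto_tsum_of_dominated_convergence (f := fun i n => ‖x n i - y n‖ * s ^ n)
      (g := fun _ => (0 : ℝ)) (𝓕 := l) (bound := fun n => 2 * (M n * s ^ n)) (hM.mul_left 2)
      (fun n => by
        have h1 : Tendsto (fun i => ‖x n i - y n‖) l (𝓝 0) := by
          rw [← tendsto_iff_norm_sub_tendsto_zero]
          exact hlim n
        simpa using h1.mul_const (s ^ n))
      (by
        filter_upwards [hx] with i hi n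
        rw [Real.norm_of_nonneg (by positivity)]
        have h1 := norm_sub_le (x n i) (y n)
        have h2 : ‖x n i - y n‖ ≤ 2 * M n := by linarith [hi n, hy n]
        calc ‖x n i - y n‖ * s ^ n ≤ 2 * M n * s ^ n := by gcongr
          _ = _ := by ring)
    simpa using this
  have hbd : ∀ {z : ℕ → ℂ}, (∀ n, ‖z n‖ ≤ M n) → Summable fun n => ‖z n‖ * s ^ n := fun hz =>
    Summable.of_nonneg_of_le (fun n => by positivity) (fun n => by gcongr; exact hz n) hM
  rw [Metric.tendstoUniformlyOn_iff]
  intro ε hε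
  filter_upwards [hx, hsum.eventually (gt_mem_nhds hε)] with i hi hlt ξ hξ
  have hξ' : ‖ξ‖ ≤ s := (mem_ball_zero_iff.1 hξ).le
  rw [dist_comm, dist_eq_norm, psum_mk_sub (hbd hi) (hbd hy) hξ']
  refine lt_of_le_of_lt ?_ hlt
  have hd : Summable fun n => ‖x n i - y n‖ * s ^ n := by
    refine Summable.of_nonneg_of_le (fun n => by positivity) (fun n => ?_)
      ((hbd hi).add (hbd hy))
    rw [← add_mul]
    gcongr
    exact norm_sub_le _ _
  unfold psum
  refine tsum_of_norm_bounded hd.hasSum fun n => ?_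
  rw [coeff_mk, norm_mul, norm_pow]
  gcongr

/-- A power series whose coefficients are continuously differentiable in time is continuously
differentiable in time as an analytic function. -/
theorem hasContTimeDeriv_psum {x x' : ℕ → ℝ → ℂ} {M : ℕ → ℝ} {s : ℝ} (hs : 0 ≤ s) {I : Set ℝ}
    (hI : Convex ℝ I) (hM : Summable fun n => M n * s ^ n)
    (hx : ∀ t ∈ I, Summable fun n => ‖x n t‖ * s ^ n) (hx' : ∀ n, ∀ t ∈ I, ‖x' n t‖ ≤ M n)
    (hder : ∀ n, ∀ t ∈ I, HasDerivWithinAt (x n) (x' n t) I t)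
    (hcont : ∀ n, ContinuousOn (x' n) I) :
    HasContTimeDeriv (Metric.ball 0 s) I (fun t => psum (PowerSeries.mk fun n => x n t))
      (fun t => psum (PowerSeries.mk fun n => x' n t)) where
  analytic t ht := differentiableOn_psum (by simpa using hx t ht)
  analytic_deriv t ht := differentiableOn_psum (by
    refine Summable.of_nonneg_of_le (fun n => by positivity) (fun n => ?_) hM
    rw [coeff_mk]
    gcongr
    exact hx' n t ht)
  hasDeriv t ht := by
    have hmem : ∀ᶠ τ in 𝓝[I \ {t}] t, τ ∈ I \ {t} := self_mem_nhdsWithin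
    -- By the mean value inequality the slopes obey the same bounds as the derivatives, so they are
    -- dominated too.
    have hbound : ∀ τ ∈ I \ {t}, ∀ n, ‖slope (x n) t τ‖ ≤ M n := by
      intro τ hτ n
      have h1 := hI.norm_image_sub_le_of_norm_hasDerivWithin_le (hder n) (hx' n) ht hτ.1
      have h2 : 0 < ‖τ - t‖ := norm_pos_iff.2 (sub_ne_zero.2 hτ.2)
      rw [slope_def_module, norm_smul, norm_inv, inv_mul_le_iff₀ h2, mul_comm]
      exact h1
    have hU := tendstoUniformlyOn_psum (l := 𝓝[I \ {t}] t) (x := fun n τ => slope (x n) t τ)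
      (y := fun n => x' n t) hs hM (hmem.mono hbound) (fun n => hx' n t ht)
      (fun n => hasDerivWithinAt_iff_tendsto_slope.1 (hder n t ht))
    refine (hU.congr ?_).tendstoLocallyUniformlyOn
    filter_upwards [hmem] with τ hτ ξ hξ
    have hξ' : ‖ξ‖ ≤ s := (mem_ball_zero_iff.1 hξ).le
    simp only
    rw [psum_mk_sub (hx τ hτ.1) (hx t ht) hξ']
    unfold psum
    rw [← tsum_div_const]
    refine tsum_congr fun n => ?_
    rw [coeff_mk, coeff_mk, slope_def_module, Complex.real_smul, Complex.ofReal_inv,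
      Complex.ofReal_sub]
    ring
  cont t ht :=
    (tendstoUniformlyOn_psum hs hM (by
      filter_upwards [self_mem_nhdsWithin] with τ hτ n using hx' n τ hτ)
      (fun n => hx' n t ht) (fun n => hcont n t ht)).tendstoLocallyUniformlyOn

end Families

/-! ### Functions with prescribed coefficients of the derivative -/

section Construction

variable {T : ℝ} (hT : 0 ≤ T)

/-- The coefficients of the function that vanishes at `0` and has the derivative with
coefficients `D`. -/
def antiCoeff (D : PowerSeries C(Icc 0 T, ℂ)) (n : ℕ) (t : ℝ) : ℂ :=
  if n = 0 then 0 else IccExtend hT (⇑(coeff (n - 1) D)) t / n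

/-- The function that vanishes at `0` and has the derivative with coefficients `D`. -/
def antiFun (D : PowerSeries C(Icc 0 T, ℂ)) (t : ℝ) : ℂ → ℂ :=
  psum (PowerSeries.mk fun n => antiCoeff hT D n t)

/-- The function with coefficients `W`, shifted by one. -/
def shiftCoeff (W : PowerSeries C(Icc 0 T, ℂ)) (n : ℕ) (t : ℝ) : ℂ :=
  if n = 0 then 0 else IccExtend hT (⇑(coeff (n - 1) W)) t

theorem norm_IccExtend_le (x : C(Icc 0 T, ℂ)) (t : ℝ) : ‖IccExtend hT x t‖ ≤ ‖x‖ :=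
  ContinuousMap.norm_coe_le_norm x _

variable {D W : PowerSeries C(Icc 0 T, ℂ)} {S : ℝ}

theorem summable_shift_bound (hW : Summable fun j => ‖coeff j W‖ * S ^ j) :
    Summable fun n : ℕ => (if n = 0 then 0 else ‖coeff (n - 1) W‖) * S ^ n := by
  rw [← summable_nat_add_iff 1]
  refine (hW.mul_left S).congr fun j => ?_
  simp [pow_succ]
  ring

theorem norm_antiCoeff_le (n : ℕ) (t : ℝ) :
    ‖antiCoeff hT D n t‖ ≤ if n = 0 then 0 else ‖coeff (n - 1) D‖ := by
  unfold antiCoeff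
  split_ifs with hn
  · simp
  · rw [norm_div, Complex.norm_natCast]
    have : (1 : ℝ) ≤ n := by exact_mod_cast Nat.one_le_iff_ne_zero.2 hn
    exact (div_le_self (norm_nonneg _) this).trans (norm_IccExtend_le hT _ t)

theorem summable_antiCoeff (hS : 0 ≤ S) (hD : Summable fun j => ‖coeff j D‖ * S ^ j) (t : ℝ) :
    Summable fun n => ‖antiCoeff hT D n t‖ * S ^ n := by
  refine Summable.of_nonneg_of_le (fun n => by positivity) (fun n => ?_) (summable_shift_bound hD)
  gcongr
  exact norm_antiCoeff_le hT n t

theorem taylorCoeff_antiFun (hS : 0 < S) (hD : Summable fun j => ‖coeff j D‖ * S ^ j) (t : ℝ)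
    (n : ℕ) : taylorCoeff (antiFun hT D t) n = antiCoeff hT D n t := by
  rw [antiFun, taylorCoeff_psum hS (by simpa using summable_antiCoeff hT hS.le hD t), coeff_mk]

theorem differentiableOn_antiFun (hS : 0 ≤ S) (hD : Summable fun j => ‖coeff j D‖ * S ^ j)
    (t : ℝ) : DifferentiableOn ℂ (antiFun hT D t) (Metric.ball 0 S) :=
  differentiableOn_psum (by simpa using summable_antiCoeff hT hS hD t)

theorem taylorSeries_deriv_antiFun (hS : 0 < S) (hD : Summable fun j => ‖coeff j D‖ * S ^ j)
    (t : Icc 0 T) : taylorSeries (deriv (antiFun hT D t)) = atTime t D := by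
  ext j
  rw [coeff_taylorSeries, taylorCoeff_deriv, taylorCoeff_antiFun hT hS hD, coeff_atTime, antiCoeff,
    if_neg (Nat.succ_ne_zero j), Nat.add_sub_cancel, IccExtend_val]
  have : ((j : ℂ) + 1) ≠ 0 := by exact_mod_cast Nat.succ_ne_zero j
  push_cast
  field_simp

theorem deriv_antiFun (hS : 0 < S) (hD : Summable fun j => ‖coeff j D‖ * S ^ j)
    (t : Icc 0 T) {ξ : ℂ} (hξ : ‖ξ‖ < S) :
    deriv (antiFun hT D t) ξ = psum (atTime t D) ξ := by
  rw [← taylorSeries_deriv_antiFun hT hS hD t]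
  exact (psum_taylorSeries ((differentiableOn_antiFun hT hS.le hD t).deriv Metric.isOpen_ball)
    hξ).symm

/-- Integral equations give continuously differentiable families of analytic functions. -/
theorem hasContTimeDeriv_antiFun (hS : 0 ≤ S) (hD : Summable fun j => ‖coeff j D‖ * S ^ j)
    (hW : Summable fun j => ‖coeff j W‖ * S ^ j)
    (h : ∀ j t, coeff j D t = coeff j D ⟨0, left_mem_Icc.2 hT⟩ + coeff j (primSeries hT W) t) :
    HasContTimeDeriv (Metric.ball 0 S) (Icc 0 T) (antiFun hT D)
      (fun t => psum (PowerSeries.mk fun n => shiftCoeff hT W n t)) := by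
  refine hasContTimeDeriv_psum (M := fun n => if n = 0 then 0 else ‖coeff (n - 1) W‖) hS
    (convex_Icc 0 T) (summable_shift_bound hW) (fun t _ => summable_antiCoeff hT hS hD t)
    (fun n t _ => ?_) (fun n t ht => ?_) (fun n => ?_)
  · unfold shiftCoeff
    split_ifs
    · simp
    · exact norm_IccExtend_le hT _ t
  · unfold shiftCoeff
    cases n with
    | zero =>
      simp only [if_true]
      exact (hasDerivWithinAt_const t _ (0 : ℂ)).congr (fun s _ => by simp [antiCoeff])
        (by simp [antiCoeff])
    | succ j =>
      rw [if_neg (Nat.succ_ne_zero j), Nat.add_sub_cancel]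
      set w : C(Icc 0 T, ℂ) := coeff j W with hw
      have hc : Continuous (IccExtend hT w) := w.continuous.Icc_extend'
      have h1 : HasDerivAt (fun s => ∫ τ in (0 : ℝ)..s, IccExtend hT w τ) (IccExtend hT w t) t :=
        intervalIntegral.integral_hasDerivAt_right (hc.intervalIntegrable _ _)
          (hc.stronglyMeasurableAtFilter _ _) hc.continuousAt
      have h2 : ∀ s ∈ Icc 0 T, antiCoeff hT D (j + 1) s =
          coeff j D ⟨0, left_mem_Icc.2 hT⟩ / ((j : ℂ) + 1) +
            ∫ τ in (0 : ℝ)..s, IccExtend hT w τ := by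
        intro s hs
        have h3 := h j ⟨s, hs⟩
        rw [coeff_primSeries, ContinuousMap.mul_apply, prim_apply, ← hw] at h3
        have h4 : ((j : ℂ) + 1) ≠ 0 := by exact_mod_cast Nat.succ_ne_zero j
        rw [antiCoeff, if_neg (Nat.succ_ne_zero j), Nat.add_sub_cancel, IccExtend_of_mem hT _ hs,
          h3]
        simp only [ContinuousMap.add_apply, ContinuousMap.natCast_apply, ContinuousMap.one_apply]
        push_cast
        field_simp
      exact (h1.const_add _).hasDerivWithinAt.congr h2 (h2 t ht)
  · unfold shiftCoeff
    by_cases hn : n = 0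
    · simp only [hn, if_true]; exact continuousOn_const
    · simp only [hn, if_false]
      exact ((ContinuousMap.continuous _).Icc_extend').continuousOn

theorem psum_shift (hS : 1 ≤ S) (hW : Summable fun j => ‖coeff j W‖ * S ^ j) (t : Icc 0 T) {ξ : ℂ}
    (hξ : ‖ξ‖ ≤ 1) :
    psum (PowerSeries.mk fun n => shiftCoeff hT W n t) ξ = ξ * psum (atTime t W) ξ := by
  have hs : Summable fun n => shiftCoeff hT W n t * ξ ^ n := by
    refine Summable.of_norm_bounded (summable_shift_bound hW) fun n => ?_
    rw [norm_mul, norm_pow]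
    gcongr
    · unfold shiftCoeff
      split_ifs
      · simp
      · exact norm_IccExtend_le hT _ t
    · exact hξ.trans hS
  unfold psum
  simp only [coeff_mk]
  rw [hs.tsum_eq_zero_add, ← tsum_mul_left]
  simp only [shiftCoeff, if_true, zero_mul, zero_add]
  refine tsum_congr fun n => ?_
  rw [if_neg (Nat.succ_ne_zero n), Nat.add_sub_cancel, IccExtend_val, coeff_atTime, pow_succ]
  ring

end Construction

/-! ### Strong solutions from coefficient solutions -/

section SolutionFromCoefficients

variable {T σ S : ℝ} (hT : 0 ≤ T) {D q : PowerSeries C(Icc 0 T, ℂ)}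

theorem l1norm_ne_top_of_summable_pow {A : Type*} [NormedCommRing A] {D : PowerSeries A}
    (hS : 1 ≤ S) (hD : Summable fun j => ‖coeff j D‖ * S ^ j) : l1norm D ≠ ∞ :=
  l1norm_ne_top_of_summable (Summable.of_nonneg_of_le (fun _ => norm_nonneg _)
    (fun _ => le_mul_of_one_le_right (norm_nonneg _) (one_le_pow₀ hS)) hD)

/-- The right-hand side of the evolution equation converges in the same disks as its argument. -/
theorem summable_rhs (hσ : |σ| ≤ 1) (hS : 1 ≤ S) (h : D * q = 1) (hq : l1norm q ≠ ∞)
    (hD : Summable fun j => ‖coeff j D‖ * S ^ j) :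
    Summable fun j => ‖coeff j (rhs (constC 0 T σ) D)‖ * S ^ j := by
  have hS0 : 0 ≤ S := by linarith
  let e : ℕ → C(Icc 0 T, ℂ) := fun j => ContinuousMap.const _ ((S ^ j : ℝ) : ℂ)
  have hen : ∀ j (x : C(Icc 0 T, ℂ)), ‖e j * x‖ = ‖x‖ * S ^ j := by
    intro j x
    have : e j * x = ((S ^ j : ℝ) : ℂ) • x := by ext t; simp [e]
    rw [this, norm_smul, Complex.norm_real, Real.norm_of_nonneg (by positivity), mul_comm]
  have hw : ∀ {V : PowerSeries C(Icc 0 T, ℂ)}, (Summable fun j => ‖coeff j V‖ * S ^ j) ↔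
      wnorm e V ≠ ∞ := by
    intro V
    have h1 : wnorm e V = ∑' j, ENNReal.ofReal (‖coeff j V‖ * S ^ j) :=
      tsum_congr fun j => by rw [← ofReal_norm, hen]
    rw [h1]
    refine ⟨fun h => h.tsum_ofReal_ne_top, fun h => ?_⟩
    refine (ENNReal.summable_toReal h).congr fun j => ?_
    rw [ENNReal.toReal_ofReal (by positivity)]
  have hD1 := l1norm_ne_top_of_summable_pow hS hD
  rw [hw] at hD ⊢
  -- The product D p itself gives no convergence beyond the unit disk, as q is only in ℓ¹; its
  -- correlation form needs the radius S for D alone.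
  rw [rhs, eq_inverse_of_mul_eq_one h, mul_herglotz (star_constC 0 T σ) hD1 hq h]
  refine ne_top_of_le_ne_top (ENNReal.add_ne_top.2 ⟨?_, ?_⟩) (wnorm_sub_le _ _ _)
  · refine hw.1 (summable_of_ne_finset_zero (s := {0}) fun j hj => ?_)
    rw [coeff_C, if_neg (by simpa using hj), norm_zero, zero_mul]
  · have hmono : ∀ j i x, ‖e j * x‖ₑ ≤ ‖e (j + i) * x‖ₑ := by
      intro j i x
      rw [← ofReal_norm, ← ofReal_norm, hen, hen]
      refine ENNReal.ofReal_le_ofReal ?_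
      gcongr
      exact Nat.le_add_right j i
    have := wnorm_corr_le (μ := 1) hmono (star_one _) D (herglotz (constC 0 T σ) q)
    simp only [mul_one] at this
    refine ne_top_of_le_ne_top (ENNReal.mul_ne_top hD ?_) this
    exact ne_top_of_le_ne_top (by finiteness) (l1norm_herglotz_le (enorm_constC_le hσ) q)

/-- The boundary equation for the function with the coefficients `D`. -/
theorem boundary_equation (hσ : |σ| ≤ 1) (hS : 1 < S) (h : D * q = 1) (hq : l1norm q ≠ ∞)
    (hD : Summable fun j => ‖coeff j D‖ * S ^ j) (t : Icc 0 T) {ξ : ℂ} (hξ : ‖ξ‖ = 1) :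
    (psum (PowerSeries.mk fun n => shiftCoeff hT (rhs (constC 0 T σ) D) n t) ξ *
      (starRingEnd ℂ) (deriv (antiFun hT D t) ξ * ξ)).re = σ := by
  have hS0 : 0 < S := by linarith
  have hDl := l1norm_atTime_ne_top t (l1norm_ne_top_of_summable_pow hS.le hD)
  have hql := l1norm_atTime_ne_top t hq
  have hpl : l1norm (herglotz (σ : ℂ) (atTime t q)) ≠ ∞ := by
    refine ne_top_of_le_ne_top (by finiteness) (l1norm_herglotz_le ?_ _)
    rw [← ofReal_norm, ← ENNReal.ofReal_one, Complex.norm_real]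
    exact ENNReal.ofReal_le_ofReal hσ
  rw [psum_shift hT hS.le (summable_rhs hσ hS.le h hq hD) t hξ.le,
    deriv_antiFun hT hS0 hD t (by rw [hξ]; exact hS), atTime_rhs t _ h hq,
    show constC 0 T σ t = (σ : ℂ) from rfl,
    psum_mul (summable_pow_one hDl) (summable_pow_one hpl) hξ.le]
  set d := psum (atTime t D) ξ with hd
  set p := psum (herglotz (σ : ℂ) (atTime t q)) ξ with hp
  have h1 : d * psum (atTime t q) ξ = 1 := by
    rw [hd, ← psum_mul (summable_pow_one hDl) (summable_pow_one hql) hξ.le, ← map_mul, h, map_one,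
      psum_one]
  have h2 : ξ * (d * p) * (starRingEnd ℂ) (d * ξ) = ((‖d‖ ^ 2 : ℝ) : ℂ) * p := by
    have e1 : ((‖d‖ ^ 2 : ℝ) : ℂ) = d * (starRingEnd ℂ) d := by
      rw [Complex.mul_conj, Complex.normSq_eq_norm_sq]
    have e2 : ξ * (starRingEnd ℂ) ξ = 1 := by
      rw [Complex.mul_conj, Complex.normSq_eq_norm_sq, hξ]; simp
    rw [map_mul, e1]
    linear_combination (d * p * (starRingEnd ℂ) d) * e2
  rw [h2, Complex.re_ofReal_mul, hp, re_psum_herglotz hql hξ]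
  have h3 : ‖d‖ * ‖psum (atTime t q) ξ‖ = 1 := by rw [← norm_mul, h1, norm_one]
  calc ‖d‖ ^ 2 * (σ * ‖psum (atTime t q) ξ‖ ^ 2) = σ * (‖d‖ * ‖psum (atTime t q) ξ‖) ^ 2 := by ring
    _ = σ := by rw [h3]; ring

/-- The constant coefficient stays real. -/
theorem im_coeff_zero_eq_zero (h : D * q = 1)
    (hint : ∀ j t, coeff j D t = coeff j D ⟨0, left_mem_Icc.2 hT⟩ +
      coeff j (primSeries hT (rhs (constC 0 T σ) D)) t)
    (h0 : (coeff 0 D ⟨0, left_mem_Icc.2 hT⟩).im = 0) (t : Icc 0 T) : (coeff 0 D t).im = 0 := by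
  set d : C(Icc 0 T, ℂ) := coeff 0 D with hd
  set w : C(Icc 0 T, ℂ) := coeff 0 (rhs (constC 0 T σ) D) with hw
  set H : C(Icc 0 T, ℂ) := coeff 0 (herglotz (constC 0 T σ) q) with hH
  -- In order 0 the equation is d' = d H with H real, so Im d solves a linear homogeneous equation
  -- and stays 0.
  have hwd : w = d * H := by
    rw [hw, rhs, eq_inverse_of_mul_eq_one h, coeff_mul]
    simp [hd, hH]
  have hHim : ∀ t, (H t).im = 0 := by
    intro t
    have h1 : H = constC 0 T σ * coeff 0 (corr q q) := by
      rw [hH, coeff_herglotz]; simp [two_mul]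
    have h2 : star (H t) = H t := by
      have : star H = H := by rw [h1, star_mul, star_constC, star_coeff_zero_corr, mul_comm]
      conv_rhs => rw [← this]
      rfl
    exact Complex.conj_eq_iff_im.1 h2
  have hc : Continuous (IccExtend hT w) := w.continuous.Icc_extend'
  have hder : ∀ s : ℝ, HasDerivAt (fun s => ∫ τ in (0 : ℝ)..s, IccExtend hT w τ)
      (IccExtend hT w s) s := fun s =>
    intervalIntegral.integral_hasDerivAt_right (hc.intervalIntegrable _ _)
      (hc.stronglyMeasurableAtFilter _ _) hc.continuousAt
  let y : ℝ → ℝ := fun s => (d ⟨0, left_mem_Icc.2 hT⟩ + ∫ τ in (0 : ℝ)..s, IccExtend hT w τ).im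
  have hyd : ∀ s, HasDerivAt y (IccExtend hT w s).im s := fun s =>
    (Complex.imCLM.hasFDerivAt.comp_hasDerivAt s ((hder s).const_add _))
  have hy : ∀ s : Icc 0 T, y s = (d s).im := by
    intro s
    have h3 := hint 0 s
    rw [coeff_primSeries, ContinuousMap.mul_apply, prim_apply, ← hw] at h3
    simp only [ContinuousMap.one_apply,
      Nat.cast_zero, zero_add, one_mul] at h3
    simp only [y]
    rw [← h3]
  have hyc : ContinuousOn y (Icc 0 T) := fun s _ => (hyd s).continuousAt.continuousWithinAt
  have hzero := eq_zero_of_abs_deriv_le_mul_abs_self_of_eq_zero_right (K := ‖H‖) hyc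
    (fun s _ => (hyd s).hasDerivWithinAt)
    (by rw [show (0 : ℝ) = ((⟨0, left_mem_Icc.2 hT⟩ : Icc 0 T) : ℝ) from rfl, hy]; exact h0)
    (fun s hs => by
      have hs' : s ∈ Icc 0 T := ⟨hs.1, hs.2.le⟩
      rw [IccExtend_of_mem hT _ hs', hwd, ContinuousMap.mul_apply, Complex.mul_im, hHim,
        mul_zero, zero_add, norm_mul, mul_comm, show y s = (d ⟨s, hs'⟩).im from hy ⟨s, hs'⟩]
      gcongr
      exact (Complex.abs_re_le_norm _).trans (ContinuousMap.norm_coe_le_norm H _)) t t.2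
  rw [← hy t]
  exact hzero

end SolutionFromCoefficients

/-! ### Uniform univalence of the polynomial family -/

section Polynomial

theorem taylorCoeff_eval (p : Polynomial ℂ) (n : ℕ) :
    taylorCoeff (fun ξ => p.eval ξ) n = p.coeff n := by
  refine taylorCoeff_eq_of_hasSum one_pos (fun ξ _ => ?_) n
  rw [Polynomial.eval_eq_sum_range]
  refine hasSum_sum_of_ne_finset_zero fun j hj => ?_
  rw [Polynomial.coeff_eq_zero_of_natDegree_lt (by simpa [Nat.lt_succ_iff] using hj), zero_mul]

/-- Uniform bounds for the difference quotients of a compact family of univalent polynomials. -/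
theorem exists_bounds_polynomial {k₀ : ℕ} {T r : ℝ} (hT : 0 ≤ T) (hr : 0 ≤ r)
    {P : ℝ → Polynomial ℂ} (hdeg : ∀ t ∈ Icc 0 T, (P t).natDegree ≤ k₀)
    (hcont : ∀ n, ContinuousOn (fun t => (P t).coeff n) (Icc 0 T))
    (hinj : ∀ t ∈ Icc 0 T, InjOn (fun ξ => (P t).eval ξ) (Metric.closedBall 0 r))
    (hne : ∀ t ∈ Icc 0 T, ∀ ξ ∈ Metric.closedBall (0 : ℂ) r,
      deriv (fun ξ => (P t).eval ξ) ξ ≠ 0) :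
    ∃ c > 0, ∃ M : ℝ, ∀ t ∈ Icc 0 T, ∀ x ∈ Metric.closedBall (0 : ℂ) r,
      (c ≤ ‖deriv (fun ξ => (P t).eval ξ) x‖ ∧ ‖deriv (fun ξ => (P t).eval ξ) x‖ ≤ M) ∧
      ∀ y ∈ Metric.closedBall (0 : ℂ) r,
        c * ‖x - y‖ ≤ ‖(P t).eval x - (P t).eval y‖ := by
  -- The divided difference of P t at two points, continued to the diagonal by the derivative.
  -- Univalence makes it zero-free on a compact set.
  let Q : ℝ × ℂ × ℂ → ℂ := fun z => ∑ j ∈ Finset.range (k₀ + 1),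
    (P z.1).coeff j * ∑ i ∈ Finset.range j, z.2.1 ^ i * z.2.2 ^ (j - 1 - i)
  have heval : ∀ t ∈ Icc 0 T, ∀ x, (P t).eval x =
      ∑ j ∈ Finset.range (k₀ + 1), (P t).coeff j * x ^ j := fun t ht x =>
    Polynomial.eval_eq_sum_range' (Nat.lt_succ_of_le (hdeg t ht)) x
  have hQ : ∀ t ∈ Icc 0 T, ∀ x y, Q (t, x, y) * (x - y) = (P t).eval x - (P t).eval y := by
    intro t ht x y
    rw [heval t ht, heval t ht, ← Finset.sum_sub_distrib, Finset.sum_mul]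
    refine Finset.sum_congr rfl fun j _ => ?_
    rw [mul_assoc, geom_sum₂_mul, mul_sub]
  have hQd : ∀ t ∈ Icc 0 T, ∀ x, Q (t, x, x) = deriv (fun ξ => (P t).eval ξ) x := by
    intro t ht x
    have h1 : HasDerivAt (fun ξ => (P t).eval ξ) (Q (t, x, x)) x := by
      have h2 : (fun ξ => (P t).eval ξ) =
          fun ξ => ∑ j ∈ Finset.range (k₀ + 1), (P t).coeff j * ξ ^ j := by
        funext ξ; exact heval t ht ξ
      rw [h2]
      refine HasDerivAt.fun_sum fun j _ => ?_
      have h3 := (hasDerivAt_pow j x).const_mul ((P t).coeff j)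
      refine h3.congr_deriv ?_
      congr 1
      rw [Finset.sum_congr rfl (g := fun _ => x ^ (j - 1)) fun i hi => ?_]
      · simp
      · rw [← pow_add]
        congr 1
        have := Finset.mem_range.1 hi
        omega
    exact h1.deriv.symm
  set K : Set (ℝ × ℂ × ℂ) :=
    Icc 0 T ×ˢ (Metric.closedBall (0 : ℂ) r ×ˢ Metric.closedBall (0 : ℂ) r) with hK
  have hKc : IsCompact K :=
    isCompact_Icc.prod ((isCompact_closedBall _ _).prod (isCompact_closedBall _ _))
  have hKne : K.Nonempty := ⟨(0, 0, 0), ⟨le_rfl, hT⟩, by simpa using hr, by simpa using hr⟩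
  have hQc : ContinuousOn Q K := by
    refine continuousOn_finsetSum _ fun j _ => ?_
    refine ContinuousOn.mul ?_ (by fun_prop)
    exact (hcont j).comp continuous_fst.continuousOn fun z hz => hz.1
  have hQne : ∀ z ∈ K, Q z ≠ 0 := by
    rintro ⟨t, x, y⟩ ⟨ht, hx, hy⟩ h0
    simp only at ht hx hy
    by_cases hxy : x = y
    · subst hxy
      rw [hQd t ht] at h0
      exact hne t ht x hx h0
    · have := hQ t ht x y
      rw [h0, zero_mul] at this
      exact hxy (hinj t ht hx hy (sub_eq_zero.1 this.symm))
  obtain ⟨z₀, hz₀, hmin⟩ := hKc.exists_isMinOn hKne hQc.norm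
  obtain ⟨M, hM⟩ := hKc.exists_bound_of_continuousOn hQc
  refine ⟨‖Q z₀‖, norm_pos_iff.2 (hQne z₀ hz₀), M, fun t ht x hx => ⟨?_, fun y hy => ?_⟩⟩
  · rw [← hQd t ht x]
    exact ⟨hmin ⟨ht, hx, hx⟩, hM _ ⟨ht, hx, hx⟩⟩
  · rw [← hQ t ht x y, norm_mul]
    gcongr
    exact hmin ⟨ht, hx, hy⟩

end Polynomial

/-! ### From close coefficients to close functions -/

section Comparison

variable {T S θ : ℝ} (hT : 0 ≤ T) {D D₀ : PowerSeries C(Icc 0 T, ℂ)}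

theorem summable_of_tsum_ofReal_le {x : ℕ → ℝ} (hx : ∀ j, 0 ≤ x j)
    (h : ∑' j, ENNReal.ofReal (x j) ≤ ENNReal.ofReal θ) : Summable x := by
  refine (ENNReal.summable_toReal (ne_top_of_le_ne_top ENNReal.ofReal_ne_top h)).congr fun j => ?_
  rw [ENNReal.toReal_ofReal (hx j)]

theorem tsum_le_of_tsum_ofReal_le {x : ℕ → ℝ} (hx : ∀ j, 0 ≤ x j) (hθ : 0 ≤ θ)
    (h : ∑' j, ENNReal.ofReal (x j) ≤ ENNReal.ofReal θ) : ∑' j, x j ≤ θ := by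
  rwa [← ENNReal.ofReal_tsum_of_nonneg hx (summable_of_tsum_ofReal_le hx h),
    ENNReal.ofReal_le_ofReal_iff hθ] at h

/-- The derivatives of functions with nearby coefficients are uniformly close. -/
theorem norm_deriv_antiFun_sub_le (hS : 0 < S) (hθ : 0 ≤ θ)
    (hD : Summable fun j => ‖coeff j D‖ * S ^ j) (hD₀ : Summable fun j => ‖coeff j D₀‖ * S ^ j)
    (h : ∑' j, ENNReal.ofReal (‖coeff j (D - D₀)‖ * S ^ j) ≤ ENNReal.ofReal θ) (t : Icc 0 T)
    {ξ : ℂ} (hξ : ‖ξ‖ < S) :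
    ‖deriv (antiFun hT D t) ξ - deriv (antiFun hT D₀ t) ξ‖ ≤ θ := by
  have hpos : ∀ j, 0 ≤ ‖coeff j (D - D₀)‖ * S ^ j := fun j => by positivity
  rw [deriv_antiFun hT hS hD t hξ, deriv_antiFun hT hS hD₀ t hξ]
  have hat : ∀ {V : PowerSeries C(Icc 0 T, ℂ)}, (Summable fun j => ‖coeff j V‖ * S ^ j) →
      Summable fun j => ‖coeff j (atTime t V)‖ * S ^ j := fun hV =>
    Summable.of_nonneg_of_le (fun j => by positivity) (fun j => by
      rw [coeff_atTime]
      gcongr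
      exact ContinuousMap.norm_coe_le_norm _ _) hV
  unfold psum
  rw [← (summable_psum (hat hD) hξ.le).tsum_sub (summable_psum (hat hD₀) hξ.le)]
  refine (tsum_of_norm_bounded (summable_of_tsum_ofReal_le hpos h).hasSum fun j => ?_).trans
    (tsum_le_of_tsum_ofReal_le hpos hθ h)
  rw [← sub_mul, norm_mul, norm_pow, coeff_atTime, coeff_atTime, ← ContinuousMap.sub_apply,
    ← map_sub]
  gcongr
  exact ContinuousMap.norm_coe_le_norm _ _

/-- Through this bound, differentiating n times costs a factor n! and a doubling of the radius. -/
theorem descFactorial_le (i n : ℕ) : (i + n).descFactorial n ≤ n.factorial * 2 ^ (i + n) := by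
  rw [Nat.descFactorial_eq_factorial_mul_choose]
  exact Nat.mul_le_mul_left _ (Nat.choose_le_two_pow _ _)

/-- The norm `|·|_{M(r)}` of the `n`-th derivative in terms of the coefficients. -/
theorem normM_iteratedDeriv_sub_le {r : ℝ} (hr : 1 ≤ r) {g₁ g₂ : ℂ → ℂ} (h₁ : AnalyticAt ℂ g₁ 0)
    (h₂ : AnalyticAt ℂ g₂ 0) (n : ℕ) :
    normM r (fun ξ => iteratedDeriv n g₁ ξ - iteratedDeriv n g₂ ξ) ≤
      ENNReal.ofReal n.factorial *
        ∑' m, ENNReal.ofReal (‖taylorCoeff g₁ m - taylorCoeff g₂ m‖ * (2 * r) ^ m) := by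
  have hr0 : 0 < r := by linarith
  calc normM r (fun ξ => iteratedDeriv n g₁ ξ - iteratedDeriv n g₂ ξ)
      ≤ ∑' i, ENNReal.ofReal n.factorial * ENNReal.ofReal
          (‖taylorCoeff g₁ (i + n) - taylorCoeff g₂ (i + n)‖ * (2 * r) ^ (i + n)) := by
        refine ENNReal.tsum_le_tsum fun i => ?_
        rw [← ENNReal.ofReal_mul (by positivity)]
        refine ENNReal.ofReal_le_ofReal ?_
        have a₁ : AnalyticAt ℂ (iteratedDeriv n g₁) 0 := by
          rw [iteratedDeriv_eq_iterate]; exact h₁.iterated_deriv n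
        have a₂ : AnalyticAt ℂ (iteratedDeriv n g₂) 0 := by
          rw [iteratedDeriv_eq_iterate]; exact h₂.iterated_deriv n
        rw [taylorCoeff_sub a₁ a₂, taylorCoeff_iteratedDeriv,
          taylorCoeff_iteratedDeriv, ← mul_sub, norm_mul, Complex.norm_natCast]
        have e1 : (((i + n).descFactorial n : ℕ) : ℝ) ≤ n.factorial * 2 ^ (i + n) := by
          exact_mod_cast descFactorial_le i n
        have e2 : r ^ i ≤ r ^ (i + n) := pow_le_pow_right₀ hr (Nat.le_add_right _ _)
        calc (((i + n).descFactorial n : ℕ) : ℝ) *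
              ‖taylorCoeff g₁ (i + n) - taylorCoeff g₂ (i + n)‖ * r ^ i
            ≤ (n.factorial * 2 ^ (i + n)) *
              ‖taylorCoeff g₁ (i + n) - taylorCoeff g₂ (i + n)‖ * r ^ (i + n) := by gcongr
          _ = _ := by rw [mul_pow]; ring
    _ = ENNReal.ofReal n.factorial * ∑' i, ENNReal.ofReal
          (‖taylorCoeff g₁ (i + n) - taylorCoeff g₂ (i + n)‖ * (2 * r) ^ (i + n)) :=
        ENNReal.tsum_mul_left
    _ ≤ _ := by
        refine mul_le_mul_right ?_ _
        exact ENNReal.tsum_comp_le_tsum_of_injective (add_left_injective n) (fun m =>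
          ENNReal.ofReal (‖taylorCoeff g₁ m - taylorCoeff g₂ m‖ * (2 * r) ^ m))

/-- Integration in ξ divides coefficients by j + 1 ≥ 1, and the shift of the index costs one factor
S. -/
theorem tsum_antiCoeff_sub_le (hS : 0 ≤ S)
    (h : ∑' j, ENNReal.ofReal (‖coeff j (D - D₀)‖ * S ^ j) ≤ ENNReal.ofReal θ) (t : Icc 0 T) :
    ∑' m, ENNReal.ofReal (‖antiCoeff hT D₀ m t - antiCoeff hT D m t‖ * S ^ m) ≤
      ENNReal.ofReal (S * θ) := by
  rw [tsum_eq_zero_add' ENNReal.summable]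
  have h0 : ENNReal.ofReal (‖antiCoeff hT D₀ 0 t - antiCoeff hT D 0 t‖ * S ^ 0) = 0 := by
    simp [antiCoeff]
  rw [h0, zero_add, ENNReal.ofReal_mul hS]
  refine le_trans ?_ (mul_le_mul_right h _)
  rw [← ENNReal.tsum_mul_left]
  refine ENNReal.tsum_le_tsum fun j => ?_
  rw [← ENNReal.ofReal_mul hS]
  refine ENNReal.ofReal_le_ofReal ?_
  have h1 : ‖antiCoeff hT D₀ (j + 1) t - antiCoeff hT D (j + 1) t‖ ≤ ‖coeff j (D - D₀)‖ := by
    simp only [antiCoeff, if_neg (Nat.succ_ne_zero j), Nat.add_sub_cancel, IccExtend_val]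
    rw [← sub_div, norm_div, Complex.norm_natCast]
    have h2 : (1 : ℝ) ≤ ((j + 1 : ℕ) : ℝ) := by exact_mod_cast Nat.succ_pos j
    refine (div_le_self (norm_nonneg _) h2).trans ?_
    rw [norm_sub_rev, ← ContinuousMap.sub_apply, ← map_sub]
    exact ContinuousMap.norm_coe_le_norm _ _
  calc _ ≤ ‖coeff j (D - D₀)‖ * S ^ (j + 1) := by gcongr
    _ = _ := by ring

end Comparison

/-- A small perturbation, with respect to derivatives, of a function with bounded inverse
difference quotients is injective. -/
theorem injOn_of_norm_deriv_sub_le {g₁ g₂ : ℂ → ℂ} {r c θ : ℝ} (hθ : θ < c)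
    (h₁ : DifferentiableOn ℂ g₁ (Metric.ball 0 r)) (h₂ : DifferentiableOn ℂ g₂ (Metric.ball 0 r))
    (hlow : ∀ x ∈ Metric.ball (0 : ℂ) r, ∀ y ∈ Metric.ball (0 : ℂ) r,
      c * ‖x - y‖ ≤ ‖g₁ x - g₁ y‖)
    (hd : ∀ x ∈ Metric.ball (0 : ℂ) r, ‖deriv g₂ x - deriv g₁ x‖ ≤ θ) :
    InjOn g₂ (Metric.ball 0 r) := by
  intro x hx y hy hxy
  have hnhds : ∀ z ∈ Metric.ball (0 : ℂ) r, Metric.ball (0 : ℂ) r ∈ 𝓝 z := fun z hz =>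
    Metric.isOpen_ball.mem_nhds hz
  have hL := (convex_ball (0 : ℂ) r).norm_image_sub_le_of_norm_hasDerivWithin_le
    (f := fun z => g₂ z - g₁ z) (f' := fun z => deriv g₂ z - deriv g₁ z) (C := θ)
    (fun z hz => (((h₂.differentiableAt (hnhds z hz)).hasDerivAt.sub
      (h₁.differentiableAt (hnhds z hz)).hasDerivAt)).hasDerivWithinAt) hd hy hx
  have h3 := hlow x hx y hy
  have h4 : g₂ x - g₁ x - (g₂ y - g₁ y) = -(g₁ x - g₁ y) := by rw [hxy]; ring
  simp only [h4, norm_neg] at hL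
  by_contra hne
  have h5 : 0 < ‖x - y‖ := norm_pos_iff.2 (sub_ne_zero.2 hne)
  nlinarith

end HeleShaw

end

/-! ### The main theorem -/

theorem theorem1
    (σ : ℝ) (hσ : σ = 1 ∨ σ = -1)
    (k₀ : ℕ) (T₀ r : ℝ) (hT₀ : 0 < T₀) (hr : 1 < r)
    (P : ℝ → Polynomial ℂ)
    (hdeg : ∀ t ∈ Set.Icc 0 T₀, (P t).natDegree = k₀)
    (hsol : HeleShaw.IsStrongSolution σ (Set.Icc 0 T₀) (fun t ξ => (P t).eval ξ))
    (hO : ∀ t ∈ Set.Icc 0 T₀,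
      HeleShaw.InO (Metric.closedBall 0 r) (fun ξ => (P t).eval ξ))
    (ε : ℝ) (hε : 0 < ε) (k : ℕ) (r' : ℝ) (hr' : 1 < r') (hr'r : r' < r) :
    ∃ δ > (0 : ℝ), ∃ ρ > (1 : ℝ),
      ∀ f₀ : ℂ → ℂ, AnalyticOnNhd ℂ f₀ (Metric.closedBall 0 1) →
        f₀ 0 = 0 → 0 < (deriv f₀ 0).re → (deriv f₀ 0).im = 0 →
        HeleShaw.normRho ρ k (fun ξ => f₀ ξ - (P 0).eval ξ) < ENNReal.ofReal δ →
        ∃ f : ℝ → ℂ → ℂ,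
          HeleShaw.IsStrongSolution σ (Set.Icc 0 T₀) f ∧
          Set.EqOn (f 0) f₀ (Metric.closedBall 0 1) ∧
          (∀ t ∈ Set.Icc 0 T₀, HeleShaw.InO (Metric.closedBall 0 r') (f t)) ∧
          HeleShaw.IsC1InH (Metric.ball 0 r) (Set.Icc 0 T₀) f ∧
          (∀ n ≤ k, ∀ t ∈ Set.Icc 0 T₀,
            HeleShaw.normM r (fun ξ => iteratedDeriv n (fun z => (P t).eval z) ξ -
              iteratedDeriv n (f t) ξ) < ENNReal.ofReal ε) ∧
          -- `f` is the only strong solution with the initial function `f₀`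
          (∀ b > (0 : ℝ), ∀ g : ℝ → ℂ → ℂ,
            HeleShaw.IsStrongSolution σ (Set.Ico 0 b) g →
            Set.EqOn (g 0) f₀ (Metric.closedBall 0 1) →
            ∀ t ∈ Set.Ico 0 b, t ≤ T₀ → Set.EqOn (g t) (f t) (Metric.closedBall 0 1)) := by
  open HeleShaw PowerSeries in
  have hσ1 : |σ| ≤ 1 := by rcases hσ with rfl | rfl <;> simp
  have hT := hT₀.le
  have hr0 : 0 < r := by linarith
  have h0I : (0 : ℝ) ∈ Icc 0 T₀ := left_mem_Icc.2 hT
  -- the polynomial solution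
  have hPd : ∀ t, Differentiable ℂ fun ξ => (P t).eval ξ := fun t => (P t).differentiable
  obtain ⟨w₀, hder₀, -⟩ := hsol.exists_deriv_taylorCoeff hT₀
  obtain ⟨c, hc, M, hcM⟩ := exists_bounds_polynomial hT hr0.le (fun t ht => (hdeg t ht).le)
    (fun n t ht => by
      have := (hder₀ t ht n).continuousWithinAt
      simpa only [taylorCoeff_eval] using this)
    (fun t ht => by
      obtain ⟨⟨U, -, hEU, -, hi⟩, -⟩ := hO t ht
      exact hi.mono hEU)
    (fun t ht ξ hξ => (hO t ht).deriv_ne_zero hξ)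
  obtain ⟨D₀, q₀, hq₀, hD₀, hDB₀, hqB₀, hint₀⟩ := hsol.exists_powerSeries (B := max M c⁻¹) hT₀ hr
    (fun t _ => ⟨r + 1, by linarith, (hPd t).differentiableOn⟩)
    (fun t ht ξ hξ => (hO t ht).deriv_ne_zero (by simpa using hξ))
    (fun t ht ξ hξ => by
      have h1 := (hcM t ht ξ (by simpa using hξ.le)).1
      refine ⟨h1.2.trans (le_max_left _ _), le_max_of_le_right ?_⟩
      rw [norm_inv]
      exact inv_anti₀ hc h1.1)
  have hq₀l : l1norm q₀ ≠ ⊤ := by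
    refine l1norm_ne_top_of_summable (Summable.of_nonneg_of_le (fun _ => norm_nonneg _) hqB₀ ?_)
    have := (summable_geometric_of_lt_one (inv_nonneg.2 hr0.le)
      (inv_lt_one_of_one_lt₀ hr)).mul_left (max M c⁻¹)
    simpa [div_eq_mul_inv] using this
  have hD₀c : ∀ j (t : Icc 0 T₀), coeff j D₀ t = ((j : ℂ) + 1) * (P t).coeff (j + 1) := by
    intro j t
    rw [hD₀, taylorCoeff_deriv, taylorCoeff_eval]
  have hD₀z : ∀ j, k₀ ≤ j → coeff j D₀ = 0 := by
    intro j hj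
    ext t
    rw [hD₀c, Polynomial.coeff_eq_zero_of_natDegree_lt (by rw [hdeg t t.2]; omega), mul_zero]
    rfl
  -- A constant polynomial would violate P'(0) ≠ 0.
  have hk₀ : 1 ≤ k₀ := by
    by_contra hk
    have h1 := hD₀c 0 ⟨0, h0I⟩
    rw [hD₀z 0 (by omega)] at h1
    have h2 : taylorCoeff (fun ξ => (P 0).eval ξ) 1 = 0 := by
      rw [taylorCoeff_eval]
      simpa using h1.symm
    rw [taylorCoeff_one] at h2
    exact (hO 0 h0I).deriv_ne_zero (by simpa using hr0.le) h2
  have hD₀s : ∀ S : ℝ, Summable fun j => ‖coeff j D₀‖ * S ^ j := fun S =>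
    summable_of_ne_finset_zero (s := Finset.range k₀) fun j hj => by
      rw [hD₀z j (by simpa using hj), norm_zero, zero_mul]
  have hPanti : ∀ (t : Icc 0 T₀) n, antiCoeff hT D₀ n t = (P t).coeff n := by
    intro t n
    cases n with
    | zero =>
      have h1 := (hO t t.2).apply_zero
      simp only [antiCoeff, if_true]
      rw [← taylorCoeff_eval, taylorCoeff_zero, h1]
    | succ j =>
      rw [antiCoeff, if_neg (Nat.succ_ne_zero j), Nat.add_sub_cancel, IccExtend_val, hD₀c]
      have : ((j : ℂ) + 1) ≠ 0 := by exact_mod_cast Nat.succ_ne_zero j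
      push_cast
      field_simp
  have hPfun : ∀ t : Icc 0 T₀, antiFun hT D₀ t = fun ξ => (P t).eval ξ := by
    intro t
    funext ξ
    rw [← psum_taylorSeries (f := fun ξ => (P t).eval ξ) (hPd t).differentiableOn
      (lt_add_one ‖ξ‖)]
    unfold antiFun psum
    refine tsum_congr fun n => ?_
    rw [coeff_mk, coeff_taylorSeries, taylorCoeff_eval, hPanti]
  -- constants
  set S := 2 * r with hS
  have hS1 : 1 < S := by linarith
  have hS0 : 0 < S := by linarith
  have hrS : r < S := by linarith
  -- The first bound keeps the difference quotients away from 0; the second pays for k derivatives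
  -- and the index shift. The radius S = 2r absorbs the doubling caused by differentiation.
  set θ := min (c / 2) (ε / (2 * (k.factorial * S))) with hθdef
  have hθ : 0 < θ := by positivity
  have hθc : θ < c := (min_le_left _ _).trans_lt (by linarith)
  have hθε : k.factorial * (S * θ) < ε := by
    have h1 : θ ≤ ε / (2 * (k.factorial * S)) := min_le_right _ _
    rw [le_div_iff₀ (by positivity)] at h1
    nlinarith
  obtain ⟨s₀, hs₀, δ, hδ, hex⟩ := exists_coeff_solution hT (star_constC 0 T₀ σ)
    (enorm_constC_le hσ1) hq₀ hq₀l hk₀ hD₀z hS1.le hθ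
  have hs₀1 : 1 < s₀ := hS1.trans_le hs₀
  -- Passing to the coefficients of f₀' brings in j + 1 ≤ 2^(j+1), hence the doubled radius; the
  -- power weight of the norm is at least 1 and is not needed.
  refine ⟨δ, hδ, 2 * s₀, by linarith, fun f₀ hf₀ hf₀0 hf₀re hf₀im hsmall => ?_⟩
  have hf₀a : AnalyticAt ℂ f₀ 0 := hf₀ 0 (by simp)
  have hPa : ∀ t, AnalyticAt ℂ (fun ξ => (P t).eval ξ) 0 := fun t =>
    (hPd t).analyticAt 0
  let v : ℕ → ℂ := fun j => ((j : ℂ) + 1) * taylorCoeff (fun ξ => f₀ ξ - (P 0).eval ξ) (j + 1)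
  have hv : ∑' j, ENNReal.ofReal (‖v j‖ * s₀ ^ j) ≤ ENNReal.ofReal δ := by
    refine le_trans (ENNReal.tsum_le_tsum fun j => ENNReal.ofReal_le_ofReal ?_) hsmall.le
    have e1 : ‖((j : ℂ) + 1)‖ = (j : ℝ) + 1 := by
      have : ((j : ℂ) + 1) = ((j + 1 : ℕ) : ℂ) := by push_cast; rfl
      rw [this, Complex.norm_natCast]; push_cast; rfl
    have e2 : ((j : ℝ) + 1) ≤ 2 ^ (j + 1) := by
      have := (Nat.lt_two_pow_self (n := j + 1)).le
      exact_mod_cast this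
    have e3 : (1 : ℝ) ≤ ((j : ℝ) + 1) ^ ((1 : ℝ) / 2 + (k : ℝ)) :=
      Real.one_le_rpow (by linarith [(Nat.cast_nonneg j : (0 : ℝ) ≤ j)]) (by positivity)
    have e4 : s₀ ^ j ≤ s₀ ^ (j + 1) := pow_le_pow_right₀ hs₀1.le (Nat.le_succ j)
    simp only [v]
    rw [norm_mul, e1]
    set y := ‖taylorCoeff (fun ξ => f₀ ξ - (P 0).eval ξ) (j + 1)‖ with hy
    calc ((j : ℝ) + 1) * y * s₀ ^ j ≤ 2 ^ (j + 1) * y * s₀ ^ (j + 1) := by gcongr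
      _ = y * (2 * s₀) ^ (j + 1) := by rw [mul_pow]; ring
      _ ≤ y * (2 * s₀) ^ (j + 1) * ((j : ℝ) + 1) ^ ((1 : ℝ) / 2 + (k : ℝ)) :=
        le_mul_of_one_le_right (by positivity) e3
  obtain ⟨D, q, hq, -, hql, hDeq, hclose⟩ := hex v hv
  have hDs : Summable fun j => ‖coeff j D‖ * S ^ j := by
    have h1 := summable_of_tsum_ofReal_le (fun j => by positivity) hclose
    refine Summable.of_nonneg_of_le (fun j => by positivity) (fun j => ?_) (h1.add (hD₀s S))
    rw [← add_mul]
    gcongr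
    have : coeff j D = coeff j (D - D₀) + coeff j D₀ := by rw [map_sub, sub_add_cancel]
    conv_lhs => rw [this]
    exact norm_add_le _ _
  -- The fixed point equation is relative to D₀; adding the integral equation of the polynomial
  -- solution cancels `rhs` of D₀.
  have hDcoef : ∀ j t, coeff j D t = coeff j D₀ ⟨0, h0I⟩ + v j +
      coeff j (primSeries hT (rhs (constC 0 T₀ σ) D)) t := by
    intro j t
    have h1 := congrArg (fun x : PowerSeries C(Icc 0 T₀, ℂ) => (coeff j x : C(Icc 0 T₀, ℂ)) t) hDeq
    simp only [map_add, primSeries_sub, map_sub, coeff_mk, ContinuousMap.add_apply,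
      ContinuousMap.sub_apply, ContinuousMap.const_apply] at h1
    rw [h1, hint₀ j t]
    ring
  have hDzero : ∀ j, coeff j D ⟨0, h0I⟩ = coeff j D₀ ⟨0, h0I⟩ + v j := by
    intro j
    rw [hDcoef, coeff_primSeries, ContinuousMap.mul_apply, prim_apply,
      intervalIntegral.integral_same, mul_zero, add_zero]
  have hDint : ∀ j t, coeff j D t = coeff j D ⟨0, h0I⟩ +
      coeff j (primSeries hT (rhs (constC 0 T₀ σ) D)) t := by
    intro j t
    rw [hDzero, hDcoef]
  have hinit : ∀ j, coeff j D ⟨0, h0I⟩ = ((j : ℂ) + 1) * taylorCoeff f₀ (j + 1) := by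
    intro j
    rw [hDzero, hD₀c]
    simp only [v]
    rw [taylorCoeff_sub hf₀a (hPa 0), taylorCoeff_eval]
    ring
  -- the solution
  have hfd : ∀ t, DifferentiableOn ℂ (antiFun hT D t) (Metric.ball 0 S) := fun t =>
    differentiableOn_antiFun hT hS0.le hDs t
  have hfa : ∀ t, AnalyticAt ℂ (antiFun hT D t) 0 := fun t =>
    (hfd t).analyticAt (Metric.ball_mem_nhds 0 hS0)
  have hsub : Metric.ball (0 : ℂ) r ⊆ Metric.ball 0 S := Metric.ball_subset_ball hrS.le
  have hC1 := (hasContTimeDeriv_antiFun hT hS0.le hDs (summable_rhs hσ1 hS1.le hq hql hDs)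
    hDint).mono hsub subset_rfl
  have hdclose : ∀ (t : Icc 0 T₀) (ξ : ℂ), ‖ξ‖ < S →
      ‖deriv (antiFun hT D t) ξ - deriv (fun ξ => (P t).eval ξ) ξ‖ ≤ θ := by
    intro t ξ hξ
    rw [← hPfun t]
    exact norm_deriv_antiFun_sub_le hT hS0 hθ.le hDs (hD₀s S) hclose t hξ
  have hinO : ∀ t ∈ Icc 0 T₀, InO (Metric.closedBall 0 r') (antiFun hT D t) := by
    intro t ht
    have hball : ∀ {x : ℂ}, x ∈ Metric.ball (0 : ℂ) r → x ∈ Metric.closedBall (0 : ℂ) r :=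
      fun hx => Metric.ball_subset_closedBall hx
    have hd0 : deriv (antiFun hT D t) 0 = coeff 0 D ⟨t, ht⟩ := by
      rw [← taylorCoeff_one, taylorCoeff_antiFun hT hS0 hDs, antiCoeff, if_neg one_ne_zero]
      simp [IccExtend_of_mem hT _ ht]
    refine ⟨⟨Metric.ball 0 r, Metric.isOpen_ball, Metric.closedBall_subset_ball hr'r,
      (hfd t).mono hsub, ?_⟩, ?_, ?_, ?_⟩
    · exact injOn_of_norm_deriv_sub_le hθc (hPd t).differentiableOn ((hfd t).mono hsub)
        (fun x hx y hy => (hcM t ht x (hball hx)).2 y (hball hy))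
        (fun x hx => hdclose ⟨t, ht⟩ x ((mem_ball_zero_iff.1 hx).trans hrS))
    · rw [← taylorCoeff_zero (antiFun hT D t), taylorCoeff_antiFun hT hS0 hDs, antiCoeff, if_pos rfl]
    -- The derivative of the polynomial at 0 is real and at least c, and θ < c, so positivity
    -- survives.
    · have h1 := hdclose ⟨t, ht⟩ 0 (by simpa using hS0)
      have h2 := (hcM t ht 0 (by simpa using hr0.le)).1.1
      obtain ⟨-, -, h3, h4⟩ := hO t ht
      have h5 : ‖deriv (fun ξ => (P t).eval ξ) 0‖ = (deriv (fun ξ => (P t).eval ξ) 0).re := by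
        rw [← Complex.abs_re_eq_norm.2 h4, abs_of_pos h3]
      have h6 := (Complex.abs_re_le_norm _).trans h1
      rw [Complex.sub_re] at h6
      have h7 := (abs_le.1 h6).1
      linarith
    · rw [hd0]
      refine im_coeff_zero_eq_zero (σ := σ) hT hq hDint ?_ ⟨t, ht⟩
      rw [hinit]
      simpa [taylorCoeff_one] using hf₀im
  have hstrong : IsStrongSolution σ (Icc 0 T₀) (antiFun hT D) := by
    refine ⟨fun t ht => ?_, _, fun t ht => ⟨r, hr, 1, one_pos, hC1.mono subset_rfl
      inter_subset_left⟩, fun t ht ξ hξ => boundary_equation hT hσ1 hS1 hq hql hDs ⟨t, ht⟩ hξ⟩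
    obtain ⟨⟨U, hU, hEU, h1⟩, h2⟩ := hinO t ht
    exact ⟨⟨U, hU, (Metric.closedBall_subset_closedBall hr'.le).trans hEU, h1⟩, h2⟩
  have htaylor0 : ∀ n, taylorCoeff (antiFun hT D 0) n = taylorCoeff f₀ n := by
    intro n
    rw [taylorCoeff_antiFun hT hS0 hDs]
    cases n with
    | zero => rw [taylorCoeff_zero, hf₀0, antiCoeff, if_pos rfl]
    | succ j =>
      rw [antiCoeff, if_neg (Nat.succ_ne_zero j), Nat.add_sub_cancel, IccExtend_of_mem hT _ h0I,
        hinit]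
      have : ((j : ℂ) + 1) ≠ 0 := by exact_mod_cast Nat.succ_ne_zero j
      push_cast
      field_simp
  refine ⟨antiFun hT D, hstrong, ?_, hinO, ⟨_, hC1⟩, fun n hn t ht => ?_, ?_⟩
  -- Equal Taylor coefficients at 0 give equality on the closed disk once f₀ is analytic in a disk
  -- of radius above 1.
  · obtain ⟨R, hR, hR'⟩ : ∃ R > (1 : ℝ), DifferentiableOn ℂ f₀ (Metric.ball 0 R) := by
      have hopen : IsOpen {z | AnalyticAt ℂ f₀ z} := isOpen_analyticAt ℂ f₀
      obtain ⟨η, hη, hthick⟩ := (isCompact_closedBall (0 : ℂ) 1).exists_cthickening_subset_open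
        hopen hf₀
      rw [cthickening_closedBall hη.le zero_le_one] at hthick
      exact ⟨η + 1, by linarith, fun z hz =>
        (hthick (Metric.ball_subset_closedBall hz)).differentiableAt.differentiableWithinAt⟩
    intro ξ hξ
    have hξ' : ‖ξ‖ ≤ 1 := by simpa using hξ
    have h1 := hasSum_taylorCoeff (hfd 0) (hξ'.trans_lt hS1)
    refine h1.unique ((hasSum_taylorCoeff hR' (hξ'.trans_lt hR)).congr_fun fun n => ?_)
    rw [htaylor0]
  · refine (normM_iteratedDeriv_sub_le hr.le (hPa t) (hfa t) n).trans_lt ?_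
    have h1 := tsum_antiCoeff_sub_le hT hS0.le hclose ⟨t, ht⟩
    have hP' : ∀ m, antiCoeff hT D₀ m t = taylorCoeff (fun ξ => (P t).eval ξ) m := fun m => by
      rw [taylorCoeff_eval]; exact hPanti ⟨t, ht⟩ m
    simp only [hP', ← taylorCoeff_antiFun hT hS0 hDs] at h1
    have h2 : ((n.factorial : ℕ) : ℝ) ≤ k.factorial := by
      exact_mod_cast Nat.factorial_le hn
    refine (mul_le_mul' (ENNReal.ofReal_le_ofReal h2) h1).trans_lt ?_
    rw [← ENNReal.ofReal_mul (by positivity)]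
    exact (ENNReal.ofReal_lt_ofReal_iff hε).2 hθε
  · intro b hb g hg hg0 t ht htT
    have hsubI : Icc 0 t ⊆ Ico 0 b := fun x hx => ⟨hx.1, hx.2.trans_lt ht.2⟩
    refine (hg.mono hsubI).eqOn_of_eqOn_zero ht.1 (hstrong.mono (Icc_subset_Icc_right htT)) hσ1
      (fun n => ?_) t ⟨ht.1, le_rfl⟩
    rw [htaylor0]
    refine taylorCoeff_congr ?_ n
    filter_upwards [Metric.closedBall_mem_nhds (0 : ℂ) one_pos] with ξ hξ using hg0 hξ
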